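/- Let $K\ge 2$. A memoryless $K$-user interference channel consists of input alphabets $\mathcal X_1,\dots,\mathcal X_K$ (arbitrary measurable spaces), output alphabets $\mathcal Y_1,\dots,\mathcal Y_K$ (nonempty standard Borel spaces) and a Markov kernel $P_{Y_1\ldots Y_K|X_1\ldots X_K}$, used $n$ times without memory. Source $k$ encodes its own message $W_k$ into $\mathcal X_k^n$; the messages are independent and $W_k$ is uniform on the integers in $[1,e^{nR_k}]$; destination $k$ decodes $W_k$ from $Y_k^n$. A tuple $(R_1,\dots,R_K)$ of nonnegative rates is achievable if there are codes of all block lengths $n$ for which the error probability of each user tends to $0$ as $n\to\infty$. The capacity region $\mathcal C$ is the closure of the convex hull of the set of achievable rate tuples. Entropies and mutual informations are in nats. Fix $\sigma$-finite reference measures $\nu_k$ on $\mathcal Y_k$; entropies on $\mathcal Y_k$ are taken relative to $\nu_k$ (Shannon entropy for the counting measure of a countable alphabet, differential entropy for Lebesgue measure). Let $\mathcal O$ be the union, over all input distributions $P_Q\prod_{k=1}^K P_{X_k|Q}$ (with $Q$ having finitely many values), of the sets of $(R_1,\dots,R_K)\in\mathbb R^K$ that satisfy the following two bounds for every $\mathcal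 S\subseteq\{1,\dots,K\}$, with elements $s_1<\dots<s_m$, and every ordering $\pi=(\pi_1,\dots,\pi_m)$ of $\mathcal S$: (a) $$\sum_{u\in\mathcal S}R_u\le\sum_{k=1}^{m} I\big(Y_{\pi_k};X_{\pi_k},\dots,X_{\pi_m}\,\big|\,X_{\pi_1},\dots,X_{\pi_{k-1}},Y_{\pi_1},\dots,Y_{\pi_{k-1}},(X_u)_{u\notin\mathcal S},Q\big);$$ (b) $$\sum_{u\in\mathcal S}R_u\le\sum_{k=1}^{m}\Big[H\big(Y_{s_k}\,\big|\,Y_{\backslash\pi_k},X'_{\pi_k}\big)-H\big(Y_{\backslash\pi_k}\,\big|\,Y_{s_k},X_1,\dots,X_K,X'_{\pi_k}\big)\Big].$$ In (b), $Y_{\backslash j}$ is a copy of output $j$ conditioned on its intended input: given $Q$, the variable $X'_j$ is an independent copy of $X_j$, independent of $(X_1,\dots,X_K)$, and $Y_{\backslash j}$ is distributed as the output of user $j$ when its intended input is $X'_j$ and the interfering inputs are $X_i$, $i\ne j$. The conditional joint law of $(Y_{s_k},Y_{\backslash\pi_k})$ given $(X_1,\dots,X_K,X'_{\pi_k})$ (and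 not depending on $Q$) may be any one with these two marginals; (b) is imposed for every such choice for which all the entropies in (b) exist and are finite. Then $\mathcal C\subseteq\overline{\mathcal O}$, and if all the input alphabets are finite, then $\mathcal C\subseteq\mathcal O$. -/

import Mathlib

open MeasureTheory ProbabilityTheory Filter Topology
open scoped ENNReal

noncomputable section

namespace InterferenceChannel

/-! ### Information measures (in nats) -/

section Information

variable {Ω α β γ : Type*} [MeasurableSpace Ω] [MeasurableSpace α] [MeasurableSpace β]
  [MeasurableSpace γ]

/-- The conditional mutual information `I(B; A | C)` of three random variables, with values in
`[0, ∞]`: the Kullback-Leibler divergence of the joint law of `((A, C), B)` from the law under which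
`(A, C)` keeps its law and `B` is drawn from its conditional law given `C` alone. -/
def condMutualInfo [StandardBorelSpace β] [Nonempty β] (μ : Measure Ω) [IsFiniteMeasure μ]
    (B : Ω → β) (A : Ω → α) (C : Ω → γ) : ℝ≥0∞ :=
  InformationTheory.klDiv (μ.map fun ω => ((A ω, C ω), B ω))
    ((μ.map fun ω => (A ω, C ω)) ⊗ₘ Kernel.prodMkLeft α (condDistrib B C μ))

/-- The conditional entropy `H(B | C)` relative to a reference measure `ν` on the alphabet of `B`,
i.e. `- E[log p(B | C)]` where `p(b | c)` is the conditional density of `B` with respect to `ν`.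
It is the Shannon entropy if `ν` is the counting measure of a countable alphabet, and the
differential entropy if `ν` is Lebesgue measure. -/
def condEntropy (μ : Measure Ω) (ν : Measure β) (B : Ω → β) (C : Ω → γ) : ℝ :=
  -∫ z, llr (μ.map fun ω => (C ω, B ω)) ((μ.map C).prod ν) z ∂(μ.map fun ω => (C ω, B ω))

/-- The conditional entropy `H(B | C)` relative to `ν` exists and is finite: the conditional
density exists, and its logarithm is integrable. -/
def HasCondEntropy (μ : Measure Ω) (ν : Measure β) (B : Ω → β) (C : Ω → γ) : Prop :=
  (μ.map fun ω => (C ω, B ω)) ≪ (μ.map C).prod ν ∧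
    Integrable (llr (μ.map fun ω => (C ω, B ω)) ((μ.map C).prod ν)) (μ.map fun ω => (C ω, B ω))

end Information

/-! ### Codes and the capacity region

A memoryless interference channel with `K` users is a Markov kernel `W` from the product of the
input alphabets to the product of the output alphabets. -/

section Capacity

variable {K : ℕ} {X Y : Fin K → Type*} [∀ k, MeasurableSpace (X k)] [∀ k, MeasurableSpace (Y k)]

/-- A code of block length `n` with `M k` messages for user `k`. Transmitter `k` sees only its own
message, and receiver `k` sees only its own output. -/
structure Code (X Y : Fin K → Type*) [∀ k, MeasurableSpace (Y k)] (n : ℕ) (M : Fin K → ℕ) where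
  enc : ∀ k, Fin (M k) → Fin n → X k
  dec : ∀ k, (Fin n → Y k) → Fin (M k)
  measurable_dec : ∀ k, Measurable (dec k)

/-- The probability that receiver `k` decodes its message wrongly, when the messages are
independent and uniformly distributed and the channel is used `n` times without memory. -/
def Code.errorProb {n : ℕ} {M : Fin K → ℕ} (c : Code X Y n M)
    (W : Kernel (∀ k, X k) (∀ k, Y k)) (k : Fin K) : ℝ :=
  (∑ w : ∀ i, Fin (M i),
    (Measure.pi fun t : Fin n => W fun i => c.enc i (w i) t).real
      {y | c.dec k (fun t => y t k) ≠ w k}) / ∏ i, (M i : ℝ)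

/-- The rate tuple `R` is achievable. The message set of user `k` at block length `n` consists of
the integers in the interval from `1` to `exp (n * R k)`. -/
def Achievable (W : Kernel (∀ k, X k) (∀ k, Y k)) (R : Fin K → ℝ) : Prop :=
  (∀ k, 0 ≤ R k) ∧
    ∃ c : ∀ n : ℕ, Code X Y n (fun k => ⌊Real.exp (n * R k)⌋₊),
      ∀ k, Tendsto (fun n => (c n).errorProb W k) atTop (𝓝 0)

/-- The capacity region: the convex closure of the set of achievable rate tuples. -/
def capacityRegion (W : Kernel (∀ k, X k) (∀ k, Y k)) : Set (Fin K → ℝ) :=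
  closure (convexHull ℝ {R | Achievable W R})

end Capacity

/-! ### The outer bound -/

section OuterBound

variable {K : ℕ}

/-- An input distribution `P_Q ∏ₖ P_{Xₖ|Q}` with a time-sharing variable `Q` that has finitely many
values. -/
structure InputLaw (X : Fin K → Type*) [∀ k, MeasurableSpace (X k)] where
  card : ℕ
  law : ProbabilityMeasure (Fin card)
  input : Fin card → ∀ k, ProbabilityMeasure (X k)

variable {X Y : Fin K → Type*} [∀ k, MeasurableSpace (X k)] [∀ k, MeasurableSpace (Y k)]

/-- The conditional law of `(X₁, …, X_K)` given `Q`. -/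
def InputLaw.inputs (P : InputLaw X) : Kernel (Fin P.card) (∀ k, X k) :=
  Kernel.ofFunOfCountable fun q => Measure.pi fun k => (P.input q k : Measure (X k))

instance (P : InputLaw X) : IsMarkovKernel P.inputs :=
  ⟨fun q => by
    change IsProbabilityMeasure (Measure.pi fun k => (P.input q k : Measure (X k)))
    infer_instance⟩

/-- The conditional law of `X_j` given `Q`. -/
def InputLaw.single (P : InputLaw X) (j : Fin K) : Kernel (Fin P.card) (X j) :=
  Kernel.ofFunOfCountable fun q => (P.input q j : Measure (X j))

instance (P : InputLaw X) (j : Fin K) : IsMarkovKernel (P.single j) :=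
  ⟨fun q => by
    change IsProbabilityMeasure (P.input q j : Measure (X j))
    infer_instance⟩

/-- The joint law of `((Q, X), Y)`, where `X` is the vector of the inputs and `Y` is the vector of
the outputs. -/
def jointLaw (W : Kernel (∀ k, X k) (∀ k, Y k)) (P : InputLaw X) :
    Measure ((Fin P.card × ∀ k, X k) × ∀ k, Y k) :=
  ((P.law : Measure (Fin P.card)) ⊗ₘ P.inputs) ⊗ₘ Kernel.prodMkLeft (Fin P.card) W

instance (W : Kernel (∀ k, X k) (∀ k, Y k)) [IsMarkovKernel W] (P : InputLaw X) :
    IsProbabilityMeasure (jointLaw W P) := by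
  unfold jointLaw
  infer_instance

/-- The first family of bounds, for the users `π 0, π 1, …` of `S` in this order. The `k`-th term
is the mutual information between the output of `π k` and the inputs of `π k` and of all later
users in `S`, given the inputs and the outputs of the earlier users, the inputs of all users outside
`S`, and `Q`. -/
def KramerBound [∀ k, StandardBorelSpace (Y k)] [∀ k, Nonempty (Y k)]
    (W : Kernel (∀ k, X k) (∀ k, Y k)) [IsMarkovKernel W] (P : InputLaw X)
    (S : Finset (Fin K)) (π : Fin S.card ≃ S) (R : Fin K → ℝ) : Prop :=
  ENNReal.ofReal (∑ u ∈ S, R u) ≤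
    ∑ k : Fin S.card,
      condMutualInfo (jointLaw W P)
        (fun ω => ω.2 (π k))
        (fun ω (i : Set.Ici k) => ω.1.2 (π i))
        (fun ω =>
          ((fun i : Set.Iio k => ω.1.2 (π i)),
            (fun i : Set.Iio k => ω.2 (π i)),
            (fun u : {u : Fin K // u ∉ S} => ω.1.2 u),
            ω.1.1))

/-- A joint conditional law, given all inputs `x` and a further input `x'` of user `j`, of the output
`Y_k` produced by `x` and the output of user `j` produced when the input of user `j` is replaced by
`x'` and the other inputs are kept. Both marginals are prescribed by the channel; the dependence
between the two is arbitrary. -/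
structure OutputCoupling (W : Kernel (∀ k, X k) (∀ k, Y k)) (k j : Fin K) where
  ker : Kernel ((∀ i, X i) × X j) (Y k × Y j)
  isMarkovKernel : IsMarkovKernel ker
  map_fst : ∀ x x', (ker (x, x')).map Prod.fst = (W x).map fun y => y k
  map_snd : ∀ x x', (ker (x, x')).map Prod.snd = (W (Function.update x j x')).map fun y => y j

/-- The joint law of `((Q, (X, X'_j)), (Y_k, Y_{∖j}))`. Given `Q`, the variable `X'_j` is an
independent copy of `X_j`, independent of all inputs, and `Y_{∖j}` is the output of user `j`
with intended input `X'_j` and with the interfering inputs `X_i`, `i ≠ j`. -/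
def sideInfoLaw (W : Kernel (∀ k, X k) (∀ k, Y k)) (P : InputLaw X) {k j : Fin K}
    (C : OutputCoupling W k j) :
    Measure ((Fin P.card × (∀ i, X i) × X j) × (Y k × Y j)) :=
  ((P.law : Measure (Fin P.card)) ⊗ₘ (P.inputs ×ₖ P.single j)) ⊗ₘ
    Kernel.prodMkLeft (Fin P.card) C.ker

/-- The second family of bounds: the users of `S` in increasing order receive the side information
of the users `π 0, π 1, …`. The variable `Y_{∖j}` stands for an output conditioned on its intended
input, so that `X'_j` is among the conditioning variables of each entropy that contains `Y_{∖j}`.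
Here `ν k` is the reference measure for entropies on the alphabet of `Y k`. The bound holds for each
choice of the dependence between `Y_k` and its side information for which the entropies are
finite. -/
def EtwBound (W : Kernel (∀ k, X k) (∀ k, Y k)) (ν : ∀ k, Measure (Y k)) (P : InputLaw X)
    (S : Finset (Fin K)) (π : Fin S.card ≃ S) (R : Fin K → ℝ) : Prop :=
  ∀ C : ∀ k : Fin S.card, OutputCoupling W (S.orderEmbOfFin rfl k) (π k),
    (∀ k : Fin S.card,
      HasCondEntropy (sideInfoLaw W P (C k)) (ν (S.orderEmbOfFin rfl k))
        (fun ω => ω.2.1) (fun ω => (ω.2.2, ω.1.2.2)) ∧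
      HasCondEntropy (sideInfoLaw W P (C k)) (ν (π k))
        (fun ω => ω.2.2) (fun ω => (ω.2.1, ω.1.2.1, ω.1.2.2))) →
    ∑ u ∈ S, R u ≤
      ∑ k : Fin S.card,
        (condEntropy (sideInfoLaw W P (C k)) (ν (S.orderEmbOfFin rfl k))
            (fun ω => ω.2.1) (fun ω => (ω.2.2, ω.1.2.2)) -
          condEntropy (sideInfoLaw W P (C k)) (ν (π k))
            (fun ω => ω.2.2) (fun ω => (ω.2.1, ω.1.2.1, ω.1.2.2)))

/-- The outer region: the union over all input distributions of the sets of rate tuples that satisfy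
both bounds for each set `S` of users and each ordering `π` of `S`. -/
def outerRegion [∀ k, StandardBorelSpace (Y k)] [∀ k, Nonempty (Y k)]
    (W : Kernel (∀ k, X k) (∀ k, Y k)) [IsMarkovKernel W] (ν : ∀ k, Measure (Y k)) :
    Set (Fin K → ℝ) :=
  ⋃ P : InputLaw X, ⋂ (S : Finset (Fin K)) (π : Fin S.card ≃ S),
    {R | KramerBound W P S π R ∧ EtwBound W ν P S π R}

end OuterBound

end InterferenceChannel

end

/-! Conditional mutual information is a minimum of divergences: `I(B; A | C)` is the least value of
`D(P_{ACB} ‖ P_{AC} q)` over Markov kernels `q` from `C` to `B`, attained at the conditional law.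
Requiring the rate bounds for every `q` gives `RelaxedBounds`, on which the whole proof turns. For
fixed kernels both families are affine in the law of `Q`. In the first family `q` may depend on the
value of `Q`; in the second it may not, because the entropies in (b) are not conditioned on `Q`.

Codes obey the relaxed bounds up to a vanishing loss, with `Q` the uniform time index and the inputs
given by independent uniform messages. The engine is `fano_block`: the law of a block is compared
with a reference in which the side information is mixed over the messages and the output is drawn
letter by letter from `q`. The compensation identity leaves behind the information that the output
carries about the other messages. In the first family this pays for the side information of the next
user, and the terms telescope along `π` (`Code.kramer_total`). In the second family the side
information of user `s_k` costs exactly what user `π_k` leaves behind, and these sums agree because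
both indices run through `S` (`Code.etw_total`). Time sharing makes the set of relaxed rate tuples
convex, so its closure contains the capacity region.

Relaxed bounds imply the outer bounds. For (a), the conditional law is substituted for `q` and data
processing is applied. For (b), the divergence expands, through densities, into the two entropies
plus `E log p(Y_{s_k} | X)` minus the same quantity for the side information. The latter terms
cancel over `S`, since replacing `X_j` by its independent copy does not change the law of the
inputs. They need not be integrable, so they are cancelled after truncation
(`sum_integral_le_of_balanced`).

For finite input alphabets the relaxed set is already closed. The variable `Q` enters only through a
point in the convex hull of a compact set, which is compact in finite dimension; the remaining
conditions are closed, and a projection along a compact set preserves closedness. -/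

noncomputable section

namespace InterferenceChannel

open InformationTheory

set_option linter.unusedSectionVars false

/-! ### Kullback-Leibler divergence: chain rules, finiteness, change of reference -/

section KullbackLeibler

variable {α β γ : Type*} [MeasurableSpace α] [MeasurableSpace β] [MeasurableSpace γ]

theorem klDiv_map_of_leftInverse {μ ν : Measure α} [IsFiniteMeasure μ] [IsFiniteMeasure ν]
    {f : α → β} {g : β → α} (hf : Measurable f) (hg : Measurable g)
    (h : Function.LeftInverse g f) : klDiv (μ.map f) (ν.map f) = klDiv μ ν := by
  refine le_antisymm (klDiv_map_le _ _ hf) ?_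
  have h1 := klDiv_map_le (μ.map f) (ν.map f) hg
  rwa [Measure.map_map hg hf, Measure.map_map hg hf, h.comp_eq_id, Measure.map_id,
    Measure.map_id] at h1

theorem klDiv_map_measurableEquiv {μ ν : Measure α} [IsFiniteMeasure μ] [IsFiniteMeasure ν]
    (e : α ≃ᵐ β) : klDiv (μ.map e) (ν.map e) = klDiv μ ν :=
  klDiv_map_of_leftInverse e.measurable e.symm.measurable e.symm_apply_apply

/-- The kernel Radon-Nikodym derivative is jointly measurable, and absolute continuity holds on a
measurable set of parameters. This is what allows divergences to be averaged over channel inputs. -/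
theorem measurable_klDiv_kernel [MeasurableSpace.CountableOrCountablyGenerated α β]
    (κ η : Kernel α β) [IsFiniteKernel κ] [IsFiniteKernel η] :
    Measurable fun a => klDiv (κ a) (η a) := by
  classical
  have h : (fun a => klDiv (κ a) (η a)) = fun a => if κ a ≪ η a then
      ∫⁻ b, ENNReal.ofReal (klFun (Kernel.rnDeriv κ η a b).toReal) ∂(η a) else ∞ := by
    funext a
    rw [klDiv_eq_lintegral_klFun]
    congr 1
    refine lintegral_congr_ae ?_
    filter_upwards [Kernel.rnDeriv_eq_rnDeriv_measure (κ := κ) (η := η) (a := a)] with b hb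
    rw [hb]
  rw [h]
  refine Measurable.ite (Kernel.measurableSet_absolutelyContinuous κ η) ?_ measurable_const
  have hm : Measurable (Function.uncurry fun a b =>
      ENNReal.ofReal (klFun (Kernel.rnDeriv κ η a b).toReal)) :=
    (measurable_klFun.comp (Kernel.measurable_rnDeriv κ η).ennreal_toReal).ennreal_ofReal
  exact hm.lintegral_kernel_prod_right

/-- The conditional Kullback-Leibler divergence is the average of the divergences. -/
theorem klDiv_compProd_right [MeasurableSpace.CountableOrCountablyGenerated α β]
    (μ : Measure α) [IsFiniteMeasure μ] (κ η : Kernel α β) [IsFiniteKernel κ] [IsFiniteKernel η] :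
    klDiv (μ ⊗ₘ κ) (μ ⊗ₘ η) = ∫⁻ a, klDiv (κ a) (η a) ∂μ := by
  by_cases hac : ∀ᵐ a ∂μ, κ a ≪ η a
  · have h_ac : μ ⊗ₘ κ ≪ μ ⊗ₘ η := Measure.absolutelyContinuous_compProd_right_iff.mpr hac
    have hd : μ ⊗ₘ κ = (μ ⊗ₘ η).withDensity fun p => Kernel.rnDeriv κ η p.1 p.2 := by
      ext s hs
      rw [Measure.compProd_apply hs, withDensity_apply _ hs, ← lintegral_indicator hs,
        Measure.lintegral_compProd (by
          exact (Kernel.measurable_rnDeriv κ η).indicator hs)]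
      refine lintegral_congr_ae ?_
      filter_upwards [hac] with a ha
      have h1 : κ a = (η a).withDensity (Kernel.rnDeriv κ η a) := by
        rw [withDensity_congr_ae (Kernel.rnDeriv_eq_rnDeriv_measure (κ := κ) (η := η) (a := a)),
          Measure.withDensity_rnDeriv_eq _ _ ha]
      have hs' : MeasurableSet (Prod.mk a ⁻¹' s) := measurable_prodMk_left hs
      conv_lhs => rw [h1, withDensity_apply _ hs', ← lintegral_indicator hs']
      rfl
    rw [klDiv_eq_lintegral_klFun_of_ac h_ac]
    have hr : (μ ⊗ₘ κ).rnDeriv (μ ⊗ₘ η) =ᵐ[μ ⊗ₘ η] fun p => Kernel.rnDeriv κ η p.1 p.2 := by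
      rw [hd]
      exact Measure.rnDeriv_withDensity _ (Kernel.measurable_rnDeriv κ η)
    calc ∫⁻ p, ENNReal.ofReal (klFun ((μ ⊗ₘ κ).rnDeriv (μ ⊗ₘ η) p).toReal) ∂(μ ⊗ₘ η)
        = ∫⁻ p, ENNReal.ofReal (klFun (Kernel.rnDeriv κ η p.1 p.2).toReal) ∂(μ ⊗ₘ η) := by
          refine lintegral_congr_ae ?_
          filter_upwards [hr] with p hp
          rw [hp]
      _ = ∫⁻ a, ∫⁻ b, ENNReal.ofReal (klFun (Kernel.rnDeriv κ η a b).toReal) ∂(η a) ∂μ :=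
          Measure.lintegral_compProd
            ((measurable_klFun.comp (Kernel.measurable_rnDeriv κ η).ennreal_toReal).ennreal_ofReal)
      _ = ∫⁻ a, klDiv (κ a) (η a) ∂μ := by
          refine lintegral_congr_ae ?_
          filter_upwards [hac] with a ha
          rw [klDiv_eq_lintegral_klFun_of_ac ha]
          refine lintegral_congr_ae ?_
          filter_upwards [Kernel.rnDeriv_eq_rnDeriv_measure (κ := κ) (η := η) (a := a)] with b hb
          rw [hb]
  -- Without almost sure absolute continuity both sides are infinite: a finite average would make
  -- almost every divergence finite, hence almost every pair absolutely continuous.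
  · rw [klDiv_of_not_ac (fun h => hac (Measure.absolutelyContinuous_compProd_right_iff.mp h))]
    symm
    by_contra hne
    refine hac ?_
    filter_upwards [ae_lt_top (measurable_klDiv_kernel κ η) hne] with a ha
    exact (klDiv_ne_top_iff.mp ha.ne).1

theorem klDiv_prod (μ₁ ν₁ : Measure α) (μ₂ ν₂ : Measure β) [IsProbabilityMeasure μ₁]
    [IsProbabilityMeasure ν₁] [IsProbabilityMeasure μ₂] [IsProbabilityMeasure ν₂] :
    klDiv (μ₁.prod μ₂) (ν₁.prod ν₂) = klDiv μ₁ ν₁ + klDiv μ₂ ν₂ := by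
  rw [← Measure.compProd_const, ← Measure.compProd_const, klDiv_compProd_eq_add]
  congr 1
  rw [Measure.compProd_const, Measure.compProd_const,
    ← klDiv_map_of_leftInverse measurable_swap measurable_swap Prod.swap_swap, Measure.prod_swap,
    Measure.prod_swap, ← Measure.compProd_const, ← Measure.compProd_const, klDiv_compProd_left]

theorem klDiv_pi {n : ℕ} (P S : Fin n → Measure α) [∀ t, IsProbabilityMeasure (P t)]
    [∀ t, IsProbabilityMeasure (S t)] :
    klDiv (Measure.pi P) (Measure.pi S) = ∑ t, klDiv (P t) (S t) := by
  induction n with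
  | zero =>
    have : Measure.pi P = Measure.pi S := by
      rw [Measure.pi_of_empty, Measure.pi_of_empty]
    rw [this, klDiv_self]
    simp
  | succ n ih =>
    have e := MeasurableEquiv.piFinSuccAbove (fun _ : Fin (n + 1) => α) 0
    have hP := (measurePreserving_piFinSuccAbove P 0).map_eq
    have hS := (measurePreserving_piFinSuccAbove S 0).map_eq
    rw [← klDiv_map_measurableEquiv (MeasurableEquiv.piFinSuccAbove (fun _ : Fin (n + 1) => α) 0),
      hP, hS, klDiv_prod, ih, Fin.sum_univ_succ]
    simp

theorem rnDeriv_le_of_le_smul {μ ν : Measure α} [IsFiniteMeasure μ] [IsFiniteMeasure ν]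
    {c : ℝ≥0∞} (h : μ ≤ c • ν) : ∀ᵐ x ∂ν, μ.rnDeriv ν x ≤ c := by
  refine ae_le_of_forall_setLIntegral_le_of_sigmaFinite (Measure.measurable_rnDeriv μ ν)
    fun s hs _ => ?_
  rw [setLIntegral_const]
  exact (Measure.setLIntegral_rnDeriv_le s).trans (h s)

/-- The density is bounded by `c`, and `klFun` is bounded on `[0, c]`. Applied to a member of a
finite family and its uniform mixture, this yields the finiteness needed to cancel terms in `[0,
∞]`. -/
theorem klDiv_ne_top_of_le_smul {μ ν : Measure α} [IsFiniteMeasure μ] [IsFiniteMeasure ν]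
    {c : ℝ≥0∞} (hc : c ≠ ∞) (h : μ ≤ c • ν) : klDiv μ ν ≠ ∞ := by
  have hac : μ ≪ ν := (Measure.absolutelyContinuous_of_le h).trans
    (Measure.smul_absolutelyContinuous)
  rw [klDiv_eq_lintegral_klFun_of_ac hac]
  have hb : ∀ r : ℝ, 0 ≤ r → r ≤ c.toReal → klFun r ≤ c.toReal * c.toReal + 1 := by
    intro r h0 h1
    rw [klFun_apply]
    have h2 : Real.log r ≤ r := Real.log_le_self h0
    have h3 : r * Real.log r ≤ r * r := mul_le_mul_of_nonneg_left h2 h0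
    nlinarith
  have hlt : ∫⁻ x, ENNReal.ofReal (klFun (μ.rnDeriv ν x).toReal) ∂ν ≤
      ∫⁻ _, ENNReal.ofReal (c.toReal * c.toReal + 1) ∂ν := by
    refine lintegral_mono_ae ?_
    filter_upwards [rnDeriv_le_of_le_smul h] with x hx
    exact ENNReal.ofReal_le_ofReal (hb _ ENNReal.toReal_nonneg (ENNReal.toReal_mono hc hx))
  refine ne_top_of_le_ne_top ?_ hlt
  rw [lintegral_const]
  exact ENNReal.mul_ne_top ENNReal.ofReal_ne_top (measure_ne_top _ _)

/-- The negative part of the log-likelihood ratio is dominated by an integrable function. -/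
theorem integrable_inv_rnDeriv {μ ν : Measure α} [IsFiniteMeasure μ] [IsFiniteMeasure ν]
    (hac : μ ≪ ν) : Integrable (fun x => ((μ.rnDeriv ν x)⁻¹).toReal) μ := by
  refine integrable_toReal_of_lintegral_ne_top
    (Measure.measurable_rnDeriv μ ν).inv.aemeasurable ?_
  have hd : ∫⁻ x, (μ.rnDeriv ν x)⁻¹ ∂μ =
      ∫⁻ x, (μ.rnDeriv ν x)⁻¹ ∂(ν.withDensity (μ.rnDeriv ν)) := by
    rw [Measure.withDensity_rnDeriv_eq μ ν hac]
  rw [hd, lintegral_withDensity_eq_lintegral_mul _ (Measure.measurable_rnDeriv _ _)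
    (g := fun x => (μ.rnDeriv ν x)⁻¹) (Measure.measurable_rnDeriv _ _).inv]
  -- The density times its inverse is at most one, so the integral is at most the total mass of `ν`.
  refine ne_top_of_le_ne_top (b := ∫⁻ _, 1 ∂ν) (by simp) (lintegral_mono fun x => ?_)
  exact ENNReal.mul_inv_le_one _

theorem neg_llr_le (μ ν : Measure α) (x : α) : -llr μ ν x ≤ ((μ.rnDeriv ν x)⁻¹).toReal := by
  simp only [llr]
  rw [← Real.log_inv, ← ENNReal.toReal_inv]
  exact Real.log_le_self ENNReal.toReal_nonneg

/-- Enlarging the second argument by a constant factor costs at most the logarithm of it. -/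
theorem klDiv_le_add_log {μ ν ν' : Measure α} [IsProbabilityMeasure μ] [IsProbabilityMeasure ν]
    [IsProbabilityMeasure ν'] {c : ℝ} (hc : 0 < c) (h : ENNReal.ofReal c • ν ≤ ν') :
    klDiv μ ν' ≤ klDiv μ ν + ENNReal.ofReal (-Real.log c) := by
  by_cases htop : klDiv μ ν = ∞
  · simp [htop]
  obtain ⟨hac, hint⟩ := klDiv_ne_top_iff.mp htop
  have hc0 : ENNReal.ofReal c ≠ 0 := by simpa using hc
  have hνν' : ν ≪ ν' := by
    refine (Measure.absolutelyContinuous_smul hc0).trans (Measure.absolutelyContinuous_of_le h)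
  have hac' : μ ≪ ν' := hac.trans hνν'
  have hle : ν ≤ (ENNReal.ofReal c)⁻¹ • ν' := by
    intro s
    have := h s
    simp only [Measure.smul_apply, smul_eq_mul] at this ⊢
    rw [mul_comm] at this
    calc ν s = ν s * ENNReal.ofReal c * (ENNReal.ofReal c)⁻¹ := by
          rw [mul_assoc, ENNReal.mul_inv_cancel hc0 ENNReal.ofReal_ne_top, mul_one]
      _ ≤ _ := by rw [mul_comm]; gcongr
  have hne : klDiv μ ν' ≠ ∞ ∧ ∀ᵐ x ∂μ, llr μ ν' x ≤ llr μ ν x + -Real.log c := by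
    -- Chain rule for densities: `dμ/dν' = (dμ/dν)(dν/dν')`, and the last factor is at most `1/c`.
    have hpt : ∀ᵐ x ∂μ, llr μ ν' x ≤ llr μ ν x + -Real.log c := by
      filter_upwards [hac'.ae_le (Measure.rnDeriv_mul_rnDeriv hac (κ := ν')),
        hac'.ae_le (rnDeriv_le_of_le_smul hle), Measure.rnDeriv_pos hac,
        hac.ae_le (Measure.rnDeriv_lt_top μ ν), Measure.rnDeriv_pos hac'] with x h1 h2 h3 h4 h5
      simp only [llr]
      simp only [Pi.mul_apply] at h1
      have hb0 : 0 < (ν.rnDeriv ν' x).toReal := by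
        refine ENNReal.toReal_pos (fun h0 => ?_) (ne_top_of_le_ne_top (by simpa using hc) h2)
        rw [h0, mul_zero] at h1
        exact h5.ne h1
      rw [← h1, ENNReal.toReal_mul, Real.log_mul (ENNReal.toReal_pos h3.ne' h4.ne).ne' hb0.ne',
        ← Real.log_inv]
      have h6 : (ν.rnDeriv ν' x).toReal ≤ c⁻¹ := by
        have := ENNReal.toReal_mono (by simpa using hc) h2
        rwa [ENNReal.toReal_inv, ENNReal.toReal_ofReal hc.le] at this
      gcongr
    refine ⟨?_, hpt⟩
    -- The pointwise bound controls the ratio from above, and the inverse density controls it from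
    -- below.
    have hμ : Integrable (llr μ ν') μ := by
      have hi1 := integrable_inv_rnDeriv hac'
      refine Integrable.mono' ((hint.abs.add (integrable_const (|Real.log c|))).add hi1)
        (measurable_llr _ _).aestronglyMeasurable ?_
      filter_upwards [hpt] with x h1
      have h2 := neg_llr_le μ ν' x
      rw [Real.norm_eq_abs, abs_le]
      have h3 : 0 ≤ ((μ.rnDeriv ν' x)⁻¹).toReal := ENNReal.toReal_nonneg
      have h4 := le_abs_self (llr μ ν x)
      have h5 := neg_le_abs (Real.log c)
      have h6 := abs_nonneg (llr μ ν x)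
      have h7 := abs_nonneg (Real.log c)
      simp only [Pi.add_apply]
      constructor <;> linarith
    exact klDiv_ne_top hac' hμ
  obtain ⟨hne1, hpt⟩ := hne
  have hint' := (klDiv_ne_top_iff.mp hne1).2
  rw [klDiv_of_ac_of_integrable hac' hint', klDiv_of_ac_of_integrable hac hint]
  simp only [probReal_univ, add_sub_cancel_right]
  refine le_trans (ENNReal.ofReal_le_ofReal ?_) ENNReal.ofReal_add_le
  calc ∫ x, llr μ ν' x ∂μ ≤ ∫ x, (llr μ ν x + -Real.log c) ∂μ :=
        integral_mono_ae hint' (hint.add (integrable_const _)) hpt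
    _ = _ := by rw [integral_add hint (integrable_const _)]; simp

end KullbackLeibler

/-! ### Uniform mixtures, the compensation identity and Fano's inequality -/

section Mixtures

variable {ι α β : Type*} [Fintype ι] [MeasurableSpace α] [MeasurableSpace β]

/-- The uniform mixture of a finite family of measures. -/
def uniformMix (P : ι → Measure α) : Measure α := (Fintype.card ι : ℝ≥0∞)⁻¹ • ∑ i, P i

instance [Nonempty ι] (P : ι → Measure α) [∀ i, IsProbabilityMeasure (P i)] :
    IsProbabilityMeasure (uniformMix P) := by
  constructor
  simp only [uniformMix, Measure.smul_apply, Measure.coe_finsetSum, Finset.sum_apply,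
    measure_univ, Finset.sum_const, Finset.card_univ, nsmul_eq_mul, mul_one, smul_eq_mul]
  exact ENNReal.inv_mul_cancel (by simp) (by simp)

theorem uniformMix_map (P : ι → Measure α) {f : α → β} (hf : Measurable f) :
    (uniformMix P).map f = uniformMix fun i => (P i).map f := by
  ext s hs
  simp [uniformMix, Measure.map_apply hf hs]

theorem lintegral_uniformMix (P : ι → Measure α) (f : α → ℝ≥0∞) :
    ∫⁻ x, f x ∂(uniformMix P) = (Fintype.card ι : ℝ≥0∞)⁻¹ * ∑ i, ∫⁻ x, f x ∂(P i) := by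
  rw [uniformMix, lintegral_smul_measure, lintegral_finsetSum_measure, smul_eq_mul]

theorem le_card_smul_uniformMix (P : ι → Measure α) (i : ι) :
    P i ≤ (Fintype.card ι : ℝ≥0∞) • uniformMix P := by
  have : Nonempty ι := ⟨i⟩
  rw [uniformMix, smul_smul, ENNReal.mul_inv_cancel (by simp) (by simp), one_smul]
  intro s
  simp only [Measure.coe_finsetSum, Finset.sum_apply]
  exact Finset.single_le_sum (f := fun i => P i s) (fun _ _ => zero_le) (Finset.mem_univ i)

theorem klDiv_uniformMix_ne_top (P : ι → Measure α) [∀ i, IsProbabilityMeasure (P i)] (i : ι) :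
    klDiv (P i) (uniformMix P) ≠ ∞ := by
  have : Nonempty ι := ⟨i⟩
  exact klDiv_ne_top_of_le_smul (by simp) (le_card_smul_uniformMix P i)

/-- The compensation identity. -/
theorem sum_klDiv_eq_add [Nonempty ι] (P : ι → Measure α) (R : Measure α)
    [∀ i, IsProbabilityMeasure (P i)] [IsProbabilityMeasure R] :
    ∑ i, klDiv (P i) R =
      ∑ i, klDiv (P i) (uniformMix P) + Fintype.card ι * klDiv (uniformMix P) R := by
  let : MeasurableSpace ι := ⊤
  have : DiscreteMeasurableSpace ι := ⟨fun _ => trivial⟩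
  set G := uniformMix P with hG
  let κ : Kernel ι α := Kernel.ofFunOfCountable P
  have : IsMarkovKernel κ := ⟨fun i => inferInstanceAs (IsProbabilityMeasure (P i))⟩
  let p : Measure ι := uniformMix fun i => Measure.dirac i
  have hp : ∀ f : ι → ℝ≥0∞, ∫⁻ i, f i ∂p = (Fintype.card ι : ℝ≥0∞)⁻¹ * ∑ i, f i := by
    intro f
    rw [lintegral_uniformMix]
    simp
  have h0 : (Fintype.card ι : ℝ≥0∞) ≠ 0 := by simp
  have h0' : (Fintype.card ι : ℝ≥0∞) ≠ ∞ := by simp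
  have key : ∀ T : Measure α, ∀ _ : IsProbabilityMeasure T,
      klDiv (p ⊗ₘ κ) (p.prod T) = (Fintype.card ι : ℝ≥0∞)⁻¹ * ∑ i, klDiv (P i) T := by
    intro T _
    rw [← Measure.compProd_const, klDiv_compProd_right, hp]
    rfl
  have hmarg : (p ⊗ₘ κ).snd = G := by
    ext s hs
    rw [Measure.snd_apply hs, Measure.compProd_apply (measurable_snd hs), hp, hG]
    simp only [uniformMix, Measure.smul_apply, Measure.coe_finsetSum, Finset.sum_apply,
      smul_eq_mul]
    rfl
  have hswap : (p ⊗ₘ κ).map Prod.swap = G ⊗ₘ ((p ⊗ₘ κ).map Prod.swap).condKernel := by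
    conv_lhs => rw [← Measure.disintegrate ((p ⊗ₘ κ).map Prod.swap)
      ((p ⊗ₘ κ).map Prod.swap).condKernel]
    rw [Measure.fst_map_swap, hmarg]
  set post := ((p ⊗ₘ κ).map Prod.swap).condKernel with hpost
  -- The divergence from independence is expanded in the two possible orders. Here the last term,
  -- which compares the posterior of the index with its prior, does not depend on `T`; taking `T =
  -- R` and `T = G` identifies it without any subtraction.
  have chain : ∀ T : Measure α, ∀ _ : IsProbabilityMeasure T,
      klDiv (p ⊗ₘ κ) (p.prod T) = klDiv G T + klDiv (G ⊗ₘ post) (G.prod p) := by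
    intro T _
    rw [← klDiv_map_of_leftInverse measurable_swap measurable_swap Prod.swap_swap,
      Measure.prod_swap, hswap, ← Measure.compProd_const, klDiv_compProd_eq_add, Measure.compProd_const]
  have e1 := (key R inferInstance).symm.trans (chain R inferInstance)
  have e2 := (key G inferInstance).symm.trans (chain G inferInstance)
  rw [klDiv_self, zero_add] at e2
  rw [← e2] at e1
  have e3 := congrArg (fun x => (Fintype.card ι : ℝ≥0∞) * x) e1
  simp only [mul_add, ← mul_assoc, ENNReal.mul_inv_cancel h0 h0', one_mul] at e3
  rw [e3, add_comm]

/-- Fano's inequality in the form of a change of measure. -/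
theorem log_mul_le_klDiv_add {G ρ : Measure α} [IsProbabilityMeasure G] [IsProbabilityMeasure ρ]
    {M : ℝ} (hM : 1 ≤ M) (A : Set α) :
    ENNReal.ofReal (Real.log M) * G A ≤ klDiv G ρ + ENNReal.ofReal M * ρ A := by
  by_cases hac : G ≪ ρ
  swap
  · simp [klDiv_of_not_ac hac]
  have hlog : 0 ≤ Real.log M := Real.log_nonneg hM
  -- Young's inequality for `klFun`: the supremum of `r log M - klFun r` is `M - 1`, reached at `r =
  -- M`.
  have young : ∀ r : ℝ, 0 ≤ r → Real.log M * r ≤ klFun r + M := by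
    intro r hr
    rw [klFun_apply]
    rcases hr.eq_or_lt with rfl | hr
    · simp; linarith
    · have h1 : Real.log (M / r) ≤ M / r - 1 := Real.log_le_sub_one_of_pos (by positivity)
      rw [Real.log_div (by positivity) hr.ne'] at h1
      have h2 := mul_le_mul_of_nonneg_left h1 hr.le
      have h3 : r * (M / r - 1) = M - r := by field_simp
      rw [h3] at h2
      nlinarith
  rw [klDiv_eq_lintegral_klFun_of_ac hac]
  calc ENNReal.ofReal (Real.log M) * G A
      = ∫⁻ x in A, ENNReal.ofReal (Real.log M) * G.rnDeriv ρ x ∂ρ := by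
        rw [lintegral_const_mul _ (Measure.measurable_rnDeriv _ _),
          Measure.setLIntegral_rnDeriv hac]
    _ ≤ ∫⁻ x in A, (ENNReal.ofReal (klFun (G.rnDeriv ρ x).toReal) + ENNReal.ofReal M) ∂ρ := by
        refine lintegral_mono_ae ?_
        filter_upwards [ae_restrict_of_ae (Measure.rnDeriv_lt_top G ρ)] with x hx
        rw [← ENNReal.ofReal_add (klFun_nonneg ENNReal.toReal_nonneg) (by linarith)]
        conv_lhs => rw [← ENNReal.ofReal_toReal hx.ne]
        rw [← ENNReal.ofReal_mul hlog]
        exact ENNReal.ofReal_le_ofReal (young _ ENNReal.toReal_nonneg)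
    _ = ∫⁻ x in A, ENNReal.ofReal (klFun (G.rnDeriv ρ x).toReal) ∂ρ + ENNReal.ofReal M * ρ A := by
        rw [lintegral_add_right _ measurable_const, setLIntegral_const]
    _ ≤ _ := by
        exact add_le_add (setLIntegral_le_lintegral _ _) le_rfl

end Mixtures

/-! ### Memoryless blocks and the block form of Fano's inequality -/

section Blocks

variable {α β γ : Type*} [MeasurableSpace α] [MeasurableSpace β] [MeasurableSpace γ] {n : ℕ}

/-- The memoryless use of a sequence of Markov kernels. -/
def blockKernel (q : Fin n → Kernel α β) [∀ t, IsMarkovKernel (q t)] :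
    Kernel (Fin n → α) (Fin n → β) where
  toFun v := Measure.pi fun t => q t (v t)
  measurable' := by
    refine Measurable.measure_of_isPiSystem_of_isProbabilityMeasure generateFrom_pi.symm
      isPiSystem_pi ?_
    rintro s ⟨s, hs, rfl⟩
    simp only [Measure.pi_pi]
    refine Finset.measurable_prod _ fun t _ => ?_
    exact (Kernel.measurable_coe (q t) (hs t (Set.mem_univ t))).comp (measurable_pi_apply t)

theorem blockKernel_apply (q : Fin n → Kernel α β) [∀ t, IsMarkovKernel (q t)] (v : Fin n → α) :
    blockKernel q v = Measure.pi fun t => q t (v t) := rfl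

instance (q : Fin n → Kernel α β) [∀ t, IsMarkovKernel (q t)] : IsMarkovKernel (blockKernel q) :=
  ⟨fun v => inferInstanceAs (IsProbabilityMeasure (Measure.pi fun t => q t (v t)))⟩

theorem lintegral_pi_prod (P : Fin n → Measure α) [∀ t, IsProbabilityMeasure (P t)]
    {f : Fin n → α → ℝ≥0∞} (hf : ∀ t, Measurable (f t)) :
    ∫⁻ v, ∏ t, f t (v t) ∂(Measure.pi P) = ∏ t, ∫⁻ v, f t v ∂(P t) := by
  rw [lintegral_prod_eq_prod_lintegral_of_indepFun Finset.univ (fun t (v : Fin n → α) => f t (v t))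
    (iIndepFun_pi (X := f) fun t => (hf t).aemeasurable)
    fun t => (hf t).comp (measurable_pi_apply t)]
  refine Finset.prod_congr rfl fun t _ => ?_
  rw [← (measurePreserving_eval P t).map_eq, lintegral_map (hf t) (measurable_pi_apply t)]

/-- Equality is tested on products of rectangles. There the block kernel contributes a product of
one-letter probabilities, and the integral factorises by independence. -/
theorem map_pi_compProd_blockKernel (P : Fin n → Measure α) [∀ t, IsProbabilityMeasure (P t)]
    (q : Fin n → Kernel α β) [∀ t, IsMarkovKernel (q t)] :
    ((Measure.pi P) ⊗ₘ blockKernel q).map (MeasurableEquiv.arrowProdEquivProdArrow α β (Fin n)).symm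
      = Measure.pi fun t => P t ⊗ₘ q t := by
  symm
  refine Measure.pi_eq_generateFrom
    (C := fun _ => Set.image2 (· ×ˢ ·) {s : Set α | MeasurableSet s} {s : Set β | MeasurableSet s})
    (fun _ => generateFrom_prod) (fun _ => isPiSystem_prod) (fun t => ?_) ?_
  · exact
      { set := fun _ => Set.univ
        set_mem := fun _ => ⟨Set.univ, MeasurableSet.univ, Set.univ, MeasurableSet.univ, by simp⟩
        finite := fun _ => measure_lt_top _ _
        spanning := by simp [Set.iUnion_const] }
  · intro s hs
    choose a ha b hb hab using hs
    have hs' : ∀ t, MeasurableSet (s t) := fun t => hab t ▸ (ha t).prod (hb t)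
    rw [MeasurableEquiv.map_apply, Measure.compProd_apply
      (MeasurableEquiv.measurable _ (MeasurableSet.univ_pi hs'))]
    have h1 : ∀ v : Fin n → α, blockKernel q v (Prod.mk v ⁻¹'
        ((MeasurableEquiv.arrowProdEquivProdArrow α β (Fin n)).symm ⁻¹' Set.univ.pi s)) =
        ∏ t, (a t).indicator (fun x => q t x (b t)) (v t) := by
      intro v
      by_cases hv : ∀ t, v t ∈ a t
      · have : Prod.mk v ⁻¹' ((MeasurableEquiv.arrowProdEquivProdArrow α β (Fin n)).symm ⁻¹'
            Set.univ.pi s) = Set.univ.pi b := by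
          ext y
          simp only [Set.mem_preimage, Set.mem_pi, Set.mem_univ, true_implies]
          refine forall_congr' fun t => ?_
          rw [← hab t]
          change (v t, y t) ∈ _ ↔ _
          simp [hv t]
        rw [this, blockKernel_apply, Measure.pi_pi]
        exact Finset.prod_congr rfl fun t _ => by rw [Set.indicator_of_mem (hv t)]
      · push Not at hv
        obtain ⟨t, ht⟩ := hv
        have : Prod.mk v ⁻¹' ((MeasurableEquiv.arrowProdEquivProdArrow α β (Fin n)).symm ⁻¹'
            Set.univ.pi s) = ∅ := by
          ext y
          simp only [Set.mem_preimage, Set.mem_pi, Set.mem_univ, true_implies,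
            Set.mem_empty_iff_false, iff_false, not_forall]
          refine ⟨t, ?_⟩
          rw [← hab t]
          change (v t, y t) ∉ _
          simp [ht]
        rw [this, measure_empty]
        exact (Finset.prod_eq_zero (Finset.mem_univ t) (Set.indicator_of_notMem ht _)).symm
    simp_rw [h1]
    rw [lintegral_pi_prod P (f := fun t => (a t).indicator fun x => q t x (b t))
      fun t => (Kernel.measurable_coe (q t) (hb t)).indicator (ha t)]
    refine Finset.prod_congr rfl fun t _ => ?_
    rw [← hab t, lintegral_indicator (ha t), Measure.compProd_apply_prod (ha t) (hb t)]

variable [StandardBorelSpace β] [Nonempty β]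

/-- The chain rule for a block of independent pairs and a memoryless kernel. -/
theorem klDiv_pi_map_compProd (Γ : Fin n → Measure (α × β)) [∀ t, IsProbabilityMeasure (Γ t)]
    (G : Measure (Fin n → α)) [IsProbabilityMeasure G]
    (q : Fin n → Kernel α β) [∀ t, IsMarkovKernel (q t)] :
    klDiv (Measure.pi Γ)
        ((G ⊗ₘ blockKernel q).map (MeasurableEquiv.arrowProdEquivProdArrow α β (Fin n)).symm) =
      klDiv (Measure.pi fun t => (Γ t).fst) G + ∑ t, klDiv (Γ t) ((Γ t).fst ⊗ₘ q t) := by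
  have h1 : Measure.pi Γ = ((Measure.pi fun t => (Γ t).fst) ⊗ₘ
      blockKernel fun t => (Γ t).condKernel).map
        (MeasurableEquiv.arrowProdEquivProdArrow α β (Fin n)).symm := by
    rw [map_pi_compProd_blockKernel]
    congr 1
    funext t
    exact ((Γ t).disintegrate (Γ t).condKernel).symm
  rw [← klDiv_pi, ← map_pi_compProd_blockKernel]
  -- The conditional part of the chain rule does not involve `G`. It is therefore the divergence
  -- between two product laws with equal first marginals, and it splits over time even when `G` is
  -- not a product.
  conv_lhs => rw [h1, klDiv_map_measurableEquiv, klDiv_compProd_eq_add,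
    ← klDiv_map_measurableEquiv (μ := _ ⊗ₘ _)
      (MeasurableEquiv.arrowProdEquivProdArrow α β (Fin n)).symm, ← h1]

/-- Here `d` is the message to be decoded, `e` collects the other messages, and the pair consists of
side information and output. For each `d` the compensation identity splits the divergence from the
reference `ρ` into a part inside the family over `e`, which dominates the leftover information in
`z` by data processing, and the divergence of the mixture from `ρ`, which Fano's inequality bounds
from below. The chain rule evaluates the divergence from `ρ` on the other side. -/
theorem fano_block {E : Type*} [Fintype E] [Nonempty E] {M : ℕ} (hM : 0 < M)
    (Γ : Fin M → E → Fin n → Measure (α × β)) [∀ d e t, IsProbabilityMeasure (Γ d e t)]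
    (q : Fin n → Kernel α β) [∀ t, IsMarkovKernel (q t)] {z : α × β → γ} (hz : Measurable z)
    {A : Fin M → Set (Fin n → α × β)} (hA : ∀ d, MeasurableSet (A d))
    (hdisj : Pairwise (Function.onFun Disjoint A)) :
    ENNReal.ofReal (Real.log M) * ∑ d, ∑ e, Measure.pi (Γ d e) (A d) +
        ∑ d, ∑ e, klDiv (Measure.pi fun t => (Γ d e t).map z)
          (uniformMix fun e' => Measure.pi fun t => (Γ d e' t).map z) ≤
      M * Fintype.card E +
        ∑ d, ∑ e, klDiv (Measure.pi fun t => (Γ d e t).fst)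
          (uniformMix fun p : Fin M × E => Measure.pi fun t => (Γ p.1 p.2 t).fst) +
        ∑ d, ∑ e, ∑ t, klDiv (Γ d e t) ((Γ d e t).fst ⊗ₘ q t) := by
  have : Nonempty (Fin M) := ⟨⟨0, hM⟩⟩
  have hzp : ∀ d e t, IsProbabilityMeasure ((Γ d e t).map z) := fun d e t =>
    Measure.isProbabilityMeasure_map hz.aemeasurable
  set GV := uniformMix fun p : Fin M × E => Measure.pi fun t => (Γ p.1 p.2 t).fst with hGV
  -- The reference ignores the messages: side information from the overall mixture, output from `q`
  -- letter by letter.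
  set ρ := (GV ⊗ₘ blockKernel q).map (MeasurableEquiv.arrowProdEquivProdArrow α β (Fin n)).symm
    with hρ
  have : IsProbabilityMeasure ρ :=
    Measure.isProbabilityMeasure_map (MeasurableEquiv.measurable _).aemeasurable
  have hchain : ∀ d e, klDiv (Measure.pi (Γ d e)) ρ =
      klDiv (Measure.pi fun t => (Γ d e t).fst) GV +
        ∑ t, klDiv (Γ d e t) ((Γ d e t).fst ⊗ₘ q t) := fun d e =>
    klDiv_pi_map_compProd (Γ d e) GV q
  have hd : ∀ d, ENNReal.ofReal (Real.log M) * ∑ e, Measure.pi (Γ d e) (A d) +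
      ∑ e, klDiv (Measure.pi fun t => (Γ d e t).map z)
          (uniformMix fun e' => Measure.pi fun t => (Γ d e' t).map z) ≤
      Fintype.card E * (M * ρ (A d)) + ∑ e, klDiv (Measure.pi (Γ d e)) ρ := by
    intro d
    set G := uniformMix fun e => Measure.pi (Γ d e) with hG
    have h1 : ∑ e, Measure.pi (Γ d e) (A d) = Fintype.card E * G (A d) := by
      rw [hG, uniformMix, Measure.smul_apply, Measure.coe_finsetSum, Finset.sum_apply,
        smul_eq_mul, ← mul_assoc, ENNReal.mul_inv_cancel (by simp) (by simp), one_mul]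
    have h2 : ∀ e, klDiv (Measure.pi fun t => (Γ d e t).map z)
        (uniformMix fun e' => Measure.pi fun t => (Γ d e' t).map z) ≤
        klDiv (Measure.pi (Γ d e)) G := by
      intro e
      have hm : Measurable fun (x : Fin n → α × β) t => z (x t) := by fun_prop
      have h3 : ∀ e, (Measure.pi fun t => (Γ d e t).map z) =
          (Measure.pi (Γ d e)).map fun x t => z (x t) := fun e =>
        (Measure.pi_map_pi (μ := Γ d e) (f := fun _ => z) fun _ => hz.aemeasurable).symm
      simp_rw [h3]
      rw [← uniformMix_map _ hm]
      exact klDiv_map_le _ _ hm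
    have h4 := log_mul_le_klDiv_add (G := G) (ρ := ρ) (M := M) (by exact_mod_cast hM) (A d)
    rw [ENNReal.ofReal_natCast] at h4
    rw [sum_klDiv_eq_add (fun e => Measure.pi (Γ d e)) ρ, h1]
    calc _ ≤ Fintype.card E * (klDiv G ρ + M * ρ (A d)) + ∑ e, klDiv (Measure.pi (Γ d e)) G := by
          rw [mul_left_comm]
          gcongr
          exact h2 _
      _ = _ := by ring
  -- The decoding regions are disjoint, so the `M` error terms of Fano's inequality together cost
  -- only `M * card E`, that is, one nat after averaging over the messages.
  have hsum : ∑ d, ρ (A d) ≤ 1 := by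
    have := measure_iUnion (μ := ρ) hdisj hA
    rw [tsum_fintype] at this
    rw [← this]
    exact prob_le_one
  calc _ = ∑ d, (ENNReal.ofReal (Real.log M) * ∑ e, Measure.pi (Γ d e) (A d) +
      ∑ e, klDiv (Measure.pi fun t => (Γ d e t).map z)
          (uniformMix fun e' => Measure.pi fun t => (Γ d e' t).map z)) := by
        rw [Finset.sum_add_distrib, Finset.mul_sum]
    _ ≤ ∑ d, (Fintype.card E * (M * ρ (A d)) + ∑ e, klDiv (Measure.pi (Γ d e)) ρ) :=
        Finset.sum_le_sum fun d _ => hd d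
    _ = M * Fintype.card E * ∑ d, ρ (A d) + ∑ d, ∑ e, klDiv (Measure.pi (Γ d e)) ρ := by
        rw [Finset.sum_add_distrib, ← Finset.mul_sum, ← Finset.mul_sum]
        ring
    _ ≤ M * Fintype.card E * 1 + ∑ d, ∑ e, klDiv (Measure.pi (Γ d e)) ρ := by gcongr
    _ = _ := by
        simp_rw [hchain, Finset.sum_add_distrib]
        rw [mul_one, add_assoc]

end Blocks

/-! ### Cost of replacing a conditional output law by a kernel -/

section SideCost

variable {𝒳 𝒱 𝒴 : Type*} [MeasurableSpace 𝒳] [MeasurableSpace 𝒱] [MeasurableSpace 𝒴]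

/-- The divergence of the joint output law `J x` from the law under which the second output is
drawn by `q` from the input and the first output. -/
def sideCost (J : Kernel 𝒳 (𝒱 × 𝒴)) (q : Kernel (𝒳 × 𝒱) 𝒴) (x : 𝒳) : ℝ≥0∞ :=
  klDiv (J x) ((J.fst ⊗ₖ q) x)

theorem sideCost_eq (J : Kernel 𝒳 (𝒱 × 𝒴)) [IsMarkovKernel J] (q : Kernel (𝒳 × 𝒱) 𝒴)
    [IsMarkovKernel q] (x : 𝒳) : sideCost J q x = klDiv (J x) ((J x).fst ⊗ₘ q.sectR x) := by
  rw [sideCost, Kernel.compProd_apply_eq_compProd_sectR, Kernel.fst_apply]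
  rfl

theorem measurable_sideCost [StandardBorelSpace 𝒱] [StandardBorelSpace 𝒴]
    (J : Kernel 𝒳 (𝒱 × 𝒴)) [IsMarkovKernel J] (q : Kernel (𝒳 × 𝒱) 𝒴) [IsMarkovKernel q] :
    Measurable (sideCost J q) :=
  measurable_klDiv_kernel _ _

end SideCost

/-! ### Variational form of the two families of bounds -/

section Relaxed

variable {K : ℕ} {X Y : Fin K → Type*} [∀ k, MeasurableSpace (X k)] [∀ k, MeasurableSpace (Y k)]

/-- The conditioning variables, without the time-sharing variable, of the `k`-th term of the first
family of bounds. -/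
abbrev KramerCond (X Y : Fin K → Type*) {S : Finset (Fin K)} (π : Fin S.card ≃ S)
    (k : Fin S.card) : Type _ :=
  ((i : Set.Iio k) → X (π i)) × ((i : Set.Iio k) → Y (π i)) × ((u : {u : Fin K // u ∉ S}) → X u)

variable {S : Finset (Fin K)} (π : Fin S.card ≃ S) (k : Fin S.card)

/-- The outputs of the users before the `k`-th one, together with the `k`-th output. -/
def outputPair (y : ∀ k, Y k) : ((i : Set.Iio k) → Y (π i)) × Y (π k) := (fun i => y (π i), y (π k))

theorem measurable_outputPair : Measurable (outputPair (Y := Y) π k) := by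
  unfold outputPair
  fun_prop

def kramerJoint (W : Kernel (∀ k, X k) (∀ k, Y k)) :
    Kernel (∀ k, X k) (((i : Set.Iio k) → Y (π i)) × Y (π k)) :=
  W.map (outputPair π k)

instance (W : Kernel (∀ k, X k) (∀ k, Y k)) [IsMarkovKernel W] :
    IsMarkovKernel (kramerJoint π k W) :=
  Kernel.IsMarkovKernel.map _ (measurable_outputPair π k)

theorem kramerJoint_apply (W : Kernel (∀ k, X k) (∀ k, Y k)) (x : ∀ k, X k) :
    kramerJoint π k W x = (W x).map (outputPair π k) :=
  Kernel.map_apply _ (measurable_outputPair π k) _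

def kramerCond (p : (∀ k, X k) × ((i : Set.Iio k) → Y (π i))) : KramerCond X Y π k :=
  (fun i => p.1 (π i), p.2, fun u => p.1 u)

theorem measurable_kramerCond : Measurable (kramerCond (X := X) (Y := Y) π k) := by
  unfold kramerCond
  fun_prop

/-- The `k`-th term of the first family of bounds for the input `x`, with the conditional law of
the output replaced by `q`. -/
def kramerCost (W : Kernel (∀ k, X k) (∀ k, Y k)) (q : Kernel (KramerCond X Y π k) (Y (π k)))
    (x : ∀ k, X k) : ℝ≥0∞ :=
  sideCost (kramerJoint π k W) (q.comap (kramerCond π k) (measurable_kramerCond π k)) x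

variable {π k}

instance {W : Kernel (∀ k, X k) (∀ k, Y k)} {k j : Fin K} (C : OutputCoupling W k j) :
    IsMarkovKernel C.ker := C.isMarkovKernel

/-- The term of the second family of bounds for the inputs `z`, with the conditional law of
the output replaced by `q`. -/
def etwCost {W : Kernel (∀ k, X k) (∀ k, Y k)} {k j : Fin K} (C : OutputCoupling W k j)
    (q : Kernel (Y j × X j) (Y k)) (z : (∀ i, X i) × X j) : ℝ≥0∞ :=
  sideCost (C.ker.map Prod.swap)
    (q.comap (fun p : ((∀ i, X i) × X j) × Y j => (p.2, p.1.2)) (by fun_prop)) z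

/-- The outer bounds for a given input law in variational form: the conditional laws of the outputs
given the side information are replaced by arbitrary kernels. -/
structure RelaxedBounds (W : Kernel (∀ k, X k) (∀ k, Y k)) (P : InputLaw X) (R : Fin K → ℝ) :
    Prop where
  kramer : ∀ (S : Finset (Fin K)) (π : Fin S.card ≃ S)
    (q : Fin P.card → ∀ k, Kernel (KramerCond X Y π k) (Y (π k))),
    (∀ t k, IsMarkovKernel (q t k)) →
    ENNReal.ofReal (∑ u ∈ S, R u) ≤
      ∫⁻ t, ∑ k, ∫⁻ x, kramerCost π k W (q t k) x ∂(P.inputs t) ∂(P.law : Measure (Fin P.card))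
  etw : ∀ (S : Finset (Fin K)) (π : Fin S.card ≃ S)
    (C : ∀ k : Fin S.card, OutputCoupling W (S.orderEmbOfFin rfl k) (π k))
    (q : ∀ k : Fin S.card, Kernel (Y (π k) × X (π k)) (Y (S.orderEmbOfFin rfl k))),
    (∀ k, IsMarkovKernel (q k)) →
    ENNReal.ofReal (∑ u ∈ S, R u) ≤
      ∫⁻ t, ∑ k, ∫⁻ z, etwCost (C k) (q k) z ∂((P.inputs ×ₖ P.single (π k)) t)
        ∂(P.law : Measure (Fin P.card))

end Relaxed

/-! ### Averages over message vectors -/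

section Averaging

variable {K : ℕ} {M : Fin K → ℕ}

open scoped Classical in
/-- The messages `w` for the users in `T` and `e` for the other users. -/
def joinOn (T : Set (Fin K)) (w e : ∀ i, Fin (M i)) : ∀ i, Fin (M i) := T.piecewise w e

@[simp]
theorem joinOn_of_mem {T : Set (Fin K)} {i : Fin K} (h : i ∈ T) (w e : ∀ i, Fin (M i)) :
    joinOn T w e i = w i := by
  classical exact if_pos h

@[simp]
theorem joinOn_of_notMem {T : Set (Fin K)} {i : Fin K} (h : i ∉ T) (w e : ∀ i, Fin (M i)) :
    joinOn T w e i = e i := by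
  classical exact if_neg h

/-- Exchanging the coordinates outside `T` between `w` and `e` is an involution of the pairs that
turns the joined vector into a single component. Every message vector is thus produced equally
often, so inequalities with the messages in `T` frozen can be summed. -/
theorem sum_sum_joinOn (T : Set (Fin K)) (F : (∀ i, Fin (M i)) → ℝ≥0∞) :
    ∑ w, ∑ e, F (joinOn T w e) = Fintype.card (∀ i, Fin (M i)) * ∑ w, F w := by
  have h : Function.Involutive fun p : (∀ i, Fin (M i)) × (∀ i, Fin (M i)) =>
      (joinOn T p.1 p.2, joinOn T p.2 p.1) := by
    rintro ⟨w, e⟩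
    ext i : 2 <;> by_cases hi : i ∈ T <;> simp [hi]
  rw [← Fintype.sum_prod_type', ← Equiv.sum_comp h.toPerm, Fintype.sum_prod_type, Finset.sum_comm]
  have h1 : ∀ w e : ∀ i, Fin (M i), joinOn T (joinOn T w e) (joinOn T e w) = w := by
    intro w e
    ext i : 1
    by_cases hi : i ∈ T <;> simp [hi]
  simp [Function.Involutive.toPerm, h1]

theorem sum_sum_update (u : Fin K) (F : (∀ i, Fin (M i)) → ℝ≥0∞) :
    ∑ d, ∑ e, F (Function.update e u d) = M u * ∑ w, F w := by
  have h : Function.Involutive fun p : Fin (M u) × (∀ i, Fin (M i)) =>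
      (p.2 u, Function.update p.2 u p.1) := by
    rintro ⟨d, e⟩
    simp
  rw [← Fintype.sum_prod_type' (f := fun d e => F (Function.update e u d)),
    ← Equiv.sum_comp h.toPerm, Fintype.sum_prod_type]
  simp [Function.Involutive.toPerm]

theorem sum_joinOn_update (T : Set (Fin K)) (u : Fin K) (F : (∀ i, Fin (M i)) → ℝ≥0∞) :
    ∑ w, ∑ d, ∑ e, F (joinOn T w (Function.update e u d)) =
      M u * Fintype.card (∀ i, Fin (M i)) * ∑ w, F w := by
  rw [mul_assoc, ← sum_sum_joinOn T F, Finset.mul_sum]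
  exact Finset.sum_congr rfl fun w _ => sum_sum_update u fun e => F (joinOn T w e)

theorem uniformMix_update {α : Type*} [MeasurableSpace α] (u : Fin K) (hu : 0 < M u)
    (H : (∀ i, Fin (M i)) → Measure α) :
    uniformMix (fun p : Fin (M u) × (∀ i, Fin (M i)) => H (Function.update p.2 u p.1)) =
      uniformMix H := by
  ext s hs
  have h0 : (M u : ℝ≥0∞) ≠ 0 := by simpa using hu.ne'
  simp only [uniformMix, Measure.smul_apply, Measure.coe_finsetSum, Finset.sum_apply, smul_eq_mul,
    Fintype.sum_prod_type, Fintype.card_prod, Fintype.card_fin, Nat.cast_mul]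
  rw [sum_sum_update u fun e => H e s, ENNReal.mul_inv (Or.inl h0) (Or.inl (by simp)), mul_mul_mul_comm,
    ENNReal.inv_mul_cancel h0 (by simp), one_mul]

end Averaging

/-! ### Converse for a single user with side information -/

section Converse

variable {K : ℕ} {X Y : Fin K → Type*} [∀ k, MeasurableSpace (X k)] [∀ k, MeasurableSpace (Y k)]
  {n : ℕ} {M : Fin K → ℕ} (c : Code X Y n M) (W : Kernel (∀ k, X k) (∀ k, Y k))

/-- The channel inputs at time `t`. -/
def Code.letter (w : ∀ i, Fin (M i)) (t : Fin n) : ∀ i, X i := fun i => c.enc i (w i) t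

/-- The law of a function of the outputs, over a block, given the messages. -/
def Code.block {Z : Type*} [MeasurableSpace Z] (z : (∀ k, Y k) → Z) (w : ∀ i, Fin (M i)) :
    Measure (Fin n → Z) :=
  Measure.pi fun t => (W (c.letter w t)).map z

/-- The conditional mutual information, up to a factor, between the messages and a function of the
outputs, given the messages of the users in `T`. -/
def Code.leak {Z : Type*} [MeasurableSpace Z] (T : Set (Fin K)) (z : (∀ k, Y k) → Z) : ℝ≥0∞ :=
  ∑ w, klDiv (c.block W z w) (uniformMix fun e => c.block W z (joinOn T w e))

/-- The probability that receiver `k` decodes its message correctly. -/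
def Code.success (k : Fin K) (w : ∀ i, Fin (M i)) : ℝ≥0∞ :=
  Measure.pi (fun t => W (c.letter w t)) {y | c.dec k (fun t => y t k) = w k}

variable [IsMarkovKernel W]

theorem Code.isProbabilityMeasure_block {Z : Type*} [MeasurableSpace Z] {z : (∀ k, Y k) → Z}
    (hz : Measurable z) (w : ∀ i, Fin (M i)) : IsProbabilityMeasure (c.block W z w) := by
  have : ∀ t, IsProbabilityMeasure ((W (c.letter w t)).map z) := fun t =>
    Measure.isProbabilityMeasure_map hz.aemeasurable
  unfold Code.block
  infer_instance

/-- Since `joinOn T w w = w`, the law under `w` is itself a member of the mixture. Finiteness is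
needed because leaks are later cancelled from both sides of inequalities in `[0, ∞]`. -/
theorem Code.leak_ne_top {Z : Type*} [MeasurableSpace Z] (T : Set (Fin K)) {z : (∀ k, Y k) → Z}
    (hz : Measurable z) : c.leak W T z ≠ ∞ := by
  refine ENNReal.sum_ne_top.mpr fun w _ => ?_
  have := fun w => c.isProbabilityMeasure_block W hz w
  have h := klDiv_uniformMix_ne_top (fun e => c.block W z (joinOn T w e)) w
  have h1 : joinOn T w w = w := by
    ext i : 1
    by_cases hi : i ∈ T <;> simp [hi]
  rwa [h1] at h

theorem Code.leak_of_subsingleton {Z : Type*} [MeasurableSpace Z] [Subsingleton Z]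
    (T : Set (Fin K)) {z : (∀ k, Y k) → Z} (hz : Measurable z) : c.leak W T z = 0 := by
  refine Finset.sum_eq_zero fun w _ => ?_
  have := fun w => c.isProbabilityMeasure_block W hz w
  have : Nonempty (∀ i, Fin (M i)) := ⟨w⟩
  rw [klDiv_eq_zero_iff]
  ext s hs
  rcases Set.eq_empty_or_nonempty s with rfl | ⟨x, hx⟩
  · simp
  · have : s = Set.univ := Set.eq_univ_of_forall fun y => by rwa [Subsingleton.elim y x]
    rw [this, measure_univ, measure_univ]

theorem Code.pi_map_eq {Z : Type*} [MeasurableSpace Z] {z : (∀ k, Y k) → Z} (hz : Measurable z)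
    (w : ∀ i, Fin (M i)) :
    (Measure.pi fun t => W (c.letter w t)).map (fun y t => z (y t)) = c.block W z w := by
  have : ∀ t, IsProbabilityMeasure ((W (c.letter w t)).map z) := fun t =>
    Measure.isProbabilityMeasure_map hz.aemeasurable
  exact Measure.pi_map_pi (f := fun _ => z) fun _ => hz.aemeasurable

variable [∀ k, StandardBorelSpace (Y k)] [∀ k, Nonempty (Y k)]

/-- One link of the telescope. The messages in `T` are frozen, the earlier outputs are the side
information, and `fano_block` is applied to the message of `π k`. The information paid for is that
of the earlier outputs given `T`; what is left over is information given `T` and the decoded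
message, for any function `f` of the earlier outputs and the new one. -/
theorem Code.kramer_step (hM : ∀ i, 0 < M i) {S : Finset (Fin K)} (π : Fin S.card ≃ S)
    (k : Fin S.card) {Z : Type*} [MeasurableSpace Z]
    {f : ((i : Set.Iio k) → Y (π i)) × Y (π k) → Z} (hf : Measurable f)
    {T : Set (Fin K)} (hS : ∀ i ∉ S, i ∈ T) (hlt : ∀ i < k, (π i : Fin K) ∈ T)
    (hk : (π k : Fin K) ∉ T)
    (q : Fin n → Kernel (KramerCond X Y π k) (Y (π k))) [∀ t, IsMarkovKernel (q t)] :
    ENNReal.ofReal (Real.log (M (π k))) * ∑ w, c.success W (π k) w +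
        c.leak W (insert (π k : Fin K) T) (fun y => f (outputPair π k y)) ≤
      Fintype.card (∀ i, Fin (M i)) + c.leak W T (fun y (i : Set.Iio k) => y (π i)) +
        ∑ w, ∑ t, kramerCost π k W (q t) (c.letter w t) := by
  have : Nonempty (∀ i, Fin (M i)) := ⟨fun i => ⟨0, hM i⟩⟩
  have hpair := measurable_outputPair (Y := Y) π k
  set N : ℝ≥0∞ := ((Fintype.card (∀ i, Fin (M i)) : ℕ) : ℝ≥0∞) with hN
  have hM0 : (M (π k).1 : ℝ≥0∞) ≠ 0 := by simpa using (hM (π k).1).ne'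
  have hN0 : N ≠ 0 := Nat.cast_ne_zero.mpr Fintype.card_ne_zero
  -- The vector `w` supplies the messages in `T`, `d` the decoded message, and `e` all others; the
  -- remaining coordinates of `w` and `e` are ignored.
  let v : (∀ i, Fin (M i)) → Fin (M (π k).1) → (∀ i, Fin (M i)) → ∀ i, Fin (M i) :=
    fun w d e => joinOn T w (Function.update e (π k).1 d)
  have hvT : ∀ w d e, ∀ i ∈ T, v w d e i = w i := fun w d e i hi => by simp [v, hi]
  have key : ∀ w, ENNReal.ofReal (Real.log (M (π k).1)) * ∑ d, ∑ e, c.success W (π k).1 (v w d e) +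
      ∑ d, ∑ e, klDiv (c.block W (fun y => f (outputPair π k y)) (v w d e))
        (uniformMix fun e' => c.block W (fun y => f (outputPair π k y))
          (joinOn (insert (π k).1 T) (v w d e) e')) ≤
      M (π k).1 * N + ∑ d, ∑ e, klDiv (c.block W (fun y (i : Set.Iio k) => y (π i)) (v w d e))
        (uniformMix fun e' => c.block W (fun y (i : Set.Iio k) => y (π i))
          (joinOn T (v w d e) e')) +
      ∑ d, ∑ e, ∑ t, kramerCost π k W (q t) (c.letter (v w d e) t) := by
    intro w
    -- In `fano_block` the kernel may not depend on `d` or `e`. The inputs of the earlier users and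
    -- of the users outside `S` belong to `T`, so they can be read off from `w`.
    let g : Fin n → ((i : Set.Iio k) → Y (π i)) → KramerCond X Y π k := fun t y =>
      (fun i => c.letter w t (π i), y, fun i => c.letter w t i)
    have hg : ∀ t, Measurable (g t) := fun t => by simp only [g]; fun_prop
    have h := fano_block (E := ∀ i, Fin (M i)) (hM (π k).1)
      (fun d e t => kramerJoint π k W (c.letter (v w d e) t))
      (fun t => (q t).comap (g t) (hg t)) hf
      (A := fun d => {b | c.dec (π k).1 (fun t => (b t).2) = d})
      (fun d => by
        have : Measurable fun b : Fin n → ((i : Set.Iio k) → Y (π i)) × Y (π k) =>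
          c.dec (π k).1 (fun t => (b t).2) := (c.measurable_dec (π k).1).comp (by fun_prop)
        exact this (measurableSet_singleton d))
      (fun d d' hdd => Set.disjoint_left.mpr fun b hb hb' => hdd (hb.symm.trans hb'))
    have e1 : ∀ d e, Measure.pi (fun t => kramerJoint π k W (c.letter (v w d e) t))
        {b | c.dec (π k).1 (fun t => (b t).2) = d} = c.success W (π k).1 (v w d e) := by
      intro d e
      simp_rw [kramerJoint_apply]
      have h1 := c.pi_map_eq W hpair (v w d e)
      rw [Code.block] at h1
      have hms : MeasurableSet {b : Fin n → ((i : Set.Iio k) → Y (π i)) × Y (π k) |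
          c.dec (π k).1 (fun t => (b t).2) = d} := by
        have : Measurable fun b : Fin n → ((i : Set.Iio k) → Y (π i)) × Y (π k) =>
          c.dec (π k).1 (fun t => (b t).2) := (c.measurable_dec (π k).1).comp (by fun_prop)
        exact this (measurableSet_singleton d)
      rw [← h1, Measure.map_apply (by fun_prop) hms, Code.success]
      have hd : v w d e (π k).1 = d := by simp [v, hk]
      rw [hd]
      rfl
    have e2 : ∀ d e, (Measure.pi fun t => (kramerJoint π k W (c.letter (v w d e) t)).map f) =
        c.block W (fun y => f (outputPair π k y)) (v w d e) := by
      intro d e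
      rw [Code.block]
      congr 1
      funext t
      rw [kramerJoint_apply, Measure.map_map hf hpair]
      rfl
    have e3 : ∀ d e, (Measure.pi fun t => (kramerJoint π k W (c.letter (v w d e) t)).fst) =
        c.block W (fun y (i : Set.Iio k) => y (π i)) (v w d e) := by
      intro d e
      rw [Code.block]
      congr 1
      funext t
      rw [kramerJoint_apply, Measure.fst, Measure.map_map measurable_fst hpair]
      rfl
    have e4 : ∀ d e t, klDiv (kramerJoint π k W (c.letter (v w d e) t))
        ((kramerJoint π k W (c.letter (v w d e) t)).fst ⊗ₘ (q t).comap (g t) (hg t)) =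
        kramerCost π k W (q t) (c.letter (v w d e) t) := by
      intro d e t
      rw [kramerCost, sideCost_eq]
      congr 2
      ext y : 1
      simp only [Kernel.comap_apply, Kernel.sectR_apply, g, kramerCond]
      congr 2
      · funext i
        simp only [Code.letter]
        rw [hvT _ _ _ _ (hlt i i.2)]
      · congr 1
        funext i
        simp only [Code.letter]
        rw [hvT _ _ _ _ (hS i i.2)]
    simp_rw [e1, e2, e3, e4] at h
    have e5 : ∀ d e e', v w d e' = joinOn (insert (π k).1 T) (v w d e) e' := by
      intro d e e'
      ext i : 1
      by_cases hi : i ∈ T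
      · simp [v, hi]
      · by_cases hiu : i = (π k).1
        · rw [hiu]
          simp [v, hk]
        · simp [v, hi, hiu]
    have e6 : ∀ d e, (uniformMix fun p : Fin (M (π k).1) × (∀ i, Fin (M i)) =>
        c.block W (fun y (i : Set.Iio k) => y (π i)) (v w p.1 p.2)) =
        uniformMix fun e' => c.block W (fun y (i : Set.Iio k) => y (π i))
          (joinOn T (v w d e) e') := by
      intro d e
      rw [uniformMix_update (π k).1 (hM (π k).1) fun e' =>
        c.block W (fun y (i : Set.Iio k) => y (π i)) (joinOn T w e')]
      congr 1
      funext e'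
      congr 1
      ext i : 1
      by_cases hi : i ∈ T <;> simp [v, hi]
    calc _ = _ := by
          congr 1
          refine Finset.sum_congr rfl fun d _ => Finset.sum_congr rfl fun e _ => ?_
          simp_rw [← e5 d e]
      _ ≤ _ := h
      _ = _ := by
          congr 2
          refine Finset.sum_congr rfl fun d _ => Finset.sum_congr rfl fun e _ => ?_
          rw [e6 d e]
  have hsum := Finset.sum_le_sum fun w (_ : w ∈ Finset.univ) => key w
  simp only [Finset.sum_add_distrib, ← Finset.mul_sum] at hsum
  rw [sum_joinOn_update T (π k).1 (c.success W (π k).1),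
    sum_joinOn_update T (π k).1 (fun w => klDiv (c.block W (fun y => f (outputPair π k y)) w)
        (uniformMix fun e' => c.block W (fun y => f (outputPair π k y))
          (joinOn (insert (π k).1 T) w e'))),
    sum_joinOn_update T (π k).1 (fun w => klDiv (c.block W (fun y (i : Set.Iio k) => y (π i)) w)
        (uniformMix fun e' => c.block W (fun y (i : Set.Iio k) => y (π i))
          (joinOn T w e'))),
    sum_joinOn_update T (π k).1 (fun w => ∑ t, kramerCost π k W (q t) (c.letter w t))] at hsum
  -- Summation over `w`, `d` and `e` counts each message vector `M * N` times; this common factor is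
  -- finite and nonzero.
  rw [← ENNReal.mul_le_mul_iff_right (a := M (π k).1 * N) (mul_ne_zero hM0 hN0)
    (ENNReal.mul_ne_top (by simp) (ENNReal.natCast_ne_top _))]
  calc _ = _ := by rw [mul_add, mul_left_comm]; rfl
    _ ≤ _ := hsum
    _ = _ := by
      rw [Finset.sum_const, Finset.card_univ, nsmul_eq_mul, mul_add, mul_add]
      congr 2
      ring

/-- A second message vector `w'` is frozen and supplies the letters `X'_j`. Given `w'`, the side
information is an output of user `j` whose own message is `w'_j`, so its cost averages to the leak
of `Y_j` given `W_j`. Decoding at `s` leaves over the leak of `Y_s` given `W_s`. The square of the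
number of message vectors comes from the two independent vectors. -/
theorem Code.etw_step (hM : ∀ i, 0 < M i) {s j : Fin K} (C : OutputCoupling W s j)
    (q : Kernel (Y j × X j) (Y s)) [IsMarkovKernel q] :
    ENNReal.ofReal (Real.log (M s)) *
          (Fintype.card (∀ i, Fin (M i)) * ∑ w, c.success W s w) +
        Fintype.card (∀ i, Fin (M i)) * c.leak W {s} (fun y => y s) ≤
      Fintype.card (∀ i, Fin (M i)) * Fintype.card (∀ i, Fin (M i)) +
        Fintype.card (∀ i, Fin (M i)) * c.leak W {j} (fun y => y j) +
        ∑ w', ∑ w, ∑ t, etwCost C q (c.letter w t, c.letter w' t j) := by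
  have : Nonempty (∀ i, Fin (M i)) := ⟨fun i => ⟨0, hM i⟩⟩
  set N : ℝ≥0∞ := ((Fintype.card (∀ i, Fin (M i)) : ℕ) : ℝ≥0∞) with hN
  have hM0 : (M s : ℝ≥0∞) ≠ 0 := by simpa using (hM s).ne'
  have hmarg : ∀ x x', ((C.ker (x, x')).map Prod.swap).map Prod.snd = (W x).map fun y => y s := by
    intro x x'
    rw [Measure.map_map measurable_snd measurable_swap, ← C.map_fst x x']
    rfl
  -- The coupling enters only through its marginals in the Fano and leak terms; its dependence
  -- structure is visible only in the cost.
  have hmarg' : ∀ x x', ((C.ker (x, x')).map Prod.swap).fst =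
      (W (Function.update x j x')).map fun y => y j := by
    intro x x'
    rw [Measure.fst, Measure.map_map measurable_fst measurable_swap, ← C.map_snd x x']
    rfl
  have key : ∀ w' : ∀ i, Fin (M i),
      ENNReal.ofReal (Real.log (M s)) * ∑ d, ∑ e, c.success W s (Function.update e s d) +
      ∑ d, ∑ e, klDiv (c.block W (fun y => y s) (Function.update e s d))
        (uniformMix fun e' => c.block W (fun y => y s)
          (joinOn {s} (Function.update e s d) e')) ≤
      M s * N + ∑ d, ∑ e, klDiv (c.block W (fun y => y j)
          (joinOn {j} w' (Function.update e s d)))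
        (uniformMix fun e' => c.block W (fun y => y j)
          (joinOn {j}
            (joinOn {j} w' (Function.update e s d)) e')) +
      ∑ d, ∑ e, ∑ t, etwCost C q (c.letter (Function.update e s d) t, c.letter w' t j) := by
    intro w'
    have hpr : ∀ z, IsProbabilityMeasure ((C.ker z).map Prod.swap) := fun z =>
      Measure.isProbabilityMeasure_map measurable_swap.aemeasurable
    have h := fano_block (E := ∀ i, Fin (M i)) (hM s)
      (fun d e t => (C.ker (c.letter (Function.update e s d) t, c.letter w' t j)).map Prod.swap)
      (fun t => q.comap (fun y => (y, c.letter w' t j)) (by fun_prop)) measurable_snd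
      (A := fun d => {b | c.dec s (fun t => (b t).2) = d})
      (fun d => by
        have : Measurable fun b : Fin n → Y j × Y s =>
          c.dec s (fun t => (b t).2) := (c.measurable_dec s).comp (by fun_prop)
        exact this (measurableSet_singleton d))
      (fun d d' hdd => Set.disjoint_left.mpr fun b hb hb' => hdd (hb.symm.trans hb'))
    have e2 : ∀ d e, (Measure.pi fun t =>
        ((C.ker (c.letter (Function.update e s d) t, c.letter w' t j)).map Prod.swap).map Prod.snd)
        = c.block W (fun y => y s) (Function.update e s d) := by
      intro d e
      simp_rw [hmarg]
      rfl
    have e1 : ∀ d e, Measure.pi (fun t =>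
        (C.ker (c.letter (Function.update e s d) t, c.letter w' t j)).map Prod.swap)
        {b | c.dec s (fun t => (b t).2) = d} = c.success W s (Function.update e s d) := by
      intro d e
      have hd : MeasurableSet {b : Fin n → Y s | c.dec s b = d} :=
        (c.measurable_dec s) (measurableSet_singleton d)
      have h1 : c.success W s (Function.update e s d) =
          c.block W (fun y => y s) (Function.update e s d) {b | c.dec s b = d} := by
        rw [← c.pi_map_eq W (measurable_pi_apply s),
          Measure.map_apply (by fun_prop) hd, Code.success, Function.update_self]
        rfl
      have hpr' : ∀ z, IsProbabilityMeasure (((C.ker z).map Prod.swap).map Prod.snd) := fun z =>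
        Measure.isProbabilityMeasure_map measurable_snd.aemeasurable
      rw [h1, ← e2 d e, ← Measure.pi_map_pi (f := fun _ => Prod.snd)
        fun _ => measurable_snd.aemeasurable, Measure.map_apply (by fun_prop) hd]
      rfl
    have e3 : ∀ d e, (Measure.pi fun t =>
        ((C.ker (c.letter (Function.update e s d) t, c.letter w' t j)).map Prod.swap).fst) =
        c.block W (fun y => y j) (joinOn {j} w' (Function.update e s d)) := by
      intro d e
      simp_rw [hmarg']
      rw [Code.block]
      congr 1
      funext t
      congr 2
      funext i
      by_cases hi : i = j
      · subst hi
        simp [Code.letter]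
      · simp [Code.letter, hi]
    have e4 : ∀ d e t, klDiv
        ((C.ker (c.letter (Function.update e s d) t, c.letter w' t j)).map Prod.swap)
        (((C.ker (c.letter (Function.update e s d) t, c.letter w' t j)).map Prod.swap).fst ⊗ₘ
          q.comap (fun y => (y, c.letter w' t j)) (by fun_prop)) =
        etwCost C q (c.letter (Function.update e s d) t, c.letter w' t j) := by
      intro d e t
      have : IsMarkovKernel (C.ker.map Prod.swap) := Kernel.IsMarkovKernel.map _ measurable_swap
      rw [etwCost, sideCost_eq, Kernel.map_apply _ measurable_swap]
      rfl
    simp_rw [e1, e2, e3, e4] at h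
    have e5 : ∀ (d : Fin (M s)) (e e' : ∀ i, Fin (M i)), Function.update e' s d =
        joinOn {s} (Function.update e s d) e' := by
      intro d e e'
      ext i : 1
      by_cases hi : i = s
      · subst hi
        simp
      · simp [hi]
    have e6 : ∀ (d : Fin (M s)) (e : ∀ i, Fin (M i)),
        (uniformMix fun p : Fin (M s) × (∀ i, Fin (M i)) =>
          c.block W (fun y => y j) (joinOn {j} w' (Function.update p.2 s p.1))) =
        uniformMix fun e' => c.block W (fun y => y j) (joinOn {j}
            (joinOn {j} w' (Function.update e s d)) e') := by
      intro d e
      rw [uniformMix_update s (hM s) fun e' =>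
        c.block W (fun y => y j) (joinOn {j} w' e')]
      congr 1
      funext e'
      congr 1
      ext i : 1
      by_cases hi : i = j
      · subst hi
        simp
      · simp [hi]
    calc _ = _ := by
          congr 1
          refine Finset.sum_congr rfl fun d _ => Finset.sum_congr rfl fun e _ => ?_
          simp_rw [← e5 d e]
      _ ≤ _ := h
      _ = _ := by
          congr 2
          refine Finset.sum_congr rfl fun d _ => Finset.sum_congr rfl fun e _ => ?_
          rw [e6 d e]
  have hsum := Finset.sum_le_sum fun w (_ : w ∈ Finset.univ) => key w
  simp only [Finset.sum_add_distrib] at hsum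
  rw [sum_joinOn_update {j} s (fun w => klDiv (c.block W (fun y => y j) w)
        (uniformMix fun e' => c.block W (fun y => y j)
          (joinOn {j} w e')))] at hsum
  simp_rw [sum_sum_update s (c.success W s),
    sum_sum_update s (fun w => klDiv (c.block W (fun y => y s) w)
        (uniformMix fun e' => c.block W (fun y => y s)
          (joinOn {s} w e')))] at hsum
  have h7 : ∀ w' : ∀ i, Fin (M i),
      ∑ d, ∑ e, ∑ t, etwCost C q (c.letter (Function.update e s d) t, c.letter w' t j) =
      M s * ∑ w, ∑ t, etwCost C q (c.letter w t, c.letter w' t j) := fun w' =>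
    sum_sum_update s fun w => ∑ t, etwCost C q (c.letter w t, c.letter w' t j)
  simp_rw [h7] at hsum
  simp only [Finset.sum_const, Finset.card_univ, nsmul_eq_mul, ← Finset.mul_sum] at hsum
  rw [← ENNReal.mul_le_mul_iff_right (a := M s) hM0 (by simp)]
  calc _ = _ := by
        rw [Code.leak, hN]
        ring
    _ ≤ _ := hsum
    _ = _ := by
        rw [Code.leak, hN]
        ring

end Converse

/-! ### Finitely supported input laws -/

section DiscreteMeasures

theorem pi_sum_smul_dirac {K : ℕ} {X ι : Fin K → Type*} [∀ k, MeasurableSpace (X k)]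
    [∀ k, Fintype (ι k)] (w : ∀ k, ι k → ℝ≥0∞) (f : ∀ k, ι k → X k)
    [∀ k, IsProbabilityMeasure (∑ i, w k i • Measure.dirac (f k i))] :
    Measure.pi (fun k => ∑ i, w k i • Measure.dirac (f k i)) =
      ∑ i : ∀ k, ι k, (∏ k, w k (i k)) • Measure.dirac fun k => f k (i k) := by
  classical
  refine Measure.pi_eq fun s hs => ?_
  simp only [Measure.coe_finsetSum, Finset.sum_apply, Measure.smul_apply, smul_eq_mul]
  have h : ∀ k, ∀ i, Measure.dirac (f k i) (s k) = (s k).indicator 1 (f k i) := fun k i =>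
    Measure.dirac_apply' _ (hs k)
  simp_rw [h]
  rw [Finset.prod_univ_sum, Fintype.piFinset_univ]
  refine Finset.sum_congr rfl fun i _ => ?_
  rw [Measure.dirac_apply' _ (MeasurableSet.univ_pi hs), Finset.prod_mul_distrib]
  congr 1
  by_cases hi : ∀ k, f k (i k) ∈ s k
  · rw [Set.indicator_of_mem (by simpa using hi)]
    simp [hi]
  · rw [Set.indicator_of_notMem (by simpa using hi)]
    push Not at hi
    obtain ⟨k, hk⟩ := hi
    exact (Finset.prod_eq_zero (Finset.mem_univ k) (Set.indicator_of_notMem hk _)).symm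

/-- A product of uniform laws on codeword letters is uniform over message vectors, which is how
independent encoders realise `∏ P_{X_k|Q}` at each time. -/
theorem pi_uniformMix_dirac {K : ℕ} {X ι : Fin K → Type*} [∀ k, MeasurableSpace (X k)]
    [∀ k, Fintype (ι k)] [∀ k, Nonempty (ι k)] (f : ∀ k, ι k → X k) :
    Measure.pi (fun k => uniformMix fun i => Measure.dirac (f k i)) =
      uniformMix fun i : ∀ k, ι k => Measure.dirac fun k => f k (i k) := by
  have h : ∀ k, (uniformMix fun i => Measure.dirac (f k i)) =
      ∑ i, ((Fintype.card (ι k) : ℝ≥0∞)⁻¹) • Measure.dirac (f k i) := fun k => Finset.smul_sum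
  have : ∀ k, IsProbabilityMeasure
      (∑ i, ((Fintype.card (ι k) : ℝ≥0∞)⁻¹) • Measure.dirac (f k i)) := fun k => by
    rw [← h k]; infer_instance
  simp_rw [h]
  rw [pi_sum_smul_dirac (fun k _ => (Fintype.card (ι k) : ℝ≥0∞)⁻¹), uniformMix, Finset.smul_sum]
  refine Finset.sum_congr rfl fun i _ => ?_
  congr 1
  classical
  rw [Fintype.card_pi, Nat.cast_prod, ENNReal.prod_inv_distrib]
  intro a _ b _ _
  exact Or.inl (by simp)

theorem lintegral_uniformMix_dirac {ι α : Type*} [Fintype ι] [MeasurableSpace α] (f : ι → α)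
    {g : α → ℝ≥0∞} (hg : Measurable g) :
    ∫⁻ x, g x ∂(uniformMix fun i => Measure.dirac (f i)) =
      (Fintype.card ι : ℝ≥0∞)⁻¹ * ∑ i, g (f i) := by
  rw [lintegral_uniformMix]
  simp_rw [lintegral_dirac' _ hg]

end DiscreteMeasures

/-! ### Summation over the users of `S` -/

section Totals

variable {K : ℕ} {X Y : Fin K → Type*} [∀ k, MeasurableSpace (X k)] [∀ k, MeasurableSpace (Y k)]
  {n : ℕ} {M : Fin K → ℕ} (c : Code X Y n M) (W : Kernel (∀ k, X k) (∀ k, Y k)) [IsMarkovKernel W]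

theorem Code.leak_comp_le {Z Z' : Type*} [MeasurableSpace Z] [MeasurableSpace Z']
    (T : Set (Fin K)) {z : (∀ k, Y k) → Z} (hz : Measurable z) {g : Z → Z'} (hg : Measurable g) :
    c.leak W T (fun y => g (z y)) ≤ c.leak W T z := by
  refine Finset.sum_le_sum fun w _ => ?_
  have := fun w => c.isProbabilityMeasure_block W hz w
  have hm : Measurable fun (x : Fin n → Z) t => g (x t) := by fun_prop
  have h : ∀ w, c.block W (fun y => g (z y)) w = (c.block W z w).map fun x t => g (x t) := by
    intro w
    have h1 := c.pi_map_eq W (hg.comp hz) w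
    simp only [Function.comp_apply] at h1
    have h2 := c.pi_map_eq W hz w
    rw [← h2, Measure.map_map hm (by fun_prop)]
    exact h1.symm
  have : Nonempty (∀ i, Fin (M i)) := ⟨w⟩
  simp_rw [h]
  rw [← uniformMix_map _ hm]
  exact klDiv_map_le _ _ hm

variable [∀ k, StandardBorelSpace (Y k)] [∀ k, Nonempty (Y k)]

/-- Each step leaves over exactly the information that the next step pays for. The first payment
vanishes, as there are no earlier outputs, and the last leftover is dropped. -/
theorem Code.kramer_total (hM : ∀ i, 0 < M i) {S : Finset (Fin K)} (π : Fin S.card ≃ S)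
    (q : Fin n → ∀ k, Kernel (KramerCond X Y π k) (Y (π k))) [∀ t k, IsMarkovKernel (q t k)] :
    ∑ k, ENNReal.ofReal (Real.log (M (π k))) * ∑ w, c.success W (π k) w ≤
      S.card * Fintype.card (∀ i, Fin (M i)) +
        ∑ k, ∑ w, ∑ t, kramerCost π k W (q t k) (c.letter w t) := by
  -- All users outside `S` together with the first `N` users in the order `π`; the implication holds
  -- vacuously outside `S`.
  let T : ℕ → Set (Fin K) := fun N => {u | ∀ h : u ∈ S, (π.symm ⟨u, h⟩ : ℕ) < N}
  let V : ∀ N : ℕ, (∀ k, Y k) → (i : {i : Fin S.card // (i : ℕ) < N}) → Y (π i) :=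
    fun N y i => y (π i)
  have hV : ∀ N, Measurable (V N) := fun N => by simp only [V]; fun_prop
  let L : ℕ → ℝ≥0∞ := fun N => c.leak W (T N) (V N)
  have hL : ∀ N, L N ≠ ∞ := fun N => c.leak_ne_top W (T N) (hV N)
  have hL0 : L 0 = 0 := by
    have : IsEmpty {i : Fin S.card // (i : ℕ) < 0} := ⟨fun i => by simpa using i.2⟩
    exact c.leak_of_subsingleton W (T 0) (hV 0)
  have step : ∀ k : Fin S.card,
      ENNReal.ofReal (Real.log (M (π k))) * ∑ w, c.success W (π k) w + L (k + 1) ≤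
      Fintype.card (∀ i, Fin (M i)) + L k +
        ∑ w, ∑ t, kramerCost π k W (q t k) (c.letter w t) := by
    intro k
    -- The tuple of the first `k + 1` outputs is a function of the pair of earlier outputs and
    -- current output, so the leftover is expressed in the form of the next payment.
    have hglue : ∀ i : {i : Fin S.card // (i : ℕ) < k + 1},
        ∃ g : ((i : Set.Iio k) → Y (π i)) × Y (π k) → Y (π i),
          Measurable g ∧ ∀ y, g (outputPair π k y) = y (π i) := by
      rintro ⟨i, hi⟩
      rcases Nat.lt_succ_iff_lt_or_eq.mp hi with h | h
      · exact ⟨fun p => p.1 ⟨i, h⟩, by fun_prop, fun y => rfl⟩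
      · obtain rfl : i = k := Fin.ext h
        exact ⟨fun p => p.2, by fun_prop, fun y => rfl⟩
    choose g hg hgy using hglue
    have h1 := c.kramer_step W hM π k (f := fun p i => g i p) (measurable_pi_lambda _ hg)
      (T := T k) (fun u hu h => absurd h hu) (fun i hi h => by simpa using hi)
      (fun h => by simpa using h (π k).2) (fun t => q t k)
    have h2 : insert (π k : Fin K) (T k) = T (k + 1) := by
      ext u
      simp only [T, Set.mem_insert_iff, Set.mem_ofPred_eq]
      constructor
      · rintro (rfl | h) hu
        · simp
        · exact (h hu).trans (Nat.lt_succ_self _)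
      · intro h
        by_cases hu : u ∈ S
        · rcases Nat.lt_succ_iff_lt_or_eq.mp (h hu) with h' | h'
          · exact Or.inr fun _ => h'
          · left
            have : π.symm ⟨u, hu⟩ = k := Fin.ext h'
            rw [← this]
            simp
        · exact Or.inr fun h => absurd h hu
    have h3 : (fun y => (fun p i => g i p) (outputPair π k y)) = V (k + 1) := by
      funext y i
      exact hgy i y
    rw [h2] at h1
    have h4 : c.leak W (T k) (fun y (i : Set.Iio k) => y (π i)) ≤ L k :=
      c.leak_comp_le W (T k) (hV k) (g := fun v (i : Set.Iio k) => v ⟨i, i.2⟩) (by fun_prop)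
    calc _ = ENNReal.ofReal (Real.log (M (π k))) * ∑ w, c.success W (π k) w +
          c.leak W (T (k + 1)) (fun y => (fun p i => g i p) (outputPair π k y)) := by rw [h3]
      _ ≤ _ := h1
      _ ≤ _ := by gcongr
  have hsum := Finset.sum_le_sum fun k (_ : k ∈ Finset.univ) => step k
  simp only [Finset.sum_add_distrib] at hsum
  -- As `L 0 = 0`, the shifted sum exceeds the original one by `L S.card`, which is nonnegative.
  have htel : ∑ k : Fin S.card, L k ≤ ∑ k : Fin S.card, L (k + 1) := by
    rw [Fin.sum_univ_eq_sum_range (fun k => L k), Fin.sum_univ_eq_sum_range (fun k => L (k + 1))]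
    have h5 := Finset.sum_range_succ' L S.card
    rw [Finset.sum_range_succ, hL0, add_zero] at h5
    rw [← h5]
    exact le_self_add
  have hfin : ∑ k : Fin S.card, L k ≠ ∞ := ENNReal.sum_ne_top.mpr fun k _ => hL k
  rw [← ENNReal.add_le_add_iff_right hfin]
  calc _ ≤ _ := add_le_add le_rfl htel
    _ ≤ _ := hsum
    _ = _ := by
      rw [Finset.sum_const, Finset.card_univ, Fintype.card_fin, nsmul_eq_mul]
      ring

theorem sum_orderEmbOfFin_eq {S : Finset (Fin K)} (π : Fin S.card ≃ S) {A : Type*}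
    [AddCommMonoid A] (g : Fin K → A) : ∑ k, g (S.orderEmbOfFin rfl k) = ∑ k, g (π k) := by
  rw [Equiv.sum_comp π fun u : S => g u,
    ← Equiv.sum_comp (S.orderIsoOfFin rfl).toEquiv fun u : S => g u]
  rfl

/-- The leftovers are indexed by the increasing enumeration of `S` and the payments by `π`. Both
enumerate `S`, so the finite leak sums coincide and cancel. -/
theorem Code.etw_total (hM : ∀ i, 0 < M i) {S : Finset (Fin K)} (π : Fin S.card ≃ S)
    (C : ∀ k : Fin S.card, OutputCoupling W (S.orderEmbOfFin rfl k) (π k))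
    (q : ∀ k : Fin S.card, Kernel (Y (π k) × X (π k)) (Y (S.orderEmbOfFin rfl k)))
    [∀ k, IsMarkovKernel (q k)] :
    ∑ k, ENNReal.ofReal (Real.log (M (π k))) *
        (Fintype.card (∀ i, Fin (M i)) * ∑ w, c.success W (π k) w) ≤
      S.card * (Fintype.card (∀ i, Fin (M i)) * Fintype.card (∀ i, Fin (M i))) +
        ∑ k, ∑ w', ∑ w, ∑ t, etwCost (C k) (q k) (c.letter w t, c.letter w' t (π k)) := by
  have hsum := Finset.sum_le_sum fun k (_ : k ∈ Finset.univ) => c.etw_step W hM (C k) (q k)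
  simp only [Finset.sum_add_distrib, ← Finset.mul_sum] at hsum
  rw [sum_orderEmbOfFin_eq π fun u => c.leak W {u} (fun y => y u),
    sum_orderEmbOfFin_eq π fun u => ENNReal.ofReal (Real.log (M u)) *
      (Fintype.card (∀ i, Fin (M i)) * ∑ w, c.success W u w)] at hsum
  have hfin : (Fintype.card (∀ i, Fin (M i)) : ℝ≥0∞) *
      ∑ k, c.leak W {(π k : Fin K)} (fun y => y (π k)) ≠ ∞ :=
    ENNReal.mul_ne_top (ENNReal.natCast_ne_top _)
      (ENNReal.sum_ne_top.mpr fun k _ => c.leak_ne_top W _ (measurable_pi_apply _))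
  rw [← ENNReal.add_le_add_iff_right hfin]
  calc _ ≤ _ := hsum
    _ = _ := by
      rw [Finset.sum_const, Finset.card_univ, Fintype.card_fin, nsmul_eq_mul]
      ring

end Totals

theorem ofReal_sub_div_le {A : ℝ} {m n : ℕ} (hn : 0 < n) {I : ℝ≥0∞}
    (h : ENNReal.ofReal A ≤ m + n * I) : ENNReal.ofReal ((A - m) / n) ≤ I := by
  rw [ENNReal.ofReal_div_of_pos (by exact_mod_cast hn), ENNReal.ofReal_natCast]
  refine ENNReal.div_le_of_le_mul' ?_
  rw [ENNReal.ofReal_sub _ (Nat.cast_nonneg _), ENNReal.ofReal_natCast]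
  exact tsub_le_iff_left.mpr h

theorem InputLaw.lintegral_inputs_prod_single {K : ℕ} {X : Fin K → Type*}
    [∀ k, MeasurableSpace (X k)] (P : InputLaw X) (t : Fin P.card) (j : Fin K)
    {g : (∀ k, X k) × X j → ℝ≥0∞} (hg : Measurable g) :
    ∫⁻ z, g z ∂((P.inputs ×ₖ P.single j) t) =
      ∫⁻ x', ∫⁻ x, g (x, x') ∂(P.inputs t) ∂(P.single j t) := by
  rw [Kernel.prod_apply, lintegral_prod_symm' _ hg]

theorem InputLaw.measurable_lintegral_inputs {K : ℕ} {X : Fin K → Type*}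
    [∀ k, MeasurableSpace (X k)] (P : InputLaw X) (t : Fin P.card) {A : Type*} [MeasurableSpace A]
    {g : (∀ k, X k) × A → ℝ≥0∞} (hg : Measurable g) :
    Measurable fun x' => ∫⁻ x, g (x, x') ∂(P.inputs t) :=
  hg.lintegral_prod_left'

/-! ### Relaxed bounds for the input law induced by a code -/

section CodeLaw

variable {K : ℕ} {X Y : Fin K → Type*} [∀ k, MeasurableSpace (X k)] [∀ k, MeasurableSpace (Y k)]
  {n : ℕ} [NeZero n] {M : Fin K → ℕ} [∀ k, NeZero (M k)] (c : Code X Y n M)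
  (W : Kernel (∀ k, X k) (∀ k, Y k))

/-- The input law of a code: the time-sharing variable is uniform over the block, and the inputs at
each time are the letters of independent uniform messages. -/
abbrev Code.inputLaw : InputLaw X where
  card := n
  law := ⟨uniformMix fun t : Fin n => Measure.dirac t, inferInstance⟩
  input t k := ⟨uniformMix fun d : Fin (M k) => Measure.dirac (c.enc k d t), inferInstance⟩

theorem Code.inputs_inputLaw (t : Fin n) :
    c.inputLaw.inputs t = uniformMix fun w => Measure.dirac (c.letter w t) :=
  pi_uniformMix_dirac fun k d => c.enc k d t

theorem Code.single_inputLaw (t : Fin n) (j : Fin K) :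
    c.inputLaw.single j t = uniformMix fun w => Measure.dirac (c.letter w t j) := by
  have h := (measurePreserving_eval (fun k => (c.inputLaw.input t k : Measure (X k))) j).map_eq
  have h2 : c.inputLaw.single j t = (c.inputLaw.inputs t).map (Function.eval j) := h.symm
  rw [h2, c.inputs_inputLaw, uniformMix_map _ (measurable_pi_apply j)]
  simp_rw [Measure.map_dirac' (measurable_pi_apply j)]

theorem Code.lintegral_inputs (t : Fin n) {g : (∀ k, X k) → ℝ≥0∞} (hg : Measurable g) :
    ∫⁻ x, g x ∂(c.inputLaw.inputs t) =
      (Fintype.card (∀ i, Fin (M i)) : ℝ≥0∞)⁻¹ * ∑ w, g (c.letter w t) := by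
  rw [c.inputs_inputLaw, lintegral_uniformMix_dirac _ hg]

theorem Code.lintegral_inputs_prod (t : Fin n) (j : Fin K) {g : (∀ k, X k) × X j → ℝ≥0∞}
    (hg : Measurable g) :
    ∫⁻ z, g z ∂((c.inputLaw.inputs ×ₖ c.inputLaw.single j) t) =
      ((Fintype.card (∀ i, Fin (M i)) * Fintype.card (∀ i, Fin (M i)) : ℕ) : ℝ≥0∞)⁻¹ *
        ∑ w', ∑ w, g (c.letter w t, c.letter w' t j) := by
  rw [InputLaw.lintegral_inputs_prod_single _ _ _ hg, c.single_inputLaw,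
    lintegral_uniformMix_dirac _ (InputLaw.measurable_lintegral_inputs _ _ hg)]
  have h : ∀ x', ∫⁻ x, g (x, x') ∂(c.inputLaw.inputs t) =
      (Fintype.card (∀ i, Fin (M i)) : ℝ≥0∞)⁻¹ * ∑ w, g (c.letter w t, x') := fun x' =>
    c.lintegral_inputs t (hg.comp measurable_prodMk_right)
  simp_rw [h]
  rw [← Finset.mul_sum, ← mul_assoc, Nat.cast_mul, ENNReal.mul_inv (Or.inr (ENNReal.natCast_ne_top _))
    (Or.inl (ENNReal.natCast_ne_top _))]

theorem Code.lintegral_law (F : Fin n → ℝ≥0∞) :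
    ∫⁻ t, F t ∂(c.inputLaw.law : Measure (Fin c.inputLaw.card)) = (n : ℝ≥0∞)⁻¹ * ∑ t, F t := by
  have := lintegral_uniformMix_dirac (fun t : Fin n => t) (measurable_of_countable F)
  simpa using this

variable [IsMarkovKernel W]

theorem Code.errorProb_le_one (k : Fin K) : c.errorProb W k ≤ 1 := by
  have h0 : (0 : ℝ) < ∏ i, (M i : ℝ) :=
    Finset.prod_pos fun i _ => Nat.cast_pos.mpr (NeZero.pos _)
  rw [Code.errorProb, div_le_one h0]
  calc _ ≤ ∑ w : ∀ i, Fin (M i), (1 : ℝ) := Finset.sum_le_sum fun w _ => measureReal_le_one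
    _ = _ := by simp

theorem Code.sum_success (k : Fin K) :
    ∑ w, c.success W k w =
      Fintype.card (∀ i, Fin (M i)) * ENNReal.ofReal (1 - c.errorProb W k) := by
  have h0 : (0 : ℝ) < ∏ i, (M i : ℝ) :=
    Finset.prod_pos fun i _ => Nat.cast_pos.mpr (NeZero.pos _)
  have hcard : ((Fintype.card (∀ i, Fin (M i)) : ℕ) : ℝ) = ∏ i, (M i : ℝ) := by simp
  have h1 : ∀ w, c.success W k w = ENNReal.ofReal (1 -
      (Measure.pi fun t : Fin n => W fun i => c.enc i (w i) t).real
        {y | c.dec k (fun t => y t k) ≠ w k}) := by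
    intro w
    have hms : MeasurableSet {y : Fin n → ∀ k, Y k | c.dec k (fun t => y t k) = w k} := by
      have : Measurable fun y : Fin n → ∀ k, Y k => c.dec k (fun t => y t k) :=
        (c.measurable_dec k).comp (by fun_prop)
      exact this (measurableSet_singleton _)
    have h2 : {y : Fin n → ∀ k, Y k | c.dec k (fun t => y t k) ≠ w k} =
        {y : Fin n → ∀ k, Y k | c.dec k (fun t => y t k) = w k}ᶜ := rfl
    rw [h2, probReal_compl_eq_one_sub hms, sub_sub_cancel, Code.success, ofReal_measureReal]
    rfl
  simp_rw [h1]
  rw [← ENNReal.ofReal_sum_of_nonneg fun w _ => sub_nonneg.mpr measureReal_le_one,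
    Finset.sum_sub_distrib, Finset.sum_const, Finset.card_univ, nsmul_eq_mul, mul_one,
    ← ENNReal.ofReal_natCast, ← ENNReal.ofReal_mul (Nat.cast_nonneg _), hcard, Code.errorProb,
    mul_sub, mul_one, mul_div_cancel₀ _ h0.ne']

variable [∀ k, StandardBorelSpace (Y k)] [∀ k, Nonempty (Y k)]

theorem measurable_kramerCost {S : Finset (Fin K)} (π : Fin S.card ≃ S) (k : Fin S.card)
    (q : Kernel (KramerCond X Y π k) (Y (π k))) [IsMarkovKernel q] :
    Measurable (kramerCost π k W q) :=
  measurable_sideCost _ _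

theorem measurable_etwCost {W : Kernel (∀ k, X k) (∀ k, Y k)} {k j : Fin K}
    (C : OutputCoupling W k j) (q : Kernel (Y j × X j) (Y k)) [IsMarkovKernel q] :
    Measurable (etwCost C q) := by
  have : IsMarkovKernel (C.ker.map Prod.swap) := Kernel.IsMarkovKernel.map _ measurable_swap
  exact measurable_sideCost _ _

/-- The rates of a code, corrected for its error probability. -/
def Code.rate (u : Fin K) : ℝ := (Real.log (M u) * (1 - c.errorProb W u) - 1) / n

theorem Code.sum_log_mul {S : Finset (Fin K)} (π : Fin S.card ≃ S) :
    ∑ k, ENNReal.ofReal (Real.log (M (π k))) * ENNReal.ofReal (1 - c.errorProb W (π k)) =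
      ENNReal.ofReal (∑ u ∈ S, Real.log (M u) * (1 - c.errorProb W u)) := by
  have h0 : ∀ u, 0 ≤ Real.log (M u) := fun u => Real.log_natCast_nonneg _
  have h1 : ∀ u, 0 ≤ 1 - c.errorProb W u := fun u => sub_nonneg.mpr (c.errorProb_le_one W u)
  rw [← Finset.sum_coe_sort S, ← Equiv.sum_comp π,
    ENNReal.ofReal_sum_of_nonneg fun k _ => mul_nonneg (h0 _) (h1 _)]
  exact Finset.sum_congr rfl fun k _ => (ENNReal.ofReal_mul (h0 _)).symm

/-- The loss of `1 / n` in each rate absorbs the one nat per user in the summed Fano bounds. -/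
theorem Code.sum_rate (S : Finset (Fin K)) :
    ∑ u ∈ S, c.rate W u =
      (∑ u ∈ S, Real.log (M u) * (1 - c.errorProb W u) - (S.card : ℕ)) / (n : ℕ) := by
  simp [Code.rate, ← Finset.sum_div, Finset.sum_sub_distrib]

/-- The totals over users are divided by `n` and by the number of message vectors, squared in the
second family because `X'_j` uses an independent second vector. The sums over times and messages
then become the integrals against the induced input law. -/
theorem Code.relaxedBounds : RelaxedBounds W c.inputLaw (c.rate W) := by
  have hn : (n : ℝ≥0∞) ≠ 0 := by simp [NeZero.ne]
  have hN : ((Fintype.card (∀ i, Fin (M i)) : ℕ) : ℝ≥0∞) ≠ 0 :=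
    Nat.cast_ne_zero.mpr Fintype.card_ne_zero
  constructor
  · intro S π q hq
    rw [c.sum_rate]
    refine ofReal_sub_div_le (NeZero.pos n) ?_
    have h := c.kramer_total W (fun i => NeZero.pos _) π q
    rw [c.lintegral_law, ← mul_assoc, ENNReal.mul_inv_cancel hn (by simp), one_mul]
    simp_rw [c.lintegral_inputs _ (measurable_kramerCost W π _ _)]
    rw [← ENNReal.mul_le_mul_iff_right hN (ENNReal.natCast_ne_top _), ← c.sum_log_mul, Finset.mul_sum, mul_add]
    simp_rw [c.sum_success] at h
    calc _ = _ := Finset.sum_congr rfl fun k _ => by ring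
      _ ≤ _ := h
      _ = _ := by
        rw [mul_comm (S.card : ℝ≥0∞)]
        congr 1
        simp_rw [Finset.mul_sum, ← mul_assoc,
          ENNReal.mul_inv_cancel hN (ENNReal.natCast_ne_top _), one_mul]
        refine Eq.trans ?_ Finset.sum_comm
        exact Finset.sum_congr rfl fun k _ => Finset.sum_comm
  · intro S π C q hq
    rw [c.sum_rate]
    refine ofReal_sub_div_le (NeZero.pos n) ?_
    have h := c.etw_total W (fun i => NeZero.pos _) π C q
    rw [c.lintegral_law, ← mul_assoc, ENNReal.mul_inv_cancel hn (by simp), one_mul]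
    simp_rw [c.lintegral_inputs_prod _ _ (measurable_etwCost _ _)]
    have hNN : ((Fintype.card (∀ i, Fin (M i)) * Fintype.card (∀ i, Fin (M i)) : ℕ) : ℝ≥0∞) ≠ 0 :=
      Nat.cast_ne_zero.mpr (mul_ne_zero Fintype.card_ne_zero Fintype.card_ne_zero)
    rw [← ENNReal.mul_le_mul_iff_right hNN (ENNReal.natCast_ne_top _), ← c.sum_log_mul,
      Finset.mul_sum, mul_add]
    simp_rw [c.sum_success] at h
    calc _ = _ := Finset.sum_congr rfl fun k _ => by rw [Nat.cast_mul]; ring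
      _ ≤ _ := h
      _ = _ := by
        rw [mul_comm (S.card : ℝ≥0∞), ← Nat.cast_mul]
        congr 1
        simp_rw [Finset.mul_sum, ← mul_assoc,
          ENNReal.mul_inv_cancel hNN (ENNReal.natCast_ne_top _), one_mul]
        refine Eq.trans ?_ Finset.sum_comm
        exact Finset.sum_congr rfl fun k _ =>
          (Finset.sum_congr rfl fun w _ => Finset.sum_comm).trans Finset.sum_comm

theorem RelaxedBounds.mono {W : Kernel (∀ k, X k) (∀ k, Y k)} {P : InputLaw X}
    {R R' : Fin K → ℝ} (h : RelaxedBounds W P R) (hR : R' ≤ R) : RelaxedBounds W P R' :=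
  ⟨fun S π q hq => (ENNReal.ofReal_le_ofReal (Finset.sum_le_sum fun u _ => hR u)).trans
    (h.kramer S π q hq), fun S π C q hq =>
    (ENNReal.ofReal_le_ofReal (Finset.sum_le_sum fun u _ => hR u)).trans (h.etw S π C q hq)⟩

end CodeLaw

theorem sub_log_two_le_log_floor_exp {r : ℝ} (hr : 0 ≤ r) :
    r - Real.log 2 ≤ Real.log ⌊Real.exp r⌋₊ := by
  have h1 : (1 : ℝ) ≤ Real.exp r := Real.one_le_exp hr
  have h2 : 1 ≤ ⌊Real.exp r⌋₊ := Nat.le_floor (by simpa using h1)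
  have h3 : Real.exp r ≤ 2 * ⌊Real.exp r⌋₊ := by
    have := Nat.lt_floor_add_one (Real.exp r)
    have h4 : (1 : ℝ) ≤ ⌊Real.exp r⌋₊ := by exact_mod_cast h2
    linarith
  have h4 : (0 : ℝ) < ⌊Real.exp r⌋₊ := by exact_mod_cast h2
  have h5 := Real.log_le_log (Real.exp_pos r) h3
  rw [Real.log_exp, Real.log_mul two_ne_zero h4.ne'] at h5
  linarith

/-- Achievable rate tuples satisfy the relaxed bounds up to an arbitrarily small loss. -/
theorem Achievable.exists_relaxedBounds {K : ℕ} {X Y : Fin K → Type*}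
    [∀ k, MeasurableSpace (X k)] [∀ k, MeasurableSpace (Y k)] [∀ k, StandardBorelSpace (Y k)]
    [∀ k, Nonempty (Y k)] {W : Kernel (∀ k, X k) (∀ k, Y k)} [IsMarkovKernel W] {R : Fin K → ℝ}
    (hR : Achievable W R) {ε : ℝ} (hε : 0 < ε) :
    ∃ P : InputLaw X, RelaxedBounds W P fun u => R u - ε := by
  obtain ⟨h0, c, hc⟩ := hR
  have hlim : ∀ u, Tendsto (fun n : ℕ => (R u - Real.log 2 / n) * (1 - (c n).errorProb W u) - 1 / n)
      atTop (𝓝 (R u)) := by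
    intro u
    have h1 : Tendsto (fun n : ℕ => Real.log 2 / n) atTop (𝓝 0) :=
      tendsto_const_div_atTop_nhds_zero_nat _
    have h2 : Tendsto (fun n : ℕ => (1 : ℝ) / n) atTop (𝓝 0) :=
      tendsto_const_div_atTop_nhds_zero_nat _
    simpa using (((tendsto_const_nhds (x := R u)).sub h1).mul
      ((tendsto_const_nhds (x := (1 : ℝ))).sub (hc u))).sub h2
  -- A single large block length suffices. The term `log 2 / n` accounts for rounding the number of
  -- messages down, which loses at most a factor of two.
  have hev : ∀ᶠ n : ℕ in atTop, ∀ u,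
      R u - ε < (R u - Real.log 2 / n) * (1 - (c n).errorProb W u) - 1 / n :=
    eventually_all.mpr fun u => (hlim u).eventually (lt_mem_nhds (by linarith))
  obtain ⟨n, hn, hpos⟩ := (hev.and (eventually_gt_atTop 0)).exists
  have : NeZero n := ⟨hpos.ne'⟩
  have hn0 : (0 : ℝ) < n := by exact_mod_cast hpos
  have hr : ∀ u, 0 ≤ n * R u := fun u => mul_nonneg hn0.le (h0 u)
  have : ∀ u, NeZero ⌊Real.exp (n * R u)⌋₊ := fun u =>
    ⟨(Nat.floor_pos.mpr (Real.one_le_exp (hr u))).ne'⟩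
  refine ⟨(c n).inputLaw, ((c n).relaxedBounds W).mono fun u => (hn u).le.trans ?_⟩
  rw [Code.rate, sub_div]
  gcongr
  rw [mul_div_right_comm]
  refine mul_le_mul_of_nonneg_right ?_ (sub_nonneg.mpr ((c n).errorProb_le_one W u))
  rw [le_div_iff₀ hn0, sub_mul, div_mul_cancel₀ _ hn0.ne', mul_comm]
  exact sub_log_two_le_log_floor_exp (hr u)

/-! ### Time sharing and convexity -/

section Convexity

variable {K : ℕ} {X Y : Fin K → Type*} [∀ k, MeasurableSpace (X k)] [∀ k, MeasurableSpace (Y k)]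

theorem InputLaw.inputs_congr {P P' : InputLaw X} {t : Fin P.card} {t' : Fin P'.card}
    (h : P.input t = P'.input t') : P.inputs t = P'.inputs t' := by
  change Measure.pi (fun k => (P.input t k : Measure (X k))) =
    Measure.pi (fun k => (P'.input t' k : Measure (X k)))
  rw [h]

theorem InputLaw.single_congr {P P' : InputLaw X} {t : Fin P.card} {t' : Fin P'.card}
    (h : P.input t = P'.input t') (j : Fin K) : P.single j t = P'.single j t' := by
  change (P.input t j : Measure (X j)) = (P'.input t' j : Measure (X j))
  rw [h]

theorem InputLaw.inputs_prod_single_congr {P P' : InputLaw X} {t : Fin P.card}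
    {t' : Fin P'.card} (h : P.input t = P'.input t') (j : Fin K) :
    (P.inputs ×ₖ P.single j) t = (P'.inputs ×ₖ P'.single j) t' := by
  rw [Kernel.prod_apply, Kernel.prod_apply, inputs_congr h, single_congr h]

theorem ofReal_sum_combo_le {ι : Type*} (S : Finset ι) {a b : ℝ} (ha : 0 ≤ a) (hb : 0 ≤ b)
    (R R' : ι → ℝ) : ENNReal.ofReal (∑ u ∈ S, (a • R + b • R') u) ≤
      ENNReal.ofReal a * ENNReal.ofReal (∑ u ∈ S, R u) +
        ENNReal.ofReal b * ENNReal.ofReal (∑ u ∈ S, R' u) := by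
  rw [← ENNReal.ofReal_mul ha, ← ENNReal.ofReal_mul hb]
  refine le_trans (le_of_eq ?_) ENNReal.ofReal_add_le
  simp [Finset.sum_add_distrib, Finset.mul_sum]

/-- Time sharing. -/
theorem RelaxedBounds.combo {W : Kernel (∀ k, X k) (∀ k, Y k)} {P P₁ P₂ : InputLaw X}
    {e₁ : Fin P₁.card → Fin P.card} {e₂ : Fin P₂.card → Fin P.card}
    (h₁ : ∀ t, P.input (e₁ t) = P₁.input t) (h₂ : ∀ t, P.input (e₂ t) = P₂.input t)
    {a b : ℝ} (ha : 0 ≤ a) (hb : 0 ≤ b)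
    (hlaw : (P.law : Measure (Fin P.card)) =
      ENNReal.ofReal a • (P₁.law : Measure (Fin P₁.card)).map e₁ +
        ENNReal.ofReal b • (P₂.law : Measure (Fin P₂.card)).map e₂)
    {R₁ R₂ : Fin K → ℝ} (hR₁ : RelaxedBounds W P₁ R₁) (hR₂ : RelaxedBounds W P₂ R₂) :
    RelaxedBounds W P (a • R₁ + b • R₂) := by
  have hint : ∀ F : Fin P.card → ℝ≥0∞, ∫⁻ t, F t ∂(P.law : Measure (Fin P.card)) =
      ENNReal.ofReal a * ∫⁻ t, F (e₁ t) ∂(P₁.law : Measure (Fin P₁.card)) +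
        ENNReal.ofReal b * ∫⁻ t, F (e₂ t) ∂(P₂.law : Measure (Fin P₂.card)) := by
    intro F
    rw [hlaw, lintegral_add_measure, lintegral_smul_measure, lintegral_smul_measure,
      lintegral_map (measurable_of_countable F) (measurable_of_countable _),
      lintegral_map (measurable_of_countable F) (measurable_of_countable _)]
    rfl
  constructor
  · intro S π q hq
    refine (ofReal_sum_combo_le S ha hb R₁ R₂).trans ?_
    rw [hint]
    simp_rw [InputLaw.inputs_congr (h₁ _), InputLaw.inputs_congr (h₂ _)]
    gcongr
    · exact hR₁.kramer S π (fun t => q (e₁ t)) fun t k => hq _ k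
    · exact hR₂.kramer S π (fun t => q (e₂ t)) fun t k => hq _ k
  · intro S π C q hq
    refine (ofReal_sum_combo_le S ha hb R₁ R₂).trans ?_
    rw [hint]
    simp_rw [InputLaw.inputs_prod_single_congr (h₁ _), InputLaw.inputs_prod_single_congr (h₂ _)]
    gcongr
    · exact hR₁.etw S π C q hq
    · exact hR₂.etw S π C q hq

theorem InputLaw.exists_combo (P₁ P₂ : InputLaw X) {a b : ℝ} (ha : 0 ≤ a) (hb : 0 ≤ b)
    (hab : a + b = 1) : ∃ (P : InputLaw X) (e₁ : Fin P₁.card → Fin P.card)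
      (e₂ : Fin P₂.card → Fin P.card), (∀ t, P.input (e₁ t) = P₁.input t) ∧
      (∀ t, P.input (e₂ t) = P₂.input t) ∧
      (P.law : Measure (Fin P.card)) =
        ENNReal.ofReal a • (P₁.law : Measure (Fin P₁.card)).map e₁ +
          ENNReal.ofReal b • (P₂.law : Measure (Fin P₂.card)).map e₂ := by
  let e₁ : Fin P₁.card → Fin (P₁.card + P₂.card) := Fin.castAdd P₂.card
  let e₂ : Fin P₂.card → Fin (P₁.card + P₂.card) := Fin.natAdd P₁.card
  have h1 : IsProbabilityMeasure ((P₁.law : Measure (Fin P₁.card)).map e₁) :=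
    Measure.isProbabilityMeasure_map (measurable_of_countable _).aemeasurable
  have h2 : IsProbabilityMeasure ((P₂.law : Measure (Fin P₂.card)).map e₂) :=
    Measure.isProbabilityMeasure_map (measurable_of_countable _).aemeasurable
  have h : IsProbabilityMeasure (ENNReal.ofReal a • (P₁.law : Measure (Fin P₁.card)).map e₁ +
          ENNReal.ofReal b • (P₂.law : Measure (Fin P₂.card)).map e₂) := by
    constructor
    simp [← ENNReal.ofReal_add ha hb, hab]
  exact ⟨⟨P₁.card + P₂.card, ⟨_, h⟩,
    Fin.addCases (motive := fun _ => ∀ k, ProbabilityMeasure (X k)) P₁.input P₂.input⟩, e₁, e₂,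
    fun t => Fin.addCases_left (motive := fun _ => ∀ k, ProbabilityMeasure (X k)) t,
    fun t => Fin.addCases_right (motive := fun _ => ∀ k, ProbabilityMeasure (X k)) t, rfl⟩

/-- The values of the two time-sharing variables are placed side by side. A kernel family for the
combined variable restricts to each part, the second family uses one common kernel for both, and the
costs are affine in the law. -/
theorem convex_setOf_relaxedBounds (W : Kernel (∀ k, X k) (∀ k, Y k)) :
    Convex ℝ {R | ∃ P : InputLaw X, RelaxedBounds W P R} := by
  rintro R₁ ⟨P₁, h₁⟩ R₂ ⟨P₂, h₂⟩ a b ha hb hab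
  obtain ⟨P, e₁, e₂, he₁, he₂, hlaw⟩ := P₁.exists_combo P₂ ha hb hab
  exact ⟨P, h₁.combo he₁ he₂ ha hb hlaw h₂⟩

theorem capacityRegion_subset_closure [∀ k, StandardBorelSpace (Y k)] [∀ k, Nonempty (Y k)]
    (W : Kernel (∀ k, X k) (∀ k, Y k)) [IsMarkovKernel W] :
    capacityRegion W ⊆ closure {R | ∃ P : InputLaw X, RelaxedBounds W P R} := by
  refine closure_minimal (convexHull_min ?_ (convex_setOf_relaxedBounds W).closure) isClosed_closure
  intro R hR
  have hlim : Tendsto (fun n : ℕ => fun u => R u - 1 / ((n : ℝ) + 1)) atTop (𝓝 R) :=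
    tendsto_pi_nhds.mpr fun u => by
      simpa using (tendsto_const_nhds (x := R u)).sub tendsto_one_div_add_atTop_nhds_zero_nat
  exact mem_closure_of_tendsto hlim
    (Eventually.of_forall fun n => Achievable.exists_relaxedBounds hR (by positivity))

end Convexity

/-! ### Data processing from costs to conditional mutual information -/

section DataProcessing

variable {𝒵 Θ 𝒱 𝒴 𝒜 𝒞 : Type*} [MeasurableSpace 𝒵] [MeasurableSpace Θ] [MeasurableSpace 𝒱]
  [MeasurableSpace 𝒴] [MeasurableSpace 𝒜] [MeasurableSpace 𝒞]

theorem lintegral_sideCost [StandardBorelSpace 𝒱] [StandardBorelSpace 𝒴] (m : Measure 𝒵)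
    [IsFiniteMeasure m] (J : Kernel 𝒵 (𝒱 × 𝒴)) [IsMarkovKernel J] (q : Kernel (𝒵 × 𝒱) 𝒴)
    [IsMarkovKernel q] :
    ∫⁻ z, sideCost J q z ∂m = klDiv (m ⊗ₘ J) (m ⊗ₘ (J.fst ⊗ₖ q)) :=
  (klDiv_compProd_right m J (J.fst ⊗ₖ q)).symm

/-- Data processing for the conditional mutual information. -/
theorem lintegral_sideCost_le [StandardBorelSpace 𝒱] [StandardBorelSpace 𝒴] (m : Measure 𝒵)
    [IsFiniteMeasure m] (J : Kernel 𝒵 Θ) [IsMarkovKernel J] {v : Θ → 𝒱} (hv : Measurable v)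
    {b : Θ → 𝒴} (hb : Measurable b) {A : 𝒵 × Θ → 𝒜} (hA : Measurable A) {χ : 𝒵 × 𝒱 → 𝒞}
    (hχ : Measurable χ) {φ : 𝒜 × 𝒞 → 𝒵 × 𝒱} (hφ : Measurable φ)
    (h : ∀ z θ, φ (A (z, θ), χ (z, v θ)) = (z, v θ)) (κ : Kernel 𝒞 𝒴) [IsMarkovKernel κ] :
    ∫⁻ z, sideCost (J.map fun θ => (v θ, b θ)) (κ.comap χ hχ) z ∂m ≤
      klDiv ((m ⊗ₘ J).map fun ω => ((A ω, χ (ω.1, v ω.2)), b ω.2))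
        (((m ⊗ₘ J).map fun ω => (A ω, χ (ω.1, v ω.2))) ⊗ₘ Kernel.prodMkLeft 𝒜 κ) := by
  have hvb : Measurable fun θ => (v θ, b θ) := hv.prodMk hb
  have : IsMarkovKernel (J.map fun θ => (v θ, b θ)) := Kernel.IsMarkovKernel.map _ hvb
  have hC : Measurable fun ω : 𝒵 × Θ => χ (ω.1, v ω.2) := by fun_prop
  have hΦ : Measurable fun p : (𝒜 × 𝒞) × 𝒴 => ((φ p.1).1, ((φ p.1).2, p.2)) := by fun_prop
  rw [lintegral_sideCost]
  -- Since `φ` recovers `(z, v)` from the conditioning pair, `hΦ`'s map pushes both laws of the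
  -- mutual information to the two laws in the cost.
  refine le_trans (le_of_eq ?_) (klDiv_map_le _ _ hΦ)
  congr 1
  · refine Measure.ext_of_lintegral _ fun f hf => ?_
    have hf1 : Measurable fun ω : 𝒵 × Θ => f ((φ (A ω, χ (ω.1, v ω.2))).1,
        ((φ (A ω, χ (ω.1, v ω.2))).2, b ω.2)) := by fun_prop
    rw [Measure.map_map hΦ (by fun_prop), lintegral_map hf (by fun_prop),
      Measure.lintegral_compProd hf]
    refine Eq.trans ?_ (Measure.lintegral_compProd hf1).symm
    refine lintegral_congr fun z => ?_
    rw [Kernel.map_apply _ hvb, lintegral_map (by fun_prop) hvb]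
    simp [h]
  · refine Measure.ext_of_lintegral _ fun f hf => ?_
    have hf2 : Measurable fun x : 𝒜 × 𝒞 => ∫⁻ y, f ((φ x).1, ((φ x).2, y)) ∂(κ x.2) := by
      have := Measurable.lintegral_kernel_prod_right (κ := Kernel.prodMkLeft 𝒜 κ)
        (f := fun x y => f ((φ x).1, ((φ x).2, y))) (by fun_prop)
      exact this
    have hf3 : Measurable fun x : 𝒵 × 𝒱 => ∫⁻ y, f (x.1, (x.2, y)) ∂(κ (χ x)) := by
      have := Measurable.lintegral_kernel_prod_right (κ := κ.comap χ hχ)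
        (f := fun x y => f (x.1, (x.2, y))) (by fun_prop)
      exact this
    have hf1 : Measurable fun p : (𝒜 × 𝒞) × 𝒴 => f ((φ p.1).1, ((φ p.1).2, p.2)) := by fun_prop
    rw [lintegral_map hf hΦ, Measure.lintegral_compProd hf, Measure.lintegral_compProd hf1]
    simp only [Kernel.prodMkLeft_apply]
    have hAC : Measurable fun ω : 𝒵 × Θ => (A ω, χ (ω.1, v ω.2)) := by fun_prop
    rw [lintegral_map hf2 hAC]
    refine Eq.trans ?_ (Measure.lintegral_compProd (hf2.comp hAC)).symm
    refine lintegral_congr fun z => ?_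
    rw [Kernel.lintegral_compProd _ _ _ (by fun_prop), Kernel.fst_apply,
      Kernel.map_apply _ hvb, Measure.map_map measurable_fst hvb]
    simp only [Kernel.comap_apply]
    refine (lintegral_map (hf3.comp measurable_prodMk_left) hv).trans ?_
    simp [h]

end DataProcessing

/-! ### From relaxed bounds to the first family -/

section Kramer

variable {K : ℕ} {X Y : Fin K → Type*} [∀ k, MeasurableSpace (X k)] [∀ k, MeasurableSpace (Y k)]
  [∀ k, StandardBorelSpace (Y k)] [∀ k, Nonempty (Y k)]

/-- The kernel used at `Q = t` is the true conditional law of the output given all conditioning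
variables, with `t` inserted for `Q`. Dependence of `q` on `t` is essential here. -/
theorem RelaxedBounds.kramerBound {W : Kernel (∀ k, X k) (∀ k, Y k)} [IsMarkovKernel W]
    {P : InputLaw X} {R : Fin K → ℝ} (h : RelaxedBounds W P R) (S : Finset (Fin K))
    (π : Fin S.card ≃ S) : KramerBound W P S π R := by
  let χ : ∀ k : Fin S.card, (Fin P.card × ∀ k, X k) × ((i : Set.Iio k) → Y (π i)) →
      ((i : Set.Iio k) → X (π i)) × ((i : Set.Iio k) → Y (π i)) ×
        ((u : {u : Fin K // u ∉ S}) → X u) × Fin P.card := fun k p =>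
    (fun i => p.1.2 (π i), p.2, fun u => p.1.2 u, p.1.1)
  have hχ : ∀ k, Measurable (χ k) := fun k => by simp only [χ]; fun_prop
  let κ := fun k : Fin S.card => condDistrib (fun ω : (Fin P.card × ∀ k, X k) × ∀ k, Y k =>
    ω.2 (π k)) (fun ω => χ k (ω.1, fun i => ω.2 (π i))) (jointLaw W P)
  let e : ∀ (t : Fin P.card) (k : Fin S.card), KramerCond X Y π k →
    ((i : Set.Iio k) → X (π i)) × ((i : Set.Iio k) → Y (π i)) ×
        ((u : {u : Fin K // u ∉ S}) → X u) × Fin P.card :=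
    fun t k c => (c.1, c.2.1, c.2.2, t)
  have he : ∀ t k, Measurable (e t k) := fun t k => by simp only [e]; fun_prop
  have hR := h.kramer S π (fun t k => (κ k).comap (e t k) (he t k)) (fun t k => inferInstance)
  refine hR.trans ?_
  rw [lintegral_finsetSum _ fun k _ => measurable_of_countable _]
  refine Finset.sum_le_sum fun k _ => ?_
  have hm : Measurable fun y : ∀ k, Y k => ((fun i : Set.Iio k => y (π i)), y (π k)) := by fun_prop
  have : IsMarkovKernel ((Kernel.prodMkLeft (Fin P.card) W).map
      fun y => ((fun i : Set.Iio k => y (π i)), y (π k))) := Kernel.IsMarkovKernel.map _ hm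
  have hcost : ∀ t x, kramerCost π k W ((κ k).comap (e t k) (he t k)) x =
      sideCost ((Kernel.prodMkLeft (Fin P.card) W).map
        fun y => ((fun i : Set.Iio k => y (π i)), y (π k)))
        ((κ k).comap (χ k) (hχ k)) (t, x) := by
    intro t x
    rw [kramerCost, sideCost_eq, sideCost_eq, kramerJoint_apply, Kernel.map_apply _ hm]
    rfl
  -- Every input is visible: earlier users of `S` and users outside `S` among the conditioning
  -- variables, the current and later users of `S` in the first argument.
  have hrec : ∀ u : Fin K, ∃ φ : ((i : Set.Ici k) → X (π i)) ×
      (((i : Set.Iio k) → X (π i)) × ((i : Set.Iio k) → Y (π i)) ×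
        ((u : {u : Fin K // u ∉ S}) → X u) × Fin P.card) → X u, Measurable φ ∧
      ∀ z y, φ ((fun i => z.2 (π i)), χ k (z, y)) = z.2 u := by
    intro u
    by_cases hu : u ∈ S
    · obtain ⟨i, hi⟩ := π.surjective ⟨u, hu⟩
      obtain rfl : (π i : Fin K) = u := by rw [hi]
      rcases lt_or_ge i k with hik | hik
      · exact ⟨fun p => p.2.1 ⟨i, hik⟩, by fun_prop, fun z y => rfl⟩
      · exact ⟨fun p => p.1 ⟨i, hik⟩, by fun_prop, fun z y => rfl⟩
    · exact ⟨fun p => p.2.2.2.1 ⟨u, hu⟩, by fun_prop, fun z y => rfl⟩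
  choose φ hφ hφ' using hrec
  have hmain := lintegral_sideCost_le ((P.law : Measure (Fin P.card)) ⊗ₘ P.inputs)
    (Kernel.prodMkLeft (Fin P.card) W) (v := fun y (i : Set.Iio k) => y (π i))
    (b := fun y => y (π k)) (by fun_prop) (by fun_prop)
    (A := fun ω (i : Set.Ici k) => ω.1.2 (π i)) (by fun_prop) (hχ k)
    (φ := fun p => ((p.2.2.2.2, fun u => φ u p), p.2.2.1)) (by fun_prop)
    (fun z y => by simp [hφ', χ]) (κ k)
  rw [Measure.lintegral_compProd (measurable_sideCost _ _)] at hmain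
  simp_rw [hcost]
  exact hmain

end Kramer

/-! ### Densities and log-likelihood ratios -/

section Densities

variable {𝒵 𝒱 𝒴 𝒞 Ω : Type*} [MeasurableSpace 𝒵] [MeasurableSpace 𝒱] [MeasurableSpace 𝒴]
  [MeasurableSpace 𝒞] [MeasurableSpace Ω]

/-- A Markov kernel that is absolutely continuous on average has a jointly measurable density. -/
theorem exists_kernel_density [StandardBorelSpace 𝒴] (ζ : Measure 𝒵) [IsFiniteMeasure ζ]
    (κ : Kernel 𝒵 𝒴) [IsMarkovKernel κ] (ν : Measure 𝒴) [SigmaFinite ν]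
    (h : ζ ⊗ₘ κ ≪ ζ.prod ν) :
    ∃ g : 𝒵 × 𝒴 → ℝ≥0∞, Measurable g ∧
      ∀ᵐ z ∂ζ, κ z = ν.withDensity fun y => g (z, y) := by
  -- The kernel derivative is taken with respect to a finite measure equivalent to `ν`, and the
  -- density of that measure with respect to `ν` is multiplied back.
  have h1 : ζ ⊗ₘ κ ≪ ζ ⊗ₘ Kernel.const 𝒵 ν.toFinite := by
    rw [Measure.compProd_const]
    exact h.trans (Measure.AbsolutelyContinuous.rfl.prod (absolutelyContinuous_toFinite ν))
  refine ⟨fun p => κ.rnDeriv (Kernel.const 𝒵 ν.toFinite) p.1 p.2 * ν.toFinite.rnDeriv ν p.2,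
    by fun_prop, ?_⟩
  filter_upwards [h1.kernel_of_compProd] with z hz
  have h2 := Kernel.withDensity_rnDeriv_eq hz
  rw [Kernel.withDensity_apply _ (Kernel.measurable_rnDeriv _ _), Kernel.const_apply] at h2
  have h3 : ν.toFinite = ν.withDensity (ν.toFinite.rnDeriv ν) :=
    (Measure.withDensity_rnDeriv_eq _ _ (toFinite_absolutelyContinuous ν)).symm
  rw [← h2]
  conv_lhs => rw [h3]
  rw [← withDensity_mul _ (Measure.measurable_rnDeriv _ _)
    (Kernel.measurable_rnDeriv_right _ _ _)]
  congr 1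
  funext y
  rw [Pi.mul_apply, mul_comm, ← h3]

theorem absolutelyContinuous_of_withDensity {μ ρ : Measure Ω} {p' : Ω → ℝ≥0∞} (hp' : Measurable p')
    (h : μ ≪ ρ) (h0 : ∀ᵐ x ∂μ, p' x ≠ 0) : μ ≪ ρ.withDensity p' := by
  refine Measure.AbsolutelyContinuous.mk fun s hs hs0 => ?_
  rw [withDensity_apply _ hs, lintegral_eq_zero_iff hp',
    EventuallyEq, ae_restrict_iff' hs] at hs0
  rw [measure_eq_zero_iff_ae_notMem]
  filter_upwards [h.ae_le hs0, h0] with x hx hx0 hxs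
  exact hx0 (hx hxs)

theorem llr_withDensity {ρ : Measure Ω} [SigmaFinite ρ] {p p' : Ω → ℝ≥0∞} (hp : Measurable p)
    (hp' : Measurable p') [IsFiniteMeasure (ρ.withDensity p)] [IsFiniteMeasure (ρ.withDensity p')]
    (h0 : ∀ᵐ x ∂(ρ.withDensity p), p' x ≠ 0) :
    llr (ρ.withDensity p) (ρ.withDensity p') =ᵐ[ρ.withDensity p]
      fun x => Real.log (p x).toReal - Real.log (p' x).toReal := by
  have hac := withDensity_absolutelyContinuous ρ p
  have hac' := absolutelyContinuous_of_withDensity hp' hac h0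
  have hpos : ∀ᵐ x ∂(ρ.withDensity p), p x ≠ 0 :=
    (ae_withDensity_iff hp).mpr (Eventually.of_forall fun x hx => hx)
  filter_upwards [hac.ae_le (Measure.rnDeriv_mul_rnDeriv (κ := ρ) hac'),
    hac.ae_le (Measure.rnDeriv_withDensity ρ hp), hac.ae_le (Measure.rnDeriv_withDensity ρ hp'),
    hac.ae_le (Measure.rnDeriv_lt_top (ρ.withDensity p) ρ),
    hac.ae_le (Measure.rnDeriv_lt_top (ρ.withDensity p') ρ), h0, hpos] with x h1 h2 h3 h4 h5 h6 h7
  rw [Pi.mul_apply, h2, h3] at h1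
  rw [h2] at h4
  rw [h3] at h5
  have h8 : (p' x).toReal ≠ 0 := ENNReal.toReal_ne_zero.mpr ⟨h6, h5.ne⟩
  have h9 : ((ρ.withDensity p).rnDeriv (ρ.withDensity p') x).toReal ≠ 0 := by
    intro h
    have := congrArg ENNReal.toReal h1
    rw [ENNReal.toReal_mul, h, zero_mul] at this
    exact ENNReal.toReal_ne_zero.mpr ⟨h7, h4.ne⟩ this.symm
  rw [llr, ← h1, ENNReal.toReal_mul, Real.log_mul h9 h8, add_sub_cancel_right]

/-- The log-likelihood ratio whose mean is the conditional mutual information of `z` and the second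
output given the first output, in terms of densities. -/
theorem llr_compProd_eq [StandardBorelSpace 𝒱] [StandardBorelSpace 𝒴] {ζ : Measure 𝒵}
    [IsProbabilityMeasure ζ] {J : Kernel 𝒵 (𝒱 × 𝒴)} [IsMarkovKernel J] {νV : Measure 𝒱}
    [SigmaFinite νV] {νY : Measure 𝒴} [SigmaFinite νY] {χ : 𝒵 × 𝒱 → 𝒞} (hχ : Measurable χ)
    {κ : Kernel 𝒞 𝒴} [IsMarkovKernel κ]
    (hκ : (ζ ⊗ₘ J).map (fun ω => (χ (ω.1, ω.2.1), ω.2.2)) =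
      (ζ ⊗ₘ J).map (fun ω => χ (ω.1, ω.2.1)) ⊗ₘ κ)
    {gV : 𝒵 × 𝒱 → ℝ≥0∞} (hgV : Measurable gV)
    (hV : ∀ᵐ z ∂ζ, J.fst z = νV.withDensity fun v => gV (z, v))
    {gY : 𝒵 × 𝒴 → ℝ≥0∞} (hgY : Measurable gY)
    (hY : ∀ᵐ z ∂ζ, J.snd z = νY.withDensity fun y => gY (z, y))
    (h1 : (ζ ⊗ₘ J).map (fun ω => (χ (ω.1, ω.2.1), ω.2.2)) ≪
      ((ζ ⊗ₘ J).map fun ω => χ (ω.1, ω.2.1)).prod νY)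
    (h2 : (ζ ⊗ₘ J).map (fun ω => ((ω.2.2, ω.1), ω.2.1)) ≪
      ((ζ ⊗ₘ J).map fun ω => (ω.2.2, ω.1)).prod νV) :
    ζ ⊗ₘ J ≪ ζ ⊗ₘ (J.fst ⊗ₖ κ.comap χ hχ) ∧
    llr (ζ ⊗ₘ J) (ζ ⊗ₘ (J.fst ⊗ₖ κ.comap χ hχ)) =ᵐ[ζ ⊗ₘ J] fun ω =>
      (Real.log (gY (ω.1, ω.2.2)).toReal - Real.log (gV (ω.1, ω.2.1)).toReal) +
      (llr ((ζ ⊗ₘ J).map fun ω => ((ω.2.2, ω.1), ω.2.1))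
          (((ζ ⊗ₘ J).map fun ω => (ω.2.2, ω.1)).prod νV) ((ω.2.2, ω.1), ω.2.1) -
        llr ((ζ ⊗ₘ J).map fun ω => (χ (ω.1, ω.2.1), ω.2.2))
          (((ζ ⊗ₘ J).map fun ω => χ (ω.1, ω.2.1)).prod νY) (χ (ω.1, ω.2.1), ω.2.2)) := by
  have m1 : Measurable fun ω : 𝒵 × 𝒱 × 𝒴 => (χ (ω.1, ω.2.1), ω.2.2) := by fun_prop
  have m1' : Measurable fun ω : 𝒵 × 𝒱 × 𝒴 => χ (ω.1, ω.2.1) := by fun_prop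
  have m2 : Measurable fun ω : 𝒵 × 𝒱 × 𝒴 => ((ω.2.2, ω.1), ω.2.1) := by fun_prop
  have m2' : Measurable fun ω : 𝒵 × 𝒱 × 𝒴 => (ω.2.2, ω.1) := by fun_prop
  set U := ζ ⊗ₘ J with hU
  set L1 := U.map (fun ω => (χ (ω.1, ω.2.1), ω.2.2)) with hL1
  set L2 := U.map (fun ω => ((ω.2.2, ω.1), ω.2.1)) with hL2
  set Q1 := U.map (fun ω => χ (ω.1, ω.2.1)) with hQ1
  set Q2 := U.map (fun ω => (ω.2.2, ω.1)) with hQ2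
  have p1 : IsProbabilityMeasure L1 := Measure.isProbabilityMeasure_map m1.aemeasurable
  have p2 : IsProbabilityMeasure L2 := Measure.isProbabilityMeasure_map m2.aemeasurable
  have p3 : IsProbabilityMeasure Q1 := Measure.isProbabilityMeasure_map m1'.aemeasurable
  have p4 : IsProbabilityMeasure Q2 := Measure.isProbabilityMeasure_map m2'.aemeasurable
  set r1 := L1.rnDeriv (Q1.prod νY) with hr1
  set r2 := L2.rnDeriv (Q2.prod νV) with hr2
  have mr1 : Measurable r1 := Measure.measurable_rnDeriv _ _
  have mr2 : Measurable r2 := Measure.measurable_rnDeriv _ _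
  obtain ⟨g, hg, hgκ⟩ := exists_kernel_density Q1 κ νY (hκ ▸ h1)
  have hgU : ∀ᵐ ω ∂U, κ (χ (ω.1, ω.2.1)) =
      νY.withDensity fun y => g (χ (ω.1, ω.2.1), y) := ae_of_ae_map m1'.aemeasurable hgκ
  have eL1 : L1 = (Q1.prod νY).withDensity g := by
    rw [hκ]
    refine Measure.ext_of_lintegral _ fun f hf => ?_
    rw [Measure.lintegral_compProd hf, lintegral_withDensity_eq_lintegral_mul _ hg hf,
      lintegral_prod _ (by fun_prop)]
    refine lintegral_congr_ae ?_
    filter_upwards [hgκ] with c hc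
    rw [hc, lintegral_withDensity_eq_lintegral_mul _ (by fun_prop) (by fun_prop)]
    rfl
  have hr1g : ∀ᵐ ω ∂U, r1 (χ (ω.1, ω.2.1), ω.2.2) = g (χ (ω.1, ω.2.1), ω.2.2) := by
    have h3 : r1 =ᵐ[Q1.prod νY] g := by
      rw [hr1, eL1]
      exact Measure.rnDeriv_withDensity _ hg
    exact ae_of_ae_map m1.aemeasurable (h1.ae_le h3)
  -- The true law is factored in the order `z`, output, side information; the reference law in the
  -- order `z`, side information, output. Both become densities with respect to the same product
  -- measure.
  set p : 𝒵 × 𝒱 × 𝒴 → ℝ≥0∞ := fun ω => gY (ω.1, ω.2.2) * r2 ((ω.2.2, ω.1), ω.2.1) with hp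
  set p' : 𝒵 × 𝒱 × 𝒴 → ℝ≥0∞ := fun ω => gV (ω.1, ω.2.1) * g (χ (ω.1, ω.2.1), ω.2.2) with hp'
  have mp : Measurable p := by fun_prop
  have mp' : Measurable p' := by fun_prop
  set ρ := ζ.prod (νV.prod νY) with hρ
  have eU : U = ρ.withDensity p := by
    refine Measure.ext_of_lintegral _ fun f hf => ?_
    have hf2 : Measurable fun w : (𝒴 × 𝒵) × 𝒱 => f (w.1.2, w.2, w.1.1) := by fun_prop
    have e1 : ∫⁻ ω, f ω ∂U = ∫⁻ w, f (w.1.2, w.2, w.1.1) ∂L2 := by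
      rw [hL2, lintegral_map hf2 m2]
    have hin : Measurable fun w : 𝒴 × 𝒵 => ∫⁻ v, r2 (w, v) * f (w.2, v, w.1) ∂νV :=
      (mr2.mul hf2).lintegral_prod_right'
    rw [e1, ← Measure.withDensity_rnDeriv_eq L2 (Q2.prod νV) h2,
      lintegral_withDensity_eq_lintegral_mul _ mr2 hf2, lintegral_prod _ (by fun_prop),
      lintegral_withDensity_eq_lintegral_mul _ mp hf, lintegral_prod _ (by fun_prop)]
    simp only [Pi.mul_apply]
    rw [hQ2, lintegral_map hin m2', hU]
    refine (Measure.lintegral_compProd (hin.comp m2')).trans (lintegral_congr_ae ?_)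
    filter_upwards [hY] with z hz
    have hin' : Measurable fun y : 𝒴 => ∫⁻ v, r2 ((y, z), v) * f (z, v, y) ∂νV :=
      hin.comp measurable_prodMk_right
    have e2 : ∫⁻ b, ∫⁻ v, r2 ((b.2, z), v) * f (z, v, b.2) ∂νV ∂(J z) =
        ∫⁻ y, ∫⁻ v, r2 ((y, z), v) * f (z, v, y) ∂νV ∂(J.snd z) := by
      rw [Kernel.snd_apply, lintegral_map hin' measurable_snd]
    refine e2.trans ?_
    rw [hz, lintegral_withDensity_eq_lintegral_mul _ (by fun_prop) hin',
      lintegral_prod_symm' _ (by fun_prop)]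
    refine lintegral_congr fun y => ?_
    rw [Pi.mul_apply, ← lintegral_const_mul _ (by fun_prop)]
    refine lintegral_congr fun v => ?_
    rw [hp, mul_assoc]
  have eU' : ζ ⊗ₘ (J.fst ⊗ₖ κ.comap χ hχ) = ρ.withDensity p' := by
    refine Measure.ext_of_lintegral _ fun f hf => ?_
    have hin : Measurable fun x : 𝒵 × 𝒱 => ∫⁻ y, f (x.1, (x.2, y)) ∂(κ (χ x)) := by
      have := Measurable.lintegral_kernel_prod_right (κ := κ.comap χ hχ)
        (f := fun x y => f (x.1, (x.2, y))) (by fun_prop)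
      exact this
    have hin' : Measurable fun x : 𝒵 × 𝒱 => ∫⁻ y, g (χ x, y) * f (x.1, (x.2, y)) ∂νY :=
      Measurable.lintegral_prod_right' (f := fun w : (𝒵 × 𝒱) × 𝒴 =>
        g (χ w.1, w.2) * f (w.1.1, (w.1.2, w.2))) (by fun_prop)
    rw [Measure.lintegral_compProd hf, lintegral_withDensity_eq_lintegral_mul _ mp' hf,
      lintegral_prod _ (by fun_prop)]
    refine lintegral_congr_ae ?_
    filter_upwards [hV, Measure.ae_ae_of_ae_compProd hgU] with z hz hgz
    rw [Kernel.lintegral_compProd _ _ _ (by fun_prop)]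
    simp only [Kernel.comap_apply]
    have hinz : Measurable fun v => ∫⁻ y, f (z, (v, y)) ∂(κ (χ (z, v))) :=
      hin.comp measurable_prodMk_left
    have hinz' : Measurable fun v => ∫⁻ y, g (χ (z, v), y) * f (z, (v, y)) ∂νY :=
      hin'.comp measurable_prodMk_left
    have e1 : ∫⁻ v, ∫⁻ y, f (z, (v, y)) ∂(κ (χ (z, v))) ∂(J.fst z) =
        ∫⁻ v, ∫⁻ y, g (χ (z, v), y) * f (z, (v, y)) ∂νY ∂(J.fst z) := by
      rw [Kernel.fst_apply, lintegral_map hinz measurable_fst, lintegral_map hinz' measurable_fst]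
      refine lintegral_congr_ae ?_
      filter_upwards [hgz] with w hw
      rw [hw, lintegral_withDensity_eq_lintegral_mul _ (by fun_prop) (by fun_prop)]
      rfl
    rw [e1, hz, lintegral_withDensity_eq_lintegral_mul _ (by fun_prop) hinz',
      lintegral_prod _ (by fun_prop)]
    refine lintegral_congr fun v => ?_
    simp only [Pi.mul_apply]
    rw [← lintegral_const_mul _ (by fun_prop)]
    refine lintegral_congr fun y => ?_
    rw [hp', mul_assoc]
  have hUr1 : ∀ᵐ ω ∂U, r1 (χ (ω.1, ω.2.1), ω.2.2) ≠ 0 := by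
    have := Measure.rnDeriv_pos h1
    exact (ae_of_ae_map m1.aemeasurable this).mono fun x hx => hx.ne'
  have hUgV : ∀ᵐ ω ∂U, gV (ω.1, ω.2.1) ≠ 0 := by
    have hm : Measurable fun ω : 𝒵 × 𝒱 × 𝒴 => gV (ω.1, ω.2.1) := by fun_prop
    refine (Measure.ae_compProd_iff (hm (measurableSet_singleton 0).compl)).mpr ?_
    filter_upwards [hV] with z hz
    have h3 : ∀ᵐ v ∂(J.fst z), gV (z, v) ≠ 0 := by
      rw [hz, ae_withDensity_iff (by fun_prop)]
      exact Eventually.of_forall fun x hx => hx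
    rw [Kernel.fst_apply] at h3
    exact ae_of_ae_map measurable_fst.aemeasurable h3
  -- Positivity under the true law gives absolute continuity with respect to the reference and
  -- allows the logarithms of products to be split.
  have hU0 : ∀ᵐ ω ∂U, p' ω ≠ 0 := by
    filter_upwards [hUr1, hUgV, hr1g] with ω a b c
    exact mul_ne_zero b (c ▸ a)
  have hp0 : ∀ᵐ ω ∂U, p ω ≠ 0 := by
    rw [eU]
    exact (ae_withDensity_iff mp).mpr (Eventually.of_forall fun x hx => hx)
  have hfin : IsFiniteMeasure (ρ.withDensity p) := by rw [← eU]; infer_instance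
  have hfin' : IsFiniteMeasure (ρ.withDensity p') := by rw [← eU']; infer_instance
  have hac := withDensity_absolutelyContinuous ρ p
  have hpt : ∀ᵐ ω ∂U, p ω ≠ ∞ := by
    rw [eU]
    filter_upwards [hac.ae_le (Measure.rnDeriv_withDensity ρ mp),
      hac.ae_le (Measure.rnDeriv_lt_top (ρ.withDensity p) ρ)] with x a b
    rw [← a]
    exact b.ne
  have hpt' : ∀ᵐ ω ∂U, p' ω ≠ ∞ := by
    rw [eU]
    filter_upwards [hac.ae_le (Measure.rnDeriv_withDensity ρ mp'),
      hac.ae_le (Measure.rnDeriv_lt_top (ρ.withDensity p') ρ)] with x a b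
    rw [← a]
    exact b.ne
  refine ⟨by rw [eU']; exact absolutelyContinuous_of_withDensity mp' (eU ▸ hac) hU0, ?_⟩
  have hllr : llr U (ζ ⊗ₘ (J.fst ⊗ₖ κ.comap χ hχ)) =ᵐ[U]
      fun x => Real.log (p x).toReal - Real.log (p' x).toReal := by
    rw [eU']
    have := llr_withDensity mp mp' (eU ▸ hU0)
    rwa [← eU] at this
  have hlog : ∀ a b : ℝ≥0∞, a * b ≠ 0 → a * b ≠ ∞ →
      Real.log (a * b).toReal = Real.log a.toReal + Real.log b.toReal := by
    intro a b hab hab'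
    have ha : a ≠ 0 := left_ne_zero_of_mul hab
    have hb : b ≠ 0 := right_ne_zero_of_mul hab
    have ha' : a ≠ ∞ := by
      rintro rfl
      exact hab' (ENNReal.top_mul hb)
    have hb' : b ≠ ∞ := by
      rintro rfl
      exact hab' (ENNReal.mul_top ha)
    rw [ENNReal.toReal_mul, Real.log_mul (ENNReal.toReal_ne_zero.mpr ⟨ha, ha'⟩)
      (ENNReal.toReal_ne_zero.mpr ⟨hb, hb'⟩)]
  filter_upwards [hllr, hU0, hp0, hpt, hpt', hr1g] with ω a b c d e h
  rw [a, hlog _ _ b e, hlog _ _ c d, ← h]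
  simp only [llr]
  ring

end Densities

/-! ### Cancellation of possibly non-integrable terms -/

section Truncation

/-- Truncation of a real number to `[-N, N]`. -/
def clip (N : ℕ) (x : ℝ) : ℝ := max (-(N : ℝ)) (min x N)

theorem abs_clip_le (N : ℕ) (x : ℝ) : |clip N x| ≤ N := by
  have : (0 : ℝ) ≤ N := Nat.cast_nonneg N
  rw [abs_le, clip]
  exact ⟨le_max_left _ _, max_le (by linarith) (min_le_right _ _)⟩

theorem measurable_clip (N : ℕ) : Measurable (clip N) := by
  unfold clip
  fun_prop

theorem tendsto_clip (x : ℝ) : Tendsto (fun N => clip N x) atTop (𝓝 x) := by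
  refine tendsto_const_nhds.congr' ?_
  filter_upwards [eventually_ge_atTop ⌈|x|⌉₊] with N hN
  have h := (Nat.le_ceil |x|).trans (Nat.cast_le.mpr hN)
  rw [abs_le] at h
  rw [clip, min_eq_left h.2, max_eq_right h.1]

/-- Truncation is monotone and 1-Lipschitz. A lower bound on `x - y` therefore survives truncation
uniformly in `N`, as Fatou's lemma requires. -/
theorem min_sub_zero_le_clip_sub (N : ℕ) (x y : ℝ) : min (x - y) 0 ≤ clip N x - clip N y := by
  unfold clip
  rcases le_total x y with h | h
  · refine (min_le_left _ _).trans ?_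
    have h1 := abs_max_sub_max_le_abs (min y N) (min x (N : ℝ)) (-(N : ℝ))
    have h2 := abs_min_sub_min_le_max y (N : ℝ) x N
    rw [sub_self, abs_zero, max_eq_left (abs_nonneg _), abs_of_nonneg (sub_nonneg.mpr h)] at h2
    have h3 := (le_abs_self _).trans (h1.trans h2)
    rw [max_comm _ (-(N : ℝ)), max_comm _ (-(N : ℝ))] at h3
    linarith
  · refine (min_le_right _ _).trans (sub_nonneg.mpr ?_)
    exact max_le_max le_rfl (min_le_min h le_rfl)

/-- Fatou's lemma for the counting measure. -/
theorem sum_liminf_le {ι : Type*} [Fintype ι] (a : ι → ℕ → ℝ≥0∞) :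
    ∑ k, liminf (a k) atTop ≤ liminf (fun N => ∑ k, a k N) atTop := by
  let _ : MeasurableSpace ι := ⊤
  have h := lintegral_liminf_le (u := atTop) (μ := (Measure.count : Measure ι)) (f := fun N k => a k N)
    fun N => measurable_from_top
  simpa [lintegral_count, tsum_fintype] using h

/-- If the integrable log-likelihood ratios `L k` differ from `A k - B k` by integrable functions,
and the truncated means of the `A k` and of the `B k` balance, then the `A k - B k` contribute
nothing to the sum of the means, even if the `A k` and the `B k` are not integrable. -/
theorem sum_integral_le_of_balanced {ι : Type*} [Fintype ι] {Ω : ι → Type*}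
    [∀ k, MeasurableSpace (Ω k)] (U : ∀ k, Measure (Ω k)) [∀ k, IsProbabilityMeasure (U k)]
    {A B G H L : ∀ k, Ω k → ℝ} (hA : ∀ k, Measurable (A k)) (hB : ∀ k, Measurable (B k))
    (hG : ∀ k, Integrable (G k) (U k)) (hH : ∀ k, Integrable (H k) (U k))
    (hL : ∀ k, L k =ᵐ[U k] fun ω => (A k ω - B k ω) + G k ω)
    (hLH : ∀ k, ∀ᵐ ω ∂(U k), -L k ω ≤ H k ω)
    (hbal : ∀ N : ℕ, ∑ k, ∫ ω, (clip N (A k ω) - clip N (B k ω)) ∂(U k) = 0) :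
    (∀ k, Integrable (L k) (U k)) ∧ ∑ k, ∫ ω, L k ω ∂(U k) ≤ ∑ k, ∫ ω, G k ω ∂(U k) := by
  let D : ∀ k, Ω k → ℝ := fun k ω => |H k ω| + |G k ω|
  have hD : ∀ k, Integrable (D k) (U k) := fun k => (hH k).abs.add (hG k).abs
  have hD0 : ∀ k ω, 0 ≤ D k ω := fun k ω => by positivity
  let f : ∀ k, ℕ → Ω k → ℝ := fun k N ω => clip N (A k ω) - clip N (B k ω)
  have hfm : ∀ k N, Measurable (f k N) := fun k N =>
    ((measurable_clip N).comp (hA k)).sub ((measurable_clip N).comp (hB k))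
  have hf : ∀ k N, Integrable (f k N) (U k) := by
    intro k N
    refine Integrable.of_bound (hfm k N).aestronglyMeasurable (N + N) ?_
    refine Eventually.of_forall fun ω => ?_
    rw [Real.norm_eq_abs]
    exact (abs_sub _ _).trans (add_le_add (abs_clip_le _ _) (abs_clip_le _ _))
  -- The integrable lower bound on `L k` carries over to `A k - B k`, because the two differ by the
  -- integrable `G k`.
  have hAB : ∀ k, ∀ᵐ ω ∂(U k), -D k ω ≤ A k ω - B k ω := by
    intro k
    filter_upwards [hL k, hLH k] with ω h1 h2
    rw [h1] at h2
    have h3 := le_abs_self (H k ω)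
    have h4 := le_abs_self (G k ω)
    simp only [D]
    linarith
  have hfD : ∀ k N, ∀ᵐ ω ∂(U k), 0 ≤ f k N ω + D k ω := by
    intro k N
    filter_upwards [hAB k] with ω h1
    have h2 := min_sub_zero_le_clip_sub N (A k ω) (B k ω)
    have h3 : -D k ω ≤ min (A k ω - B k ω) 0 := le_min h1 (by linarith [hD0 k ω])
    simp only [f]
    linarith
  -- The truncated differences balance exactly, so only the integrals of `D k` remain, whatever `N`
  -- is.
  have hsum : ∀ N, ∑ k, ∫⁻ ω, ENNReal.ofReal (f k N ω + D k ω) ∂(U k) =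
      ENNReal.ofReal (∑ k, ∫ ω, D k ω ∂(U k)) := by
    intro N
    have h1 : ∀ k, ∫⁻ ω, ENNReal.ofReal (f k N ω + D k ω) ∂(U k) =
        ENNReal.ofReal (∫ ω, (f k N ω + D k ω) ∂(U k)) := fun k =>
      (ofReal_integral_eq_lintegral_ofReal ((hf k N).add (hD k)) (hfD k N)).symm
    simp_rw [h1]
    rw [← ENNReal.ofReal_sum_of_nonneg fun k _ => integral_nonneg_of_ae (hfD k N)]
    congr 1
    have h2 : ∀ k, ∫ ω, (f k N ω + D k ω) ∂(U k) = ∫ ω, f k N ω ∂(U k) + ∫ ω, D k ω ∂(U k) :=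
      fun k => integral_add (hf k N) (hD k)
    simp_rw [h2]
    rw [Finset.sum_add_distrib, hbal N, zero_add]
  -- Letting `N` tend to infinity gives integrability of each `A k - B k`, and that their means sum
  -- to at most zero.
  have hfatou : ∀ k, ∫⁻ ω, ENNReal.ofReal (A k ω - B k ω + D k ω) ∂(U k) ≤
      liminf (fun N => ∫⁻ ω, ENNReal.ofReal (f k N ω + D k ω) ∂(U k)) atTop := by
    intro k
    have h1 : ∀ ω, ENNReal.ofReal (A k ω - B k ω + D k ω) =
        liminf (fun N => ENNReal.ofReal (f k N ω + D k ω)) atTop := fun ω =>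
      (((ENNReal.continuous_ofReal.tendsto _).comp
        (((tendsto_clip _).sub (tendsto_clip _)).add_const _)).liminf_eq).symm
    simp_rw [h1]
    exact lintegral_liminf_le' fun N =>
      ((hfm k N).aemeasurable.add (hD k).aemeasurable).ennreal_ofReal
  have hle : ∑ k, ∫⁻ ω, ENNReal.ofReal (A k ω - B k ω + D k ω) ∂(U k) ≤
      ENNReal.ofReal (∑ k, ∫ ω, D k ω ∂(U k)) := by
    refine (Finset.sum_le_sum fun k _ => hfatou k).trans ((sum_liminf_le _).trans ?_)
    simp_rw [hsum]
    simp
  have hABD0 : ∀ k, 0 ≤ᵐ[U k] fun ω => A k ω - B k ω + D k ω := by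
    intro k
    filter_upwards [hAB k] with ω h
    simp only [Pi.zero_apply]
    linarith
  have hABDi : ∀ k, Integrable (fun ω => A k ω - B k ω + D k ω) (U k) := by
    intro k
    refine (lintegral_ofReal_ne_top_iff_integrable (f := fun ω => A k ω - B k ω + D k ω)
      (((hA k).sub (hB k)).aestronglyMeasurable.add (hD k).aestronglyMeasurable) (hABD0 k)).mp ?_
    exact ENNReal.sum_ne_top.mp (ne_top_of_le_ne_top ENNReal.ofReal_ne_top hle) k
      (Finset.mem_univ k)
  have hABi : ∀ k, Integrable (fun ω => A k ω - B k ω) (U k) := fun k =>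
    ((hABDi k).sub (hD k)).congr (Eventually.of_forall fun ω => by simp)
  refine ⟨fun k => ((hABi k).add (hG k)).congr (hL k).symm, ?_⟩
  have h1 : ∀ k, ∫ ω, L k ω ∂(U k) = ∫ ω, (A k ω - B k ω) ∂(U k) + ∫ ω, G k ω ∂(U k) := fun k =>
    (integral_congr_ae (hL k)).trans (integral_add (hABi k) (hG k))
  have h2 : ∀ k, ∫ ω, (A k ω - B k ω + D k ω) ∂(U k) =
      ∫ ω, (A k ω - B k ω) ∂(U k) + ∫ ω, D k ω ∂(U k) := fun k =>
    integral_add (hABi k) (hD k)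
  have h3 : ∀ k, ∫⁻ ω, ENNReal.ofReal (A k ω - B k ω + D k ω) ∂(U k) =
      ENNReal.ofReal (∫ ω, (A k ω - B k ω + D k ω) ∂(U k)) := fun k =>
    (ofReal_integral_eq_lintegral_ofReal (hABDi k) (hABD0 k)).symm
  simp_rw [h3] at hle
  rw [← ENNReal.ofReal_sum_of_nonneg fun k _ => integral_nonneg_of_ae (hABD0 k),
    ENNReal.ofReal_le_ofReal_iff (Finset.sum_nonneg fun k _ => integral_nonneg (hD0 k))] at hle
  simp_rw [h2, Finset.sum_add_distrib] at hle
  simp_rw [h1, Finset.sum_add_distrib]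
  linarith

end Truncation

theorem map_compProd_eq {𝒵 Θ A B : Type*} [MeasurableSpace 𝒵] [MeasurableSpace Θ]
    [MeasurableSpace A] [MeasurableSpace B] {ζ : Measure 𝒵} [SFinite ζ] {J : Kernel 𝒵 Θ}
    [IsSFiniteKernel J] {κ : Kernel A B} [IsSFiniteKernel κ] {f : 𝒵 → A} (hf : Measurable f)
    {g : Θ → B} (hg : Measurable g) (h : ∀ z, (J z).map g = κ (f z)) :
    (ζ ⊗ₘ J).map (fun ω => (f ω.1, g ω.2)) = ζ.map f ⊗ₘ κ := by
  refine Measure.ext_of_lintegral _ fun φ hφ => ?_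
  have hφ' : Measurable fun ω : 𝒵 × Θ => φ (f ω.1, g ω.2) := by fun_prop
  rw [lintegral_map hφ (by fun_prop), Measure.lintegral_compProd hφ',
    Measure.lintegral_compProd hφ, lintegral_map (by fun_prop) hf]
  refine lintegral_congr fun z => ?_
  rw [← h, lintegral_map (by fun_prop) hg]

/-- On a rectangle the discarded coordinate contributes mass one and the new coordinate contributes
the factor that was lost. -/
theorem pi_prod_map_update {K : ℕ} {X : Fin K → Type*} [∀ k, MeasurableSpace (X k)]
    (μ : ∀ k, Measure (X k)) [∀ k, IsProbabilityMeasure (μ k)] (j : Fin K) :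
    ((Measure.pi μ).prod (μ j)).map (fun z => Function.update z.1 j z.2) = Measure.pi μ := by
  have hm : Measurable fun z : (∀ k, X k) × X j => Function.update z.1 j z.2 := by fun_prop
  refine (Measure.pi_eq fun s hs => ?_).symm
  have h : (fun z : (∀ k, X k) × X j => Function.update z.1 j z.2) ⁻¹' Set.univ.pi s =
      (Set.univ.pi (Function.update s j Set.univ)) ×ˢ s j := by
    ext z
    simp only [Set.mem_preimage, Set.mem_pi, Set.mem_univ, true_imp_iff, Set.mem_prod]
    constructor
    · intro h
      refine ⟨fun i => ?_, by simpa using h j⟩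
      by_cases hi : i = j
      · subst hi
        simp
      · simpa [hi] using h i
    · rintro ⟨h1, h2⟩ i
      by_cases hi : i = j
      · subst hi
        simpa using h2
      · simpa [hi] using h1 i
  rw [Measure.map_apply hm (MeasurableSet.univ_pi hs), h, Measure.prod_prod, Measure.pi_pi]
  rw [← Finset.mul_prod_erase _ _ (Finset.mem_univ j),
    ← Finset.mul_prod_erase _ (fun i => μ i (s i)) (Finset.mem_univ j)]
  rw [Function.update_self, measure_univ, one_mul, mul_comm]
  congr 1
  refine Finset.prod_congr rfl fun i hi => ?_
  rw [Function.update_of_ne (Finset.ne_of_mem_erase hi)]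

/-! ### Laws of the inputs and outputs in the second family -/

section Etw

variable {K : ℕ} {X Y : Fin K → Type*} [∀ k, MeasurableSpace (X k)] [∀ k, MeasurableSpace (Y k)]

/-- The law of `(X₁, …, X_K)`. -/
def InputLaw.marginal (P : InputLaw X) : Measure (∀ k, X k) :=
  ((P.law : Measure (Fin P.card)) ⊗ₘ P.inputs).map Prod.snd

/-- The law of `((X₁, …, X_K), X'_j)`. -/
def InputLaw.pairLaw (P : InputLaw X) (j : Fin K) : Measure ((∀ k, X k) × X j) :=
  ((P.law : Measure (Fin P.card)) ⊗ₘ (P.inputs ×ₖ P.single j)).map Prod.snd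

instance (P : InputLaw X) : IsProbabilityMeasure P.marginal :=
  Measure.isProbabilityMeasure_map measurable_snd.aemeasurable

instance (P : InputLaw X) (j : Fin K) : IsProbabilityMeasure (P.pairLaw j) :=
  Measure.isProbabilityMeasure_map measurable_snd.aemeasurable

theorem InputLaw.lintegral_marginal (P : InputLaw X) {f : (∀ k, X k) → ℝ≥0∞} (hf : Measurable f) :
    ∫⁻ x, f x ∂P.marginal =
      ∫⁻ t, ∫⁻ x, f x ∂(P.inputs t) ∂(P.law : Measure (Fin P.card)) := by
  rw [marginal, lintegral_map hf measurable_snd, Measure.lintegral_compProd (by fun_prop)]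

theorem InputLaw.lintegral_pairLaw (P : InputLaw X) (j : Fin K) {f : (∀ k, X k) × X j → ℝ≥0∞}
    (hf : Measurable f) :
    ∫⁻ z, f z ∂P.pairLaw j =
      ∫⁻ t, ∫⁻ z, f z ∂((P.inputs ×ₖ P.single j) t) ∂(P.law : Measure (Fin P.card)) := by
  rw [pairLaw, lintegral_map hf measurable_snd, Measure.lintegral_compProd (by fun_prop)]

theorem InputLaw.pairLaw_map_fst (P : InputLaw X) (j : Fin K) :
    (P.pairLaw j).map Prod.fst = P.marginal := by
  refine Measure.ext_of_lintegral _ fun f hf => ?_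
  rw [lintegral_map hf measurable_fst, P.lintegral_pairLaw j (by fun_prop), P.lintegral_marginal hf]
  refine lintegral_congr fun t => ?_
  rw [Kernel.prod_apply, lintegral_prod _ (by fun_prop)]
  simp

/-- Given `Q`, the input `X'_j` is an independent copy of `X_j`, so the replacement preserves the
product law for each value of `Q`, and hence the average. The cancellation over `S` rests on this.
-/
theorem InputLaw.pairLaw_map_update (P : InputLaw X) (j : Fin K) :
    (P.pairLaw j).map (fun z => Function.update z.1 j z.2) = P.marginal := by
  have hm : Measurable fun z : (∀ k, X k) × X j => Function.update z.1 j z.2 := by fun_prop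
  refine Measure.ext_of_lintegral _ fun f hf => ?_
  rw [lintegral_map hf hm, P.lintegral_pairLaw j (by fun_prop), P.lintegral_marginal hf]
  refine lintegral_congr fun t => ?_
  rw [Kernel.prod_apply]
  have h : ((P.inputs t).prod (P.single j t)).map (fun z => Function.update z.1 j z.2) =
      P.inputs t := pi_prod_map_update (fun k => (P.input t k : Measure (X k))) j
  conv_rhs => rw [← h]
  rw [lintegral_map hf hm]

variable {W : Kernel (∀ k, X k) (∀ k, Y k)} (P : InputLaw X)

/-- The law of `((X, X'_j), (Y_{∖j}, Y_k))`. -/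
def pairOutputLaw {k j : Fin K} (C : OutputCoupling W k j) :
    Measure (((∀ i, X i) × X j) × (Y j × Y k)) :=
  P.pairLaw j ⊗ₘ C.ker.map Prod.swap

instance {k j : Fin K} (C : OutputCoupling W k j) : IsMarkovKernel (C.ker.map Prod.swap) :=
  Kernel.IsMarkovKernel.map _ measurable_swap

instance {k j : Fin K} (C : OutputCoupling W k j) : IsProbabilityMeasure (pairOutputLaw P C) := by
  unfold pairOutputLaw
  infer_instance

instance {k j : Fin K} (C : OutputCoupling W k j) : IsProbabilityMeasure (sideInfoLaw W P C) := by
  unfold sideInfoLaw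
  infer_instance

theorem sideInfoLaw_map {k j : Fin K} (C : OutputCoupling W k j) :
    (sideInfoLaw W P C).map (fun ω => (ω.1.2, ω.2.swap)) = pairOutputLaw P C := by
  rw [sideInfoLaw, map_compProd_eq (κ := C.ker.map Prod.swap) measurable_snd measurable_swap]
  · rfl
  · intro z
    rw [Kernel.map_apply _ measurable_swap]
    rfl

theorem sideInfoLaw_map_comp {k j : Fin K} (C : OutputCoupling W k j) {A : Type*}
    [MeasurableSpace A] {f : ((∀ i, X i) × X j) × (Y j × Y k) → A} (hf : Measurable f) :
    (sideInfoLaw W P C).map (fun ω => f (ω.1.2, ω.2.swap)) = (pairOutputLaw P C).map f := by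
  rw [← sideInfoLaw_map, Measure.map_map hf (by fun_prop)]
  rfl

variable [IsMarkovKernel W]

instance (u : Fin K) : IsMarkovKernel (W.map fun y => y u) :=
  Kernel.IsMarkovKernel.map _ (measurable_pi_apply u)

theorem pairOutputLaw_map_output {k j : Fin K} (C : OutputCoupling W k j) :
    (pairOutputLaw P C).map (fun ω => (ω.1.1, ω.2.2)) =
      P.marginal ⊗ₘ (W.map fun y => y k) := by
  rw [pairOutputLaw, map_compProd_eq (κ := W.map fun y => y k) measurable_fst measurable_snd,
    P.pairLaw_map_fst]
  rintro ⟨x, x'⟩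
  rw [Kernel.map_apply _ measurable_swap, Kernel.map_apply _ (measurable_pi_apply k), ← C.map_fst x x',
    Measure.map_map measurable_snd measurable_swap]
  rfl

theorem pairOutputLaw_map_side {k j : Fin K} (C : OutputCoupling W k j) :
    (pairOutputLaw P C).map (fun ω => (Function.update ω.1.1 j ω.1.2, ω.2.1)) =
      P.marginal ⊗ₘ (W.map fun y => y j) := by
  rw [pairOutputLaw, map_compProd_eq (κ := W.map fun y => y j)
    (f := fun z : (∀ i, X i) × X j => Function.update z.1 j z.2) (by fun_prop) measurable_fst, P.pairLaw_map_update]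
  rintro ⟨x, x'⟩
  rw [Kernel.map_apply _ measurable_swap, Kernel.map_apply _ (measurable_pi_apply j), ← C.map_snd x x',
    Measure.map_map measurable_fst measurable_swap]
  rfl

/-- The conditional density of the side information is pushed forward along the replacement of `X_j`
by `X'_j`. Finiteness of the second entropy thus supplies a transition density for the output of
user `j`. -/
theorem marginal_absolutelyContinuous {k j : Fin K} (C : OutputCoupling W k j)
    (ν : Measure (Y j)) [SigmaFinite ν]
    (h : (pairOutputLaw P C).map (fun ω => ((ω.2.2, ω.1), ω.2.1)) ≪
      ((pairOutputLaw P C).map fun ω => (ω.2.2, ω.1)).prod ν) :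
    P.marginal ⊗ₘ (W.map fun y => y j) ≪ P.marginal.prod ν := by
  have hf : Measurable fun w : Y k × ((∀ i, X i) × X j) => Function.update w.2.1 j w.2.2 := by
    fun_prop
  have h1 := h.map (f := Prod.map (fun w => Function.update w.2.1 j w.2.2) id)
    (hf.prodMap measurable_id)
  rw [← Measure.map_prod_map _ _ hf measurable_id, Measure.map_map (hf.prodMap measurable_id)
    (by fun_prop), Measure.map_map hf (by fun_prop), Measure.map_id] at h1
  have h2 : (pairOutputLaw P C).map (fun ω => Function.update ω.1.1 j ω.1.2) = P.marginal := by
    have h3 := congrArg (fun μ => Measure.map Prod.fst μ) (pairOutputLaw_map_side P C)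
    rw [Measure.map_map measurable_fst (by fun_prop)] at h3
    refine h3.trans ?_
    change Measure.fst _ = _
    rw [Measure.fst_compProd]
  rw [← pairOutputLaw_map_side P C]
  conv_rhs => rw [← h2]
  exact h1

end Etw

/-! ### From relaxed bounds to the second family -/

section EtwBound

variable {K : ℕ} {X Y : Fin K → Type*} [∀ k, MeasurableSpace (X k)] [∀ k, MeasurableSpace (Y k)]
  [∀ k, StandardBorelSpace (Y k)] [∀ k, Nonempty (Y k)] {W : Kernel (∀ k, X k) (∀ k, Y k)}
  [IsMarkovKernel W] (P : InputLaw X)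

/-- The conditional law of `Y_k` given the side information. -/
def sideKernel {k j : Fin K} (C : OutputCoupling W k j) : Kernel (Y j × X j) (Y k) :=
  condDistrib (fun ω => ω.2.1) (fun ω => (ω.2.2, ω.1.2.2)) (sideInfoLaw W P C)

instance {k j : Fin K} (C : OutputCoupling W k j) : IsMarkovKernel (sideKernel P C) := by
  unfold sideKernel
  infer_instance

/-- The law of `((X, X'_j), (Y_{∖j}, Y_k))` under which `Y_k` depends only on the side
information. -/
def pairOutputRef {k j : Fin K} (C : OutputCoupling W k j) :
    Measure (((∀ i, X i) × X j) × (Y j × Y k)) :=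
  P.pairLaw j ⊗ₘ ((C.ker.map Prod.swap).fst ⊗ₖ
    (sideKernel P C).comap (fun p : ((∀ i, X i) × X j) × Y j => (p.2, p.1.2)) (by fun_prop))

instance {k j : Fin K} (C : OutputCoupling W k j) : IsProbabilityMeasure (pairOutputRef P C) := by
  unfold pairOutputRef
  infer_instance

theorem lintegral_etwCost {k j : Fin K} (C : OutputCoupling W k j) :
    ∫⁻ t, ∫⁻ z, etwCost C (sideKernel P C) z ∂((P.inputs ×ₖ P.single j) t)
        ∂(P.law : Measure (Fin P.card)) = klDiv (pairOutputLaw P C) (pairOutputRef P C) := by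
  rw [← P.lintegral_pairLaw j (measurable_etwCost _ _)]
  exact lintegral_sideCost _ _ _

/-- The divergence in question is `I(Y_k; X, X'_j | Y_{∖j}, X'_j)`. Its log-likelihood ratio is the
difference of the two log transition densities plus `G`, where `G` gathers the two conditional
log-densities and has the entropy difference of (b) as its mean. -/
theorem exists_llr_pairOutput {k j : Fin K} (C : OutputCoupling W k j) {νk : Measure (Y k)}
    [SigmaFinite νk] {νj : Measure (Y j)} [SigmaFinite νj]
    (h1 : HasCondEntropy (sideInfoLaw W P C) νk (fun ω => ω.2.1) (fun ω => (ω.2.2, ω.1.2.2)))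
    (h2 : HasCondEntropy (sideInfoLaw W P C) νj (fun ω => ω.2.2)
      (fun ω => (ω.2.1, ω.1.2.1, ω.1.2.2)))
    {gk : (∀ i, X i) × Y k → ℝ≥0∞} (hgk : Measurable gk)
    (hk : ∀ᵐ x ∂P.marginal, W.map (fun y => y k) x = νk.withDensity fun y => gk (x, y))
    {gj : (∀ i, X i) × Y j → ℝ≥0∞} (hgj : Measurable gj)
    (hj : ∀ᵐ x ∂P.marginal, W.map (fun y => y j) x = νj.withDensity fun y => gj (x, y)) :
    pairOutputLaw P C ≪ pairOutputRef P C ∧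
    ∃ G : ((∀ i, X i) × X j) × (Y j × Y k) → ℝ, Integrable G (pairOutputLaw P C) ∧
      ∫ ω, G ω ∂(pairOutputLaw P C) =
        condEntropy (sideInfoLaw W P C) νk (fun ω => ω.2.1) (fun ω => (ω.2.2, ω.1.2.2)) -
          condEntropy (sideInfoLaw W P C) νj (fun ω => ω.2.2)
            (fun ω => (ω.2.1, ω.1.2.1, ω.1.2.2)) ∧
      llr (pairOutputLaw P C) (pairOutputRef P C) =ᵐ[pairOutputLaw P C] fun ω =>
        (Real.log (gk (ω.1.1, ω.2.2)).toReal -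
          Real.log (gj (Function.update ω.1.1 j ω.1.2, ω.2.1)).toReal) + G ω := by
  let χ : ((∀ i, X i) × X j) × Y j → Y j × X j := fun p => (p.2, p.1.2)
  have hχ : Measurable χ := by simp only [χ]; fun_prop
  have m1 : Measurable fun ω : ((∀ i, X i) × X j) × (Y j × Y k) => (χ (ω.1, ω.2.1), ω.2.2) := by
    fun_prop
  have m1' : Measurable fun ω : ((∀ i, X i) × X j) × (Y j × Y k) => χ (ω.1, ω.2.1) := by
    fun_prop
  have m2 : Measurable fun ω : ((∀ i, X i) × X j) × (Y j × Y k) => ((ω.2.2, ω.1), ω.2.1) := by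
    fun_prop
  have m2' : Measurable fun ω : ((∀ i, X i) × X j) × (Y j × Y k) => (ω.2.2, ω.1) := by
    fun_prop
  have e1 := sideInfoLaw_map_comp P C m1
  have e1' := sideInfoLaw_map_comp P C m1'
  have e2 := sideInfoLaw_map_comp P C m2
  have e2' := sideInfoLaw_map_comp P C m2'
  obtain ⟨a1, i1⟩ := h1
  obtain ⟨a2, i2⟩ := h2
  have hκ : (pairOutputLaw P C).map (fun ω => (χ (ω.1, ω.2.1), ω.2.2)) =
      (pairOutputLaw P C).map (fun ω => χ (ω.1, ω.2.1)) ⊗ₘ sideKernel P C := by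
    rw [← e1, ← e1']
    exact (compProd_map_condDistrib (by fun_prop)).symm
  have hV : ∀ᵐ z ∂(P.pairLaw j), (C.ker.map Prod.swap).fst z =
      νj.withDensity fun v => gj (Function.update z.1 j z.2, v) := by
    rw [← P.pairLaw_map_update j] at hj
    filter_upwards [ae_of_ae_map (by fun_prop) hj] with z hz
    rw [← hz, Kernel.fst_apply, Kernel.map_apply _ measurable_swap,
      Kernel.map_apply _ (measurable_pi_apply j), ← C.map_snd,
      Measure.map_map measurable_fst measurable_swap]
    rfl
  have hY : ∀ᵐ z ∂(P.pairLaw j), (C.ker.map Prod.swap).snd z =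
      νk.withDensity fun y => gk (z.1, y) := by
    rw [← P.pairLaw_map_fst j] at hk
    filter_upwards [ae_of_ae_map (by fun_prop) hk] with z hz
    rw [← hz, Kernel.snd_apply, Kernel.map_apply _ measurable_swap,
      Kernel.map_apply _ (measurable_pi_apply k), ← C.map_fst z.1 z.2,
      Measure.map_map measurable_snd measurable_swap]
    rfl
  have b1 : (pairOutputLaw P C).map (fun ω => (χ (ω.1, ω.2.1), ω.2.2)) ≪
      ((pairOutputLaw P C).map fun ω => χ (ω.1, ω.2.1)).prod νk := by
    rw [← e1, ← e1']
    exact a1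
  have b2 : (pairOutputLaw P C).map (fun ω => ((ω.2.2, ω.1), ω.2.1)) ≪
      ((pairOutputLaw P C).map fun ω => (ω.2.2, ω.1)).prod νj := by
    rw [← e2, ← e2']
    exact a2
  have j1 : Integrable (llr ((pairOutputLaw P C).map fun ω => (χ (ω.1, ω.2.1), ω.2.2))
      (((pairOutputLaw P C).map fun ω => χ (ω.1, ω.2.1)).prod νk))
      ((pairOutputLaw P C).map fun ω => (χ (ω.1, ω.2.1), ω.2.2)) := by
    rw [← e1, ← e1']
    exact i1
  have j2 : Integrable (llr ((pairOutputLaw P C).map fun ω => ((ω.2.2, ω.1), ω.2.1))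
      (((pairOutputLaw P C).map fun ω => (ω.2.2, ω.1)).prod νj))
      ((pairOutputLaw P C).map fun ω => ((ω.2.2, ω.1), ω.2.1)) := by
    rw [← e2, ← e2']
    exact i2
  have c1 : condEntropy (sideInfoLaw W P C) νk (fun ω => ω.2.1) (fun ω => (ω.2.2, ω.1.2.2)) =
      -∫ w, llr ((pairOutputLaw P C).map fun ω => (χ (ω.1, ω.2.1), ω.2.2))
      (((pairOutputLaw P C).map fun ω => χ (ω.1, ω.2.1)).prod νk) w
      ∂((pairOutputLaw P C).map fun ω => (χ (ω.1, ω.2.1), ω.2.2)) := by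
    rw [← e1, ← e1']
    rfl
  have c2 : condEntropy (sideInfoLaw W P C) νj (fun ω => ω.2.2)
      (fun ω => (ω.2.1, ω.1.2.1, ω.1.2.2)) =
      -∫ w, llr ((pairOutputLaw P C).map fun ω => ((ω.2.2, ω.1), ω.2.1))
      (((pairOutputLaw P C).map fun ω => (ω.2.2, ω.1)).prod νj) w
      ∂((pairOutputLaw P C).map fun ω => ((ω.2.2, ω.1), ω.2.1)) := by
    rw [← e2, ← e2']
    rfl
  obtain ⟨hac, hllr⟩ := llr_compProd_eq hχ hκ
    (gV := fun p => gj (Function.update p.1.1 j p.1.2, p.2)) (by fun_prop) hV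
    (gY := fun p => gk (p.1.1, p.2)) (by fun_prop) hY b1 b2
  refine ⟨hac, _, ?_, ?_, hllr⟩
  · exact (j2.comp_measurable m2).sub (j1.comp_measurable m1)
  · rw [c1, c2, integral_map m1.aemeasurable j1.aestronglyMeasurable,
      integral_map m2.aemeasurable j2.aestronglyMeasurable]
    refine (integral_sub (j2.comp_measurable m2) (j1.comp_measurable m1)).trans ?_
    simp only [Function.comp_apply]
    ring

/-- With `q` equal to the conditional law given the side information, the relaxed bound is a sum of
divergences. The log transition densities cancel over `S` after truncation, and the entropies
remain. -/
theorem RelaxedBounds.etwBound {R : Fin K → ℝ} {P : InputLaw X} (h : RelaxedBounds W P R)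
    (ν : ∀ k, Measure (Y k)) [∀ k, SigmaFinite (ν k)] (S : Finset (Fin K))
    (π : Fin S.card ≃ S) : EtwBound W ν P S π R := by
  intro C hC
  have hR := h.etw S π C (fun k => sideKernel P (C k)) fun k => inferInstance
  rw [lintegral_finsetSum _ fun k _ => measurable_of_countable _] at hR
  simp_rw [lintegral_etwCost] at hR
  have hg : ∀ u : Fin K, ∃ g : (∀ i, X i) × Y u → ℝ≥0∞, Measurable g ∧ (u ∈ S →
      ∀ᵐ x ∂P.marginal, W.map (fun y => y u) x = (ν u).withDensity fun y => g (x, y)) := by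
    intro u
    by_cases hu : u ∈ S
    · obtain ⟨k, hk⟩ := π.surjective ⟨u, hu⟩
      obtain rfl : (π k : Fin K) = u := by rw [hk]
      have e2 := sideInfoLaw_map_comp P (C k) (f := fun ω => ((ω.2.2, ω.1), ω.2.1)) (by fun_prop)
      have e2' := sideInfoLaw_map_comp P (C k) (f := fun ω => (ω.2.2, ω.1)) (by fun_prop)
      have hac := (hC k).2.1
      obtain ⟨g, hg, hg'⟩ := exists_kernel_density P.marginal (W.map fun y => y (π k)) (ν (π k))
        (marginal_absolutelyContinuous P (C k) (ν (π k)) (by rw [← e2, ← e2']; exact hac))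
      exact ⟨g, hg, fun _ => hg'⟩
    · exact ⟨fun _ => 0, measurable_const, fun h => absurd h hu⟩
  choose g hgm hg using hg
  have hmem : ∀ k : Fin S.card, S.orderEmbOfFin rfl k ∈ S := fun k => S.orderEmbOfFin_mem rfl k
  have hdata := fun k => exists_llr_pairOutput P (C k) (hC k).1 (hC k).2 (hgm _)
    (hg _ (hmem k)) (hgm _) (hg _ (π k).2)
  choose hac G hGi hGint hllr using hdata
  have hlog : ∀ u, Measurable fun p : (∀ i, X i) × Y u => Real.log (g u p).toReal := fun u =>
    Real.measurable_log.comp (hgm u).ennreal_toReal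
  have hsum := sum_integral_le_of_balanced (fun k => pairOutputLaw P (C k))
    (A := fun k ω => Real.log (g (S.orderEmbOfFin rfl k) (ω.1.1, ω.2.2)).toReal)
    (B := fun k ω => Real.log (g (π k) (Function.update ω.1.1 (π k) ω.1.2, ω.2.1)).toReal)
    (fun k => (hlog _).comp (by fun_prop)) (fun k => (hlog _).comp (by fun_prop)) hGi
    (fun k => integrable_inv_rnDeriv (hac k)) hllr
    (fun k => Eventually.of_forall fun ω => neg_llr_le _ _ ω) (by
      intro N
      have hb : ∀ u, Measurable fun p : (∀ i, X i) × Y u => clip N (Real.log (g u p).toReal) :=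
        fun u => (measurable_clip N).comp (hlog u)
      have hbi : ∀ u (μ : Measure ((∀ i, X i) × Y u)) [IsProbabilityMeasure μ],
          Integrable (fun p => clip N (Real.log (g u p).toReal)) μ := fun u μ _ =>
        Integrable.of_bound (hb u).aestronglyMeasurable N
          (Eventually.of_forall fun p => abs_clip_le _ _)
      have h1 : ∀ k : Fin S.card, ∫ ω, (clip N (Real.log (g (S.orderEmbOfFin rfl k)
          (ω.1.1, ω.2.2)).toReal) - clip N (Real.log (g (π k)
          (Function.update ω.1.1 (π k).1 ω.1.2, ω.2.1)).toReal)) ∂(pairOutputLaw P (C k)) =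
          ∫ p, clip N (Real.log (g (S.orderEmbOfFin rfl k) p).toReal)
            ∂(P.marginal ⊗ₘ (W.map fun y => y (S.orderEmbOfFin rfl k))) -
          ∫ p, clip N (Real.log (g (π k) p).toReal)
            ∂(P.marginal ⊗ₘ (W.map fun y => y (π k).1)) := by
        intro k
        have n1 : Measurable fun ω : ((∀ i, X i) × X (π k)) ×
            (Y (π k) × Y (S.orderEmbOfFin rfl k)) => (ω.1.1, ω.2.2) := by fun_prop
        have n2 : Measurable fun ω : ((∀ i, X i) × X (π k)) ×
            (Y (π k) × Y (S.orderEmbOfFin rfl k)) =>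
              (Function.update ω.1.1 (π k).1 ω.1.2, ω.2.1) := by fun_prop
        rw [← pairOutputLaw_map_output P (C k), ← pairOutputLaw_map_side P (C k),
          integral_map n1.aemeasurable (hb _).aestronglyMeasurable,
          integral_map n2.aemeasurable (hb _).aestronglyMeasurable]
        refine integral_sub ?_ ?_
        · have := Measure.isProbabilityMeasure_map (μ := pairOutputLaw P (C k)) n1.aemeasurable
          exact (hbi _ ((pairOutputLaw P (C k)).map _)).comp_measurable n1
        · have := Measure.isProbabilityMeasure_map (μ := pairOutputLaw P (C k)) n2.aemeasurable
          exact (hbi _ ((pairOutputLaw P (C k)).map _)).comp_measurable n2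
      simp_rw [h1]
      rw [Finset.sum_sub_distrib, sub_eq_zero]
      -- Each user of `S` contributes the same truncated mean once with each sign.
      exact sum_orderEmbOfFin_eq π fun u => ∫ p, clip N (Real.log (g u p).toReal)
            ∂(P.marginal ⊗ₘ (W.map fun y => y u)))
  obtain ⟨hLi, hLle⟩ := hsum
  have hkl : ∀ k, klDiv (pairOutputLaw P (C k)) (pairOutputRef P (C k)) =
      ENNReal.ofReal (∫ ω, llr (pairOutputLaw P (C k)) (pairOutputRef P (C k)) ω
        ∂(pairOutputLaw P (C k))) := by
    intro k
    rw [klDiv_of_ac_of_integrable (hac k) (hLi k)]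
    simp
  have hpos : ∀ k, 0 ≤ ∫ ω, llr (pairOutputLaw P (C k)) (pairOutputRef P (C k)) ω
        ∂(pairOutputLaw P (C k)) := by
    intro k
    have := integral_llr_add_sub_measure_univ_nonneg (hac k) (hLi k)
    simpa using this
  simp_rw [hkl] at hR
  rw [← ENNReal.ofReal_sum_of_nonneg fun k _ => hpos k,
    ENNReal.ofReal_le_ofReal_iff (Finset.sum_nonneg fun k _ => hpos k)] at hR
  refine hR.trans (hLle.trans (le_of_eq ?_))
  exact Finset.sum_congr rfl fun k _ => hGint k

theorem setOf_relaxedBounds_subset_outerRegion (W : Kernel (∀ k, X k) (∀ k, Y k))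
    [IsMarkovKernel W] (ν : ∀ k, Measure (Y k)) [∀ k, SigmaFinite (ν k)] :
    {R | ∃ P : InputLaw X, RelaxedBounds W P R} ⊆ outerRegion W ν := by
  rintro R ⟨P, h⟩
  exact Set.mem_iUnion.mpr ⟨P, Set.mem_iInter₂.mpr fun S π =>
    ⟨h.kramerBound S π, h.etwBound ν S π⟩⟩

end EtwBound

/-! ### Compact convex hulls in finite dimension -/

theorem isCompact_convexHull_of_isCompact {E : Type*} [NormedAddCommGroup E] [NormedSpace ℝ E]
    [FiniteDimensional ℝ E] {s : Set E} (hs : IsCompact s) : IsCompact (convexHull ℝ s) := by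
  rcases s.eq_empty_or_nonempty with rfl | ⟨x₀, hx₀⟩
  · simp
  -- Carathéodory's number of points. Shorter combinations are padded with weight zero at `x₀`, so
  -- the hull is the continuous image of one compact set.
  let d := Module.finrank ℝ E + 1
  let f : (Fin d → ℝ) × (Fin d → E) → E := fun p => ∑ i, p.1 i • p.2 i
  have hf : Continuous f := by
    simp only [f]
    fun_prop
  have hc : IsCompact (stdSimplex ℝ (Fin d) ×ˢ (Set.univ.pi fun _ : Fin d => s)) :=
    (isCompact_stdSimplex ℝ _).prod (isCompact_univ_pi fun _ => hs)
  convert hc.image hf using 1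
  ext x
  constructor
  · intro hx
    obtain ⟨ι, _, z, w, hz, hind, hw, hw1, hx⟩ := eq_pos_convex_span_of_mem_convexHull hx
    have hcard : Fintype.card ι ≤ Fintype.card (Fin d) := by
      rw [Fintype.card_fin]
      refine hind.card_le_finrank_succ.trans (Nat.succ_le_succ ?_)
      exact Submodule.finrank_le _
    obtain ⟨e⟩ := Function.Embedding.nonempty_of_card_le hcard
    have hzs : ∀ l, z l ∈ s := fun l => hz (Set.mem_range_self l)
    have hout : ∀ i, i ∉ Set.range e → Function.extend e w 0 i = 0 := fun i hi =>
      Function.extend_apply' _ _ _ hi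
    refine ⟨(Function.extend e w 0, Function.extend e z fun _ => x₀), ⟨⟨fun i => ?_, ?_⟩, ?_⟩, ?_⟩
    · by_cases hi : i ∈ Set.range e
      · obtain ⟨l, rfl⟩ := hi
        simpa [e.injective.extend_apply] using (hw l).le
      · exact (hout i hi).ge
    · rw [← hw1]
      refine (Finset.sum_of_injOn e e.injective.injOn (by simp) (fun i _ hi => hout i ?_)
        fun l _ => (e.injective.extend_apply _ _ _).symm).symm
      simpa using hi
    · intro i _
      by_cases hi : i ∈ Set.range e
      · obtain ⟨l, rfl⟩ := hi
        simpa [e.injective.extend_apply] using hzs l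
      · simpa [Function.extend_apply' _ _ _ hi] using hx₀
    · rw [← hx]
      refine (Finset.sum_of_injOn e e.injective.injOn (by simp) (fun i _ hi => ?_)
        fun l _ => ?_).symm
      · change Function.extend e w 0 i • _ = 0
        rw [hout i (by simpa using hi), zero_smul]
      · change _ = Function.extend e w 0 (e l) • Function.extend e z (fun _ => x₀) (e l)
        rw [e.injective.extend_apply, e.injective.extend_apply]
  · rintro ⟨p, ⟨hp, hz⟩, rfl⟩
    exact mem_convexHull_of_exists_fintype p.1 p.2 hp.1 hp.2 (fun i => hz i trivial) rfl

/-! ### Probability measures on finite sets -/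

section Discrete

/-- The probability measure with the given weights. -/
def weighted {α : Type*} [Fintype α] [MeasurableSpace α] (θ : α → ℝ) : Measure α :=
  ∑ x, ENNReal.ofReal (θ x) • Measure.dirac x

theorem isProbabilityMeasure_weighted {α : Type*} [Fintype α] [MeasurableSpace α] {θ : α → ℝ}
    (h : θ ∈ stdSimplex ℝ α) : IsProbabilityMeasure (weighted θ) := by
  constructor
  simp only [weighted, Measure.coe_finsetSum, Finset.sum_apply, Measure.smul_apply, measure_univ,
    smul_eq_mul, mul_one]
  rw [← ENNReal.ofReal_sum_of_nonneg fun x _ => h.1 x, h.2, ENNReal.ofReal_one]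

theorem lintegral_weighted {α : Type*} [Fintype α] [MeasurableSpace α] (θ : α → ℝ) {f : α → ℝ≥0∞}
    (hf : Measurable f) : ∫⁻ x, f x ∂(weighted θ) = ∑ x, ENNReal.ofReal (θ x) * f x := by
  rw [weighted, lintegral_finsetSum_measure]
  refine Finset.sum_congr rfl fun x _ => ?_
  rw [lintegral_smul_measure, lintegral_dirac' _ hf, smul_eq_mul]

/-- Every probability measure on a finite set, with an arbitrary `σ`-algebra, is given by
weights. -/
theorem exists_weighted_eq {α : Type*} [Fintype α] [MeasurableSpace α] (μ : Measure α)
    [IsProbabilityMeasure μ] : ∃ θ ∈ stdSimplex ℝ α, μ = weighted θ := by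
  classical
  -- Points of one measurable atom cannot be separated, so `r` picks a representative of each atom
  -- and the mass of the atom is placed there. Singletons need not be measurable.
  let r : α → α := fun x => Quotient.out (Quotient.mk (Setoid.ker (measurableAtom (β := α))) x)
  have hr : ∀ x, measurableAtom (r x) = measurableAtom x := fun x =>
    Quotient.exact (s := Setoid.ker (measurableAtom (β := α))) (Quotient.out_eq _)
  have hrc : ∀ x y, measurableAtom x = measurableAtom y → r x = r y := fun x y h =>
    congrArg Quotient.out (Quotient.sound (s := Setoid.ker (measurableAtom (β := α))) h)
  have hfib : ∀ x, MeasurableSet (r ⁻¹' {x}) := by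
    intro x
    by_cases hx : r x = x
    · have : r ⁻¹' {x} = measurableAtom x := by
        ext y
        constructor
        · intro hy
          have : measurableAtom y = measurableAtom x := by rw [← hr y, show r y = x from hy]
          rw [← this]
          exact mem_measurableAtom_self y
        · intro hy
          exact (hrc _ _ (measurableAtom_eq_of_mem hy)).trans hx
      rw [this]
      exact MeasurableSet.measurableAtom_of_countable x
    · have : r ⁻¹' {x} = ∅ := by
        ext y
        simp only [Set.mem_preimage, Set.mem_singleton_iff, Set.mem_empty_iff_false, iff_false]
        rintro rfl
        exact hx (hrc _ _ (hr y))
      rw [this]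
      exact MeasurableSet.empty
  have hmem : ∀ {A : Set α}, MeasurableSet A → ∀ y, r y ∈ A ↔ y ∈ A := by
    intro A hA y
    have h1 : y ∈ measurableAtom (r y) := by rw [hr]; exact mem_measurableAtom_self y
    have h2 : r y ∈ measurableAtom y := by rw [← hr]; exact mem_measurableAtom_self _
    exact ⟨fun h => measurableAtom_subset hA h h1, fun h => measurableAtom_subset hA h h2⟩
  have hsum : ∀ {A : Set α}, MeasurableSet A → μ A = ∑ x with x ∈ A, μ (r ⁻¹' {x}) := by
    intro A hA
    rw [sum_measure_preimage_singleton _ fun x _ => hfib x]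
    congr 1
    ext y
    simp [hmem hA y]
  refine ⟨fun x => μ.real (r ⁻¹' {x}), ⟨fun x => measureReal_nonneg, ?_⟩, ?_⟩
  · have h := hsum MeasurableSet.univ
    simp only [measure_univ, Set.mem_univ, Finset.filter_true] at h
    simp only [Measure.real]
    rw [← ENNReal.toReal_sum fun x _ => measure_ne_top _ _, ← h, ENNReal.toReal_one]
  · ext A hA
    rw [hsum hA, weighted]
    simp only [Measure.coe_finsetSum, Finset.sum_apply, Measure.smul_apply, smul_eq_mul,
      Measure.dirac_apply' _ hA]
    rw [Finset.sum_filter]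
    refine Finset.sum_congr rfl fun x _ => ?_
    by_cases hx : x ∈ A <;> simp [hx]

end Discrete

/-! ### Mixing kernels to make all costs finite -/

section Smoothing

variable {𝒳 𝒱 𝒴 𝒞 : Type*} [MeasurableSpace 𝒳] [MeasurableSpace 𝒱] [MeasurableSpace 𝒴]
  [MeasurableSpace 𝒞]

/-- The mixture of two kernels with weights `1 - δ` and `δ`. -/
def mixKernel (δ : ℝ) (q u : Kernel 𝒞 𝒴) : Kernel 𝒞 𝒴 where
  toFun c := ENNReal.ofReal (1 - δ) • q c + ENNReal.ofReal δ • u c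
  measurable' := by
    refine Measure.measurable_of_measurable_coe _ fun s hs => ?_
    simp only [Measure.add_apply, Measure.smul_apply, smul_eq_mul]
    exact ((q.measurable_coe hs).const_mul _).add ((u.measurable_coe hs).const_mul _)

theorem mixKernel_apply (δ : ℝ) (q u : Kernel 𝒞 𝒴) (c : 𝒞) :
    mixKernel δ q u c = ENNReal.ofReal (1 - δ) • q c + ENNReal.ofReal δ • u c := rfl

theorem isMarkovKernel_mixKernel {δ : ℝ} (h0 : 0 ≤ δ) (h1 : δ ≤ 1) (q u : Kernel 𝒞 𝒴)
    [IsMarkovKernel q] [IsMarkovKernel u] : IsMarkovKernel (mixKernel δ q u) := by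
  refine ⟨fun c => ⟨?_⟩⟩
  simp only [mixKernel_apply, Measure.add_apply, Measure.smul_apply, measure_univ, smul_eq_mul,
    mul_one]
  rw [← ENNReal.ofReal_add (sub_nonneg.mpr h1) h0, sub_add_cancel, ENNReal.ofReal_one]

theorem sideCost_le_add_log {J : Kernel 𝒳 (𝒱 × 𝒴)} [IsMarkovKernel J] {q q' : Kernel 𝒞 𝒴}
    [IsMarkovKernel q] [IsMarkovKernel q'] {χ : 𝒳 × 𝒱 → 𝒞} (hχ : Measurable χ) {c : ℝ} (hc : 0 < c)
    (h : ∀ a, ENNReal.ofReal c • q a ≤ q' a) (x : 𝒳) :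
    sideCost J (q'.comap χ hχ) x ≤
      sideCost J (q.comap χ hχ) x + ENNReal.ofReal (-Real.log c) := by
  rw [sideCost_eq, sideCost_eq]
  refine klDiv_le_add_log hc (Measure.le_iff.mpr fun s hs => ?_)
  rw [Measure.smul_apply, smul_eq_mul, Measure.compProd_apply hs, Measure.compProd_apply hs,
    ← lintegral_const_mul _ (Kernel.measurable_kernel_prodMk_left hs)]
  exact lintegral_mono fun v => h (χ (x, v)) _

theorem sideCost_mixKernel_le {J : Kernel 𝒳 (𝒱 × 𝒴)} [IsMarkovKernel J] {q u : Kernel 𝒞 𝒴}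
    [IsMarkovKernel q] [IsMarkovKernel u] {χ : 𝒳 × 𝒱 → 𝒞} (hχ : Measurable χ) {δ : ℝ}
    (h0 : 0 < δ) (h1 : δ < 1) (x : 𝒳) :
    sideCost J ((mixKernel δ q u).comap χ hχ) x ≤
        sideCost J (q.comap χ hχ) x + ENNReal.ofReal (-Real.log (1 - δ)) ∧
      sideCost J ((mixKernel δ q u).comap χ hχ) x ≤
        sideCost J (u.comap χ hχ) x + ENNReal.ofReal (-Real.log δ) := by
  have := isMarkovKernel_mixKernel h0.le h1.le q u
  refine ⟨sideCost_le_add_log hχ (sub_pos.mpr h1) (fun a => ?_) x,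
    sideCost_le_add_log hχ h0 (fun a => ?_) x⟩
  · exact Measure.le_add_right le_rfl
  · exact Measure.le_add_left le_rfl

/-- If there are finitely many inputs, then some kernel has a finite cost for all of them. -/
theorem exists_sideCost_ne_top [Fintype 𝒳] [StandardBorelSpace 𝒱] [Nonempty 𝒱]
    [StandardBorelSpace 𝒴] [Nonempty 𝒴]
    (J : Kernel 𝒳 (𝒱 × 𝒴)) [IsMarkovKernel J] {χ : 𝒳 × 𝒱 → 𝒞} (hχ : Measurable χ) {p : 𝒞 → 𝒱}
    (hp : Measurable p) (hpχ : ∀ x v, p (χ (x, v)) = v) :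
    ∃ u : Kernel 𝒞 𝒴, IsMarkovKernel u ∧ ∀ x, sideCost J (u.comap χ hχ) x ≠ ∞ := by
  rcases isEmpty_or_nonempty 𝒳 with h | h
  · obtain ⟨y⟩ := ‹Nonempty 𝒴›
    exact ⟨Kernel.const _ (Measure.dirac y), inferInstance, fun x => h.elim x⟩
  have hm : ∀ x, Measurable fun w : 𝒱 × 𝒴 => (χ (x, w.1), w.2) := fun x => by fun_prop
  let L : 𝒳 → Measure (𝒞 × 𝒴) := fun x => (J x).map fun w => (χ (x, w.1), w.2)
  have hL : ∀ x, IsProbabilityMeasure (L x) := fun x =>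
    Measure.isProbabilityMeasure_map (hm x).aemeasurable
  have hfin := fun x => klDiv_uniformMix_ne_top L x
  -- Each `L x` has finite divergence from the uniform mixture over inputs, and the chain rule
  -- bounds by it the divergence of the conditional part.
  refine ⟨(uniformMix L).condKernel, inferInstance, fun x => ?_⟩
  have hchain : klDiv (L x) ((L x).fst ⊗ₘ (uniformMix L).condKernel) ≠ ∞ := by
    have h1 := klDiv_compProd_eq_add (μ := (L x).fst) (ν := (uniformMix L).fst)
      (κ := (L x).condKernel) (η := (uniformMix L).condKernel)
    rw [Measure.disintegrate, Measure.disintegrate] at h1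
    exact ne_top_of_le_ne_top (hfin x) (h1 ▸ le_add_self)
  rw [sideCost_eq]
  rw [← klDiv_map_of_leftInverse (f := fun w : 𝒱 × 𝒴 => (χ (x, w.1), w.2))
    (g := fun c => (p c.1, c.2)) (hm x) (by fun_prop) fun w => by simp [hpχ]]
  convert hchain using 2
  have hχx : Measurable fun v => χ (x, v) := by fun_prop
  have h2 : (L x).fst = (J x).fst.map fun v => χ (x, v) := by
    simp only [L]
    rw [Measure.fst, Measure.map_map measurable_fst (hm x), Measure.fst,
      Measure.map_map hχx measurable_fst]
    rfl
  rw [h2]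
  exact map_compProd_eq hχx measurable_id fun v => by
    rw [Measure.map_id]
    rfl

end Smoothing

/-! ### Finite-cost kernels for the two families -/

section FullKernels

variable {K : ℕ} {X Y : Fin K → Type*} [∀ k, MeasurableSpace (X k)] [∀ k, MeasurableSpace (Y k)]
  [∀ k, StandardBorelSpace (Y k)] [∀ k, Nonempty (Y k)] [∀ k, Fintype (X k)]

theorem exists_kramerCost_ne_top (W : Kernel (∀ k, X k) (∀ k, Y k)) [IsMarkovKernel W]
    {S : Finset (Fin K)} (π : Fin S.card ≃ S) (k : Fin S.card) :
    ∃ u : Kernel (KramerCond X Y π k) (Y (π k)), IsMarkovKernel u ∧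
      ∀ x, kramerCost π k W u x ≠ ∞ :=
  exists_sideCost_ne_top (kramerJoint π k W) (measurable_kramerCond π k) (p := fun c => c.2.1)
    (by fun_prop) fun x v => rfl

theorem exists_etwCost_ne_top {W : Kernel (∀ k, X k) (∀ k, Y k)} {k j : Fin K}
    (C : OutputCoupling W k j) :
    ∃ u : Kernel (Y j × X j) (Y k), IsMarkovKernel u ∧ ∀ z, etwCost C u z ≠ ∞ :=
  exists_sideCost_ne_top (C.ker.map Prod.swap)
    (χ := fun p : ((∀ i, X i) × X j) × Y j => (p.2, p.1.2)) (by fun_prop) (p := fun c => c.1)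
    (by fun_prop) fun x v => rfl

theorem kramerCost_mixKernel_le (W : Kernel (∀ k, X k) (∀ k, Y k)) [IsMarkovKernel W]
    {S : Finset (Fin K)} (π : Fin S.card ≃ S) (k : Fin S.card)
    (q u : Kernel (KramerCond X Y π k) (Y (π k))) [IsMarkovKernel q] [IsMarkovKernel u] {δ : ℝ}
    (h0 : 0 < δ) (h1 : δ < 1) (x : ∀ k, X k) :
    kramerCost π k W (mixKernel δ q u) x ≤
        kramerCost π k W q x + ENNReal.ofReal (-Real.log (1 - δ)) ∧
      kramerCost π k W (mixKernel δ q u) x ≤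
        kramerCost π k W u x + ENNReal.ofReal (-Real.log δ) :=
  sideCost_mixKernel_le (J := kramerJoint π k W) (measurable_kramerCond π k) h0 h1 x

theorem etwCost_mixKernel_le {W : Kernel (∀ k, X k) (∀ k, Y k)} {k j : Fin K}
    (C : OutputCoupling W k j) (q u : Kernel (Y j × X j) (Y k)) [IsMarkovKernel q]
    [IsMarkovKernel u] {δ : ℝ} (h0 : 0 < δ) (h1 : δ < 1) (z : (∀ i, X i) × X j) :
    etwCost C (mixKernel δ q u) z ≤ etwCost C q z + ENNReal.ofReal (-Real.log (1 - δ)) ∧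
      etwCost C (mixKernel δ q u) z ≤ etwCost C u z + ENNReal.ofReal (-Real.log δ) :=
  sideCost_mixKernel_le (J := C.ker.map Prod.swap)
    (χ := fun p : ((∀ i, X i) × X j) × Y j => (p.2, p.1.2)) (by fun_prop) h0 h1 z

end FullKernels

/-! ### Costs as finite sums over the inputs -/

section FiniteAlphabets

variable {K : ℕ} {X Y : Fin K → Type*} [∀ k, MeasurableSpace (X k)] [∀ k, MeasurableSpace (Y k)]
  [∀ k, StandardBorelSpace (Y k)] [∀ k, Nonempty (Y k)] [∀ k, Fintype (X k)]
  {W : Kernel (∀ k, X k) (∀ k, Y k)} [IsMarkovKernel W]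

theorem le_of_forall_le_add_log {a b : ℝ≥0∞} (n : ℕ)
    (h : ∀ δ : ℝ, 0 < δ → δ < 1 → a ≤ b + n * ENNReal.ofReal (-Real.log (1 - δ))) : a ≤ b := by
  have hlim : Tendsto (fun δ : ℝ => b + n * ENNReal.ofReal (-Real.log (1 - δ))) (𝓝[>] 0)
      (𝓝 (b + n * ENNReal.ofReal (-Real.log (1 - 0)))) := by
    refine Tendsto.mono_left ?_ nhdsWithin_le_nhds
    refine tendsto_const_nhds.add (ENNReal.Tendsto.const_mul ?_ (Or.inr (ENNReal.natCast_ne_top n)))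
    refine ENNReal.tendsto_ofReal ?_
    exact ((Real.continuousAt_log (by norm_num)).comp
      (continuousAt_const.sub continuousAt_id)).neg
  rw [sub_zero, Real.log_one, neg_zero, ENNReal.ofReal_zero, mul_zero, add_zero] at hlim
  refine ge_of_tendsto hlim ?_
  filter_upwards [Ioo_mem_nhdsGT (zero_lt_one' ℝ)] with δ hδ
  exact h δ hδ.1 hδ.2

/-- It suffices to check the relaxed bounds for kernels with finite costs. -/
theorem RelaxedBounds.of_ne_top {P : InputLaw X} {R : Fin K → ℝ}
    (hk : ∀ (S : Finset (Fin K)) (π : Fin S.card ≃ S)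
      (q : Fin P.card → ∀ k, Kernel (KramerCond X Y π k) (Y (π k))),
      (∀ t k, IsMarkovKernel (q t k)) → (∀ t k x, kramerCost π k W (q t k) x ≠ ∞) →
      ENNReal.ofReal (∑ u ∈ S, R u) ≤
        ∫⁻ t, ∑ k, ∫⁻ x, kramerCost π k W (q t k) x ∂(P.inputs t) ∂(P.law : Measure (Fin P.card)))
    (he : ∀ (S : Finset (Fin K)) (π : Fin S.card ≃ S)
      (C : ∀ k : Fin S.card, OutputCoupling W (S.orderEmbOfFin rfl k) (π k))
      (q : ∀ k : Fin S.card, Kernel (Y (π k) × X (π k)) (Y (S.orderEmbOfFin rfl k))),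
      (∀ k, IsMarkovKernel (q k)) → (∀ k z, etwCost (C k) (q k) z ≠ ∞) →
      ENNReal.ofReal (∑ u ∈ S, R u) ≤
        ∫⁻ t, ∑ k, ∫⁻ z, etwCost (C k) (q k) z ∂((P.inputs ×ₖ P.single (π k)) t)
          ∂(P.law : Measure (Fin P.card))) : RelaxedBounds W P R := by
  constructor
  · intro S π q hq
    choose u hu hu' using exists_kramerCost_ne_top W π
    -- Mixing in weight `δ` of the kernel `u` makes every cost finite and raises each of the
    -- `S.card` terms by at most `-log (1 - δ)`, which vanishes with `δ`.
    refine le_of_forall_le_add_log S.card fun δ h0 h1 => ?_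
    have hmix : ∀ t k, IsMarkovKernel (mixKernel δ (q t k) (u k)) := fun t k =>
      isMarkovKernel_mixKernel h0.le h1.le _ _
    refine (hk S π (fun t k => mixKernel δ (q t k) (u k)) hmix fun t k x =>
      ne_top_of_le_ne_top (ENNReal.add_ne_top.mpr ⟨hu' k x, ENNReal.ofReal_ne_top⟩)
        (kramerCost_mixKernel_le W π k _ _ h0 h1 x).2).trans ?_
    calc _ ≤ ∫⁻ t, (∑ k, ∫⁻ x, kramerCost π k W (q t k) x ∂(P.inputs t) +
          S.card * ENNReal.ofReal (-Real.log (1 - δ))) ∂(P.law : Measure (Fin P.card)) := by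
          refine lintegral_mono fun t => ?_
          calc _ ≤ ∑ k, ∫⁻ x, (kramerCost π k W (q t k) x +
                ENNReal.ofReal (-Real.log (1 - δ))) ∂(P.inputs t) :=
                Finset.sum_le_sum fun k _ => lintegral_mono fun x =>
                  (kramerCost_mixKernel_le W π k _ _ h0 h1 x).1
            _ = _ := by
                simp_rw [lintegral_add_right _ measurable_const, lintegral_const, measure_univ,
                  mul_one, Finset.sum_add_distrib, Finset.sum_const, Finset.card_univ,
                  Fintype.card_fin, nsmul_eq_mul]
      _ = _ := by
          rw [lintegral_add_right _ measurable_const, lintegral_const, measure_univ, mul_one]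
  · intro S π C q hq
    choose u hu hu' using fun k => exists_etwCost_ne_top (C k)
    refine le_of_forall_le_add_log S.card fun δ h0 h1 => ?_
    have hmix : ∀ k, IsMarkovKernel (mixKernel δ (q k) (u k)) := fun k =>
      isMarkovKernel_mixKernel h0.le h1.le _ _
    refine (he S π C (fun k => mixKernel δ (q k) (u k)) hmix fun k z =>
      ne_top_of_le_ne_top (ENNReal.add_ne_top.mpr ⟨hu' k z, ENNReal.ofReal_ne_top⟩)
        (etwCost_mixKernel_le (C k) _ _ h0 h1 z).2).trans ?_
    calc _ ≤ ∫⁻ t, (∑ k, ∫⁻ z, etwCost (C k) (q k) z ∂((P.inputs ×ₖ P.single (π k)) t) +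
          S.card * ENNReal.ofReal (-Real.log (1 - δ))) ∂(P.law : Measure (Fin P.card)) := by
          refine lintegral_mono fun t => ?_
          calc _ ≤ ∑ k, ∫⁻ z, (etwCost (C k) (q k) z +
                ENNReal.ofReal (-Real.log (1 - δ))) ∂((P.inputs ×ₖ P.single (π k)) t) :=
                Finset.sum_le_sum fun k _ => lintegral_mono fun z =>
                  (etwCost_mixKernel_le (C k) _ _ h0 h1 z).1
            _ = _ := by
                simp_rw [lintegral_add_right _ measurable_const, lintegral_const, measure_univ,
                  mul_one, Finset.sum_add_distrib, Finset.sum_const, Finset.card_univ,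
                  Fintype.card_fin, nsmul_eq_mul]
      _ = _ := by
          rw [lintegral_add_right _ measurable_const, lintegral_const, measure_univ, mul_one]

/-- The weight of an input vector for independent inputs. -/
def prodWeight (θ : ∀ k, X k → ℝ) (x : ∀ k, X k) : ℝ := ∏ k, θ k (x k)

/-- The weight of an input vector and a further independent input. -/
def pairWeight (θ : ∀ k, X k → ℝ) (i : Σ j : Fin K, (∀ k, X k) × X j) : ℝ :=
  prodWeight θ i.2.1 * θ i.1 i.2.2

variable {θ : ∀ k, X k → ℝ}

theorem prodWeight_nonneg (hθ : ∀ k, θ k ∈ stdSimplex ℝ (X k)) (x : ∀ k, X k) :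
    0 ≤ prodWeight θ x := Finset.prod_nonneg fun k _ => (hθ k).1 _

theorem pairWeight_nonneg (hθ : ∀ k, θ k ∈ stdSimplex ℝ (X k))
    (i : Σ j : Fin K, (∀ k, X k) × X j) : 0 ≤ pairWeight θ i :=
  mul_nonneg (prodWeight_nonneg hθ _) ((hθ _).1 _)

theorem prodWeight_le_one (hθ : ∀ k, θ k ∈ stdSimplex ℝ (X k)) (x : ∀ k, X k) :
    prodWeight θ x ≤ 1 := by
  refine Finset.prod_le_one (fun k _ => (hθ k).1 _) fun k _ => ?_
  rw [← (hθ k).2]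
  exact Finset.single_le_sum (fun y _ => (hθ k).1 y) (Finset.mem_univ _)

theorem InputLaw.lintegral_inputs_weighted {P : InputLaw X} {t : Fin P.card}
    (hθ : ∀ k, θ k ∈ stdSimplex ℝ (X k))
    (hP : ∀ k, (P.input t k : Measure (X k)) = weighted (θ k)) {f : (∀ k, X k) → ℝ≥0∞}
    (hf : Measurable f) (hfin : ∀ x, f x ≠ ∞) :
    ∫⁻ x, f x ∂(P.inputs t) = ENNReal.ofReal (∑ x, prodWeight θ x * (f x).toReal) := by
  have h1 : P.inputs t = ∑ x : ∀ k, X k, (∏ k, ENNReal.ofReal (θ k (x k))) • Measure.dirac x := by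
    have : ∀ k, IsProbabilityMeasure (∑ x, ENNReal.ofReal (θ k x) • Measure.dirac x) :=
      fun k => isProbabilityMeasure_weighted (hθ k)
    change Measure.pi (fun k => (P.input t k : Measure (X k))) = _
    simp_rw [hP]
    exact pi_sum_smul_dirac (fun k x => ENNReal.ofReal (θ k x)) fun k x => x
  rw [h1, lintegral_finsetSum_measure, ENNReal.ofReal_sum_of_nonneg fun x _ =>
    mul_nonneg (prodWeight_nonneg hθ x) ENNReal.toReal_nonneg]
  refine Finset.sum_congr rfl fun x _ => ?_
  rw [lintegral_smul_measure, lintegral_dirac' _ hf, smul_eq_mul,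
    ENNReal.ofReal_mul (prodWeight_nonneg hθ x), ENNReal.ofReal_toReal (hfin x), prodWeight,
    ENNReal.ofReal_prod_of_nonneg fun k _ => (hθ k).1 _]

theorem InputLaw.lintegral_pair_weighted {P : InputLaw X} {t : Fin P.card}
    (hθ : ∀ k, θ k ∈ stdSimplex ℝ (X k))
    (hP : ∀ k, (P.input t k : Measure (X k)) = weighted (θ k)) (j : Fin K)
    {f : (∀ k, X k) × X j → ℝ≥0∞} (hf : Measurable f) (hfin : ∀ x, f x ≠ ∞) :
    ∫⁻ z, f z ∂((P.inputs ×ₖ P.single j) t) =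
      ENNReal.ofReal (∑ z, pairWeight θ ⟨j, z⟩ * (f z).toReal) := by
  have h1 : P.single j t = weighted (θ j) := hP j
  rw [P.lintegral_inputs_prod_single t j hf, h1,
    lintegral_weighted _ (InputLaw.measurable_lintegral_inputs P t hf),
    ENNReal.ofReal_sum_of_nonneg fun z _ =>
      mul_nonneg (pairWeight_nonneg hθ _) ENNReal.toReal_nonneg,
    Fintype.sum_prod_type_right]
  refine Finset.sum_congr rfl fun x' _ => ?_
  rw [P.lintegral_inputs_weighted hθ hP (f := fun x => f (x, x')) (by fun_prop) fun x => hfin _,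
    ← ENNReal.ofReal_mul ((hθ j).1 x'), Finset.mul_sum,
    ENNReal.ofReal_sum_of_nonneg fun x _ => mul_nonneg ((hθ j).1 x')
      (mul_nonneg (prodWeight_nonneg hθ x) ENNReal.toReal_nonneg)]
  refine Finset.sum_congr rfl fun x _ => ?_
  congr 1
  simp only [pairWeight]
  ring

theorem InputLaw.lintegral_law_ofReal (P : InputLaw X) {f : Fin P.card → ℝ} (hf : ∀ t, 0 ≤ f t) :
    ∫⁻ t, ENNReal.ofReal (f t) ∂(P.law : Measure (Fin P.card)) =
      ENNReal.ofReal (∑ t, (P.law : Measure (Fin P.card)).real {t} * f t) := by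
  rw [lintegral_fintype, ENNReal.ofReal_sum_of_nonneg fun t _ =>
    mul_nonneg measureReal_nonneg (hf t)]
  refine Finset.sum_congr rfl fun t _ => ?_
  rw [ENNReal.ofReal_mul measureReal_nonneg, ofReal_measureReal, mul_comm]

variable {P : InputLaw X} {θs : Fin P.card → ∀ k, X k → ℝ}

theorem InputLaw.kramer_sum_eq (hθ : ∀ t k, θs t k ∈ stdSimplex ℝ (X k))
    (hP : ∀ t k, (P.input t k : Measure (X k)) = weighted (θs t k))
    {S : Finset (Fin K)} (π : Fin S.card ≃ S)
    (q : Fin P.card → ∀ k, Kernel (KramerCond X Y π k) (Y (π k)))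
    [∀ t k, IsMarkovKernel (q t k)] (hq : ∀ t k x, kramerCost π k W (q t k) x ≠ ∞) :
    ∫⁻ t, ∑ k, ∫⁻ x, kramerCost π k W (q t k) x ∂(P.inputs t)
        ∂(P.law : Measure (Fin P.card)) =
      ENNReal.ofReal (∑ t, (P.law : Measure (Fin P.card)).real {t} *
        ∑ x, prodWeight (θs t) x * ∑ k, (kramerCost π k W (q t k) x).toReal) := by
  rw [← P.lintegral_law_ofReal fun t => Finset.sum_nonneg fun x _ =>
    mul_nonneg (prodWeight_nonneg (hθ t) x) (Finset.sum_nonneg fun k _ => ENNReal.toReal_nonneg)]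
  refine lintegral_congr fun t => ?_
  have h : ∀ k, ∫⁻ x, kramerCost π k W (q t k) x ∂(P.inputs t) =
      ENNReal.ofReal (∑ x, prodWeight (θs t) x * (kramerCost π k W (q t k) x).toReal) := fun k =>
    P.lintegral_inputs_weighted (hθ t) (hP t) (measurable_kramerCost W π k _) (hq t k)
  simp_rw [h]
  rw [← ENNReal.ofReal_sum_of_nonneg fun k _ => Finset.sum_nonneg fun x _ =>
    mul_nonneg (prodWeight_nonneg (hθ t) x) ENNReal.toReal_nonneg, Finset.sum_comm]
  simp_rw [Finset.mul_sum]

/-- As `q` does not depend on the value of `Q`, the average over `Q` can be taken inside. The second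
family sees the input law only through the averaged pair weights. -/
theorem InputLaw.etw_sum_eq (hθ : ∀ t k, θs t k ∈ stdSimplex ℝ (X k))
    (hP : ∀ t k, (P.input t k : Measure (X k)) = weighted (θs t k))
    {S : Finset (Fin K)} (π : Fin S.card ≃ S)
    (C : ∀ k : Fin S.card, OutputCoupling W (S.orderEmbOfFin rfl k) (π k))
    (q : ∀ k : Fin S.card, Kernel (Y (π k) × X (π k)) (Y (S.orderEmbOfFin rfl k)))
    [∀ k, IsMarkovKernel (q k)] (hq : ∀ k z, etwCost (C k) (q k) z ≠ ∞) :
    ∫⁻ t, ∑ k, ∫⁻ z, etwCost (C k) (q k) z ∂((P.inputs ×ₖ P.single (π k)) t)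
        ∂(P.law : Measure (Fin P.card)) =
      ENNReal.ofReal (∑ k, ∑ z, (∑ t, (P.law : Measure (Fin P.card)).real {t} *
        pairWeight (θs t) ⟨π k, z⟩) * (etwCost (C k) (q k) z).toReal) := by
  have h : ∀ t k, ∫⁻ z, etwCost (C k) (q k) z ∂((P.inputs ×ₖ P.single (π k)) t) =
      ENNReal.ofReal (∑ z, pairWeight (θs t) ⟨π k, z⟩ * (etwCost (C k) (q k) z).toReal) := fun t k =>
    P.lintegral_pair_weighted (hθ t) (hP t) (π k) (measurable_etwCost _ _) (hq k)
  have h0 : ∀ t (k : Fin S.card), 0 ≤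
      ∑ z, pairWeight (θs t) ⟨π k, z⟩ * (etwCost (C k) (q k) z).toReal := fun t k =>
    Finset.sum_nonneg fun z _ => mul_nonneg (pairWeight_nonneg (hθ t) _) ENNReal.toReal_nonneg
  have h2 : ∀ t, ∑ k, ENNReal.ofReal
      (∑ z, pairWeight (θs t) ⟨π k, z⟩ * (etwCost (C k) (q k) z).toReal) = ENNReal.ofReal
      (∑ k, ∑ z, pairWeight (θs t) ⟨π k, z⟩ * (etwCost (C k) (q k) z).toReal) := fun t =>
    (ENNReal.ofReal_sum_of_nonneg fun k _ => h0 t k).symm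
  simp_rw [h, h2]
  rw [P.lintegral_law_ofReal fun t => Finset.sum_nonneg fun k _ => h0 t k]
  congr 1
  simp_rw [Finset.mul_sum, Finset.sum_mul]
  rw [Finset.sum_comm]
  refine Finset.sum_congr rfl fun k _ => ?_
  rw [Finset.sum_comm]
  simp_rw [mul_assoc]

end FiniteAlphabets

/-- The projection of a closed set along a compact set is closed. -/
theorem isClosed_setOf_exists_mem_of_isCompact {A E : Type*} [TopologicalSpace A]
    [TopologicalSpace E] {s : Set E} (hs : IsCompact s) {p : A → E → Prop}
    (hp : IsClosed {z : A × E | p z.1 z.2}) : IsClosed {a | ∃ c ∈ s, p a c} := by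
  have : CompactSpace s := isCompact_iff_compactSpace.mp hs
  have h := isClosedMap_fst_of_compactSpace (X := A) (Y := s) _
    (hp.preimage (Continuous.prodMap continuous_id continuous_subtype_val))
  convert h using 1
  ext a
  simp [-Prod.map_fst]

/-! ### Closedness of the relaxed region for finite input alphabets -/

section Closedness

variable {K : ℕ} {X Y : Fin K → Type*} [∀ k, MeasurableSpace (X k)] [∀ k, MeasurableSpace (Y k)]
  [∀ k, StandardBorelSpace (Y k)] [∀ k, Nonempty (Y k)] [∀ k, Fintype (X k)]
  (W : Kernel (∀ k, X k) (∀ k, Y k)) [IsMarkovKernel W]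

/-- The finite total costs, as functions of the inputs, of the first family of bounds. -/
def kramerFamily {S : Finset (Fin K)} (π : Fin S.card ≃ S) : Set ((∀ k, X k) → ℝ) :=
  {a | ∃ q : ∀ k, Kernel (KramerCond X Y π k) (Y (π k)), (∀ k, IsMarkovKernel (q k)) ∧
    (∀ k x, kramerCost π k W (q k) x ≠ ∞) ∧
    a = fun x => ∑ k, (kramerCost π k W (q k) x).toReal}

theorem kramerFamily_nonempty {S : Finset (Fin K)} (π : Fin S.card ≃ S) :
    (kramerFamily W π).Nonempty := by
  choose u hu hu' using exists_kramerCost_ne_top W π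
  exact ⟨_, u, hu, hu', rfl⟩

variable {W} in
theorem kramerFamily_nonneg {S : Finset (Fin K)} {π : Fin S.card ≃ S} {a : (∀ k, X k) → ℝ}
    (ha : a ∈ kramerFamily W π) (x : ∀ k, X k) : 0 ≤ a x := by
  obtain ⟨q, -, -, rfl⟩ := ha
  exact Finset.sum_nonneg fun k _ => ENNReal.toReal_nonneg

variable {W} in
theorem sum_prodWeight_mul_nonneg {θ : ∀ k, X k → ℝ} (hθ : ∀ k, θ k ∈ stdSimplex ℝ (X k))
    {S : Finset (Fin K)} {π : Fin S.card ≃ S} {a : (∀ k, X k) → ℝ} (ha : a ∈ kramerFamily W π) :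
    0 ≤ ∑ x, prodWeight θ x * a x :=
  Finset.sum_nonneg fun x _ => mul_nonneg (prodWeight_nonneg hθ x) (kramerFamily_nonneg ha x)

/-- The pair laws of product inputs, with lower bounds for the total costs of the first family. -/
def weightBoundPairs : Set (((Σ j : Fin K, (∀ k, X k) × X j) → ℝ) ×
    ((Σ S : Finset (Fin K), (Fin S.card ≃ S)) → ℝ)) :=
  {c | ∃ θ : ∀ k, X k → ℝ, (∀ k, θ k ∈ stdSimplex ℝ (X k)) ∧ c.1 = pairWeight θ ∧
    ∀ i, 0 ≤ c.2 i ∧ ∀ a ∈ kramerFamily W i.2, c.2 i ≤ ∑ x, prodWeight θ x * a x}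

/-- For a fixed cost function `a` each constraint compares a coordinate with a polynomial in `θ`, so
it is closed; infima over kernels need not be continuous in `θ`, which is why lower bounds are
recorded instead. One finite cost `a₀` bounds these coordinates from above. -/
theorem isCompact_weightBoundPairs : IsCompact (weightBoundPairs W) := by
  choose a₀ ha₀ using fun i : Σ S : Finset (Fin K), (Fin S.card ≃ S) => kramerFamily_nonempty W i.2
  let A : Set ((∀ k, X k → ℝ) × ((Σ S : Finset (Fin K), (Fin S.card ≃ S)) → ℝ)) :=
    (Set.univ.pi fun k => stdSimplex ℝ (X k)) ×ˢ
      (Set.univ.pi fun i => Set.Icc 0 (∑ x, a₀ i x))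
  have hA : IsCompact A := (isCompact_univ_pi fun k => isCompact_stdSimplex ℝ (X k)).prod
    (isCompact_univ_pi fun i => isCompact_Icc)
  let B : Set ((∀ k, X k → ℝ) × ((Σ S : Finset (Fin K), (Fin S.card ≃ S)) → ℝ)) :=
    {p | ∀ i, ∀ a ∈ kramerFamily W i.2, p.2 i ≤ ∑ x, prodWeight p.1 x * a x}
  have hB : IsClosed B := by
    simp only [B, Set.ofPred_forall]
    refine isClosed_iInter fun i => isClosed_iInter fun a => isClosed_iInter fun ha =>
      isClosed_le (by fun_prop) ?_
    unfold prodWeight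
    fun_prop
  have himage : weightBoundPairs W =
      (fun p : (∀ k, X k → ℝ) × ((Σ S : Finset (Fin K), (Fin S.card ≃ S)) → ℝ) =>
        (pairWeight p.1, p.2)) '' (A ∩ B) := by
    ext c
    constructor
    · rintro ⟨θ, hθ, h1, h2⟩
      refine ⟨(θ, c.2), ⟨⟨fun k _ => hθ k, fun i _ => ⟨(h2 i).1, ?_⟩⟩, fun i => (h2 i).2⟩,
        Prod.ext h1.symm rfl⟩
      refine ((h2 i).2 _ (ha₀ i)).trans (Finset.sum_le_sum fun x _ => ?_)
      exact mul_le_of_le_one_left (kramerFamily_nonneg (ha₀ i) x) (prodWeight_le_one hθ x)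
    · rintro ⟨⟨θ, y⟩, ⟨⟨h1, h2⟩, h3⟩, rfl⟩
      exact ⟨θ, fun k => h1 k trivial, rfl, fun i => ⟨(h2 i trivial).1, h3 i⟩⟩
  rw [himage]
  refine (hA.inter_right hB).image (Continuous.prodMk ?_ continuous_snd)
  unfold pairWeight prodWeight
  fun_prop

/-- A description of the rate tuples that satisfy the relaxed bounds, with the time-sharing variable
replaced by a point of a compact convex set. -/
theorem setOf_relaxedBounds_eq :
    {R : Fin K → ℝ | ∃ P : InputLaw X, RelaxedBounds W P R} =
      {R | ∃ c ∈ convexHull ℝ (weightBoundPairs W),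
        (∀ i : Σ S : Finset (Fin K), (Fin S.card ≃ S), ∑ u ∈ i.1, R u ≤ c.2 i) ∧
        ∀ (S : Finset (Fin K)) (π : Fin S.card ≃ S)
          (C : ∀ k : Fin S.card, OutputCoupling W (S.orderEmbOfFin rfl k) (π k))
          (q : ∀ k : Fin S.card, Kernel (Y (π k) × X (π k)) (Y (S.orderEmbOfFin rfl k))),
          (∀ k, IsMarkovKernel (q k)) → (∀ k z, etwCost (C k) (q k) z ≠ ∞) →
          ∑ u ∈ S, R u ≤ ∑ k, ∑ z, c.1 ⟨π k, z⟩ * (etwCost (C k) (q k) z).toReal} := by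
  ext R
  constructor
  · rintro ⟨P, hP⟩
    choose θs hθ hPθ using fun t k => exists_weighted_eq (P.input t k : Measure (X k))
    have hlaw : ∑ t, (P.law : Measure (Fin P.card)).real {t} = 1 := by
      rw [sum_measureReal_singleton, Finset.coe_univ, probReal_univ]
    let I := Σ S : Finset (Fin K), (Fin S.card ≃ S)
    -- The best lower bound at a given value of `Q` is the infimum over all kernels of finite cost.
    let V : Fin P.card → I → Set ℝ := fun t i =>
      (fun a : (∀ k, X k) → ℝ => ∑ x, prodWeight (θs t) x * a x) '' kramerFamily W i.2
    have hV : ∀ t i, (V t i).Nonempty := fun t i => (kramerFamily_nonempty W i.2).image _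
    have hV0 : ∀ t i, ∀ v ∈ V t i, 0 ≤ v := by
      rintro t i _ ⟨a, ha, rfl⟩
      exact sum_prodWeight_mul_nonneg (hθ t) ha
    let p : Fin P.card → ((Σ j : Fin K, (∀ k, X k) × X j) → ℝ) × (I → ℝ) := fun t =>
      (pairWeight (θs t), fun i => sInf (V t i))
    have hp : ∀ t, p t ∈ weightBoundPairs W := fun t =>
      ⟨θs t, hθ t, rfl, fun i => ⟨le_csInf (hV t i) (hV0 t i), fun a ha =>
        csInf_le ⟨0, hV0 t i⟩ ⟨a, ha, rfl⟩⟩⟩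
    refine ⟨∑ t, (P.law : Measure (Fin P.card)).real {t} • p t, ?_, ?_, ?_⟩
    · exact mem_convexHull_of_exists_fintype _ p (fun t => measureReal_nonneg) hlaw hp rfl
    · intro i
      -- A kernel within `ε` of the infimum is chosen separately for each value of `Q`, so the
      -- infimum need not be attained.
      refine le_of_forall_pos_le_add fun ε hε => ?_
      have h1 : ∀ t, ∃ q : ∀ k, Kernel (KramerCond X Y i.2 k) (Y (i.2 k)),
          (∀ k, IsMarkovKernel (q k)) ∧ (∀ k x, kramerCost i.2 k W (q k) x ≠ ∞) ∧
          ∑ x, prodWeight (θs t) x * ∑ k, (kramerCost i.2 k W (q k) x).toReal <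
            sInf (V t i) + ε := by
        intro t
        obtain ⟨_, ⟨a, ⟨q, hq, hq', rfl⟩, rfl⟩, hlt⟩ :=
          exists_lt_of_csInf_lt (hV t i) (lt_add_of_pos_right (sInf (V t i)) hε)
        exact ⟨q, hq, hq', hlt⟩
      choose q hq hq' hlt using h1
      have h2 := hP.kramer i.1 i.2 q hq
      rw [P.kramer_sum_eq hθ hPθ i.2 q hq', ENNReal.ofReal_le_ofReal_iff
        (Finset.sum_nonneg fun t _ => mul_nonneg measureReal_nonneg
          (sum_prodWeight_mul_nonneg (hθ t) ⟨q t, hq t, hq' t, rfl⟩))] at h2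
      refine h2.trans ?_
      calc _ ≤ ∑ t, (P.law : Measure (Fin P.card)).real {t} * (sInf (V t i) + ε) :=
            Finset.sum_le_sum fun t _ => mul_le_mul_of_nonneg_left (hlt t).le measureReal_nonneg
        _ = _ := by
          simp only [mul_add, Finset.sum_add_distrib, ← Finset.sum_mul, hlaw, one_mul]
          simp [Prod.snd_sum, p]
    · intro S π C q hq hq'
      have h2 := hP.etw S π C q hq
      rw [P.etw_sum_eq hθ hPθ π C q hq', ENNReal.ofReal_le_ofReal_iff
        (Finset.sum_nonneg fun k _ => Finset.sum_nonneg fun z _ => mul_nonneg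
          (Finset.sum_nonneg fun t _ => mul_nonneg measureReal_nonneg (pairWeight_nonneg (hθ t) _))
          ENNReal.toReal_nonneg)] at h2
      refine h2.trans_eq ?_
      simp [Prod.fst_sum, p]
  · rintro ⟨c, hc, hk, he⟩
    obtain ⟨ι, _, w, p, hw0, hw1, hp, rfl⟩ := mem_convexHull_iff_exists_fintype.mp hc
    let e := Fintype.equivFin ι
    choose θ hθ hθ1 hθ2 using hp
    have hw : (fun t => w (e.symm t)) ∈ stdSimplex ℝ (Fin (Fintype.card ι)) :=
      ⟨fun t => hw0 _, by rw [← hw1, Equiv.sum_comp e.symm w]⟩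
    let P : InputLaw X := ⟨Fintype.card ι, ⟨weighted _, isProbabilityMeasure_weighted hw⟩,
      fun t k => ⟨weighted (θ (e.symm t) k), isProbabilityMeasure_weighted (hθ _ k)⟩⟩
    have hreal : ∀ t, (P.law : Measure (Fin P.card)).real {t} = w (e.symm t) := by
      intro t
      change (weighted fun t => w (e.symm t)).real {t} = _
      rw [measureReal_def, ← lintegral_indicator_one (measurableSet_singleton t),
        lintegral_weighted _ (measurable_one.indicator (measurableSet_singleton t)),
        Finset.sum_eq_single t]
      · simp [hw0]
      · intro s _ hs
        simp [hs]
      · simp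
    have hPθ : ∀ t k, (P.input t k : Measure (X k)) = weighted (θ (e.symm t) k) := fun t k => rfl
    refine ⟨P, RelaxedBounds.of_ne_top ?_ ?_⟩
    · intro S π q hq hq'
      rw [P.kramer_sum_eq (fun t => hθ (e.symm t)) hPθ π q hq']
      refine ENNReal.ofReal_le_ofReal ((hk ⟨S, π⟩).trans ?_)
      have h1 : (∑ i, w i • p i).2 ⟨S, π⟩ = ∑ t, w (e.symm t) * (p (e.symm t)).2 ⟨S, π⟩ := by
        rw [Equiv.sum_comp e.symm fun i => w i * (p i).2 ⟨S, π⟩]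
        simp [Prod.snd_sum]
      rw [h1]
      refine Finset.sum_le_sum fun t _ => ?_
      rw [hreal]
      exact mul_le_mul_of_nonneg_left
        ((hθ2 (e.symm t) ⟨S, π⟩).2 _ ⟨q t, hq t, hq' t, rfl⟩) (hw0 _)
    · intro S π C q hq hq'
      rw [P.etw_sum_eq (fun t => hθ (e.symm t)) hPθ π C q hq']
      refine ENNReal.ofReal_le_ofReal ((he S π C q hq hq').trans_eq ?_)
      refine Finset.sum_congr rfl fun k _ => Finset.sum_congr rfl fun z _ => ?_
      congr 1
      simp_rw [hreal]
      refine Eq.trans ?_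
        (Equiv.sum_comp e.symm fun i => w i * pairWeight (θ i) ⟨(π k : Fin K), z⟩).symm
      simp [Prod.fst_sum, hθ1]

/-- The inequalities are linear in the rates and in `c` jointly, hence closed, and `c` ranges over
the convex hull of a compact set. The outer region does not lend itself to this directly, because
the couplings for which (b) is imposed vary with the input law. -/
theorem isClosed_setOf_relaxedBounds :
    IsClosed {R : Fin K → ℝ | ∃ P : InputLaw X, RelaxedBounds W P R} := by
  rw [setOf_relaxedBounds_eq]
  refine isClosed_setOf_exists_mem_of_isCompact
    (isCompact_convexHull_of_isCompact (isCompact_weightBoundPairs W)) ?_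
  rw [Set.ofPred_and]
  refine IsClosed.inter ?_ ?_
  · simp only [Set.ofPred_forall]
    exact isClosed_iInter fun i => isClosed_le (by fun_prop) (by fun_prop)
  · simp only [Set.ofPred_forall]
    exact isClosed_iInter fun S => isClosed_iInter fun π => isClosed_iInter fun C =>
      isClosed_iInter fun q => isClosed_iInter fun _ => isClosed_iInter fun _ =>
      isClosed_le (by fun_prop) (by fun_prop)

end Closedness

end InterferenceChannel

end

theorem theorem1 {K : ℕ} (hK : 2 ≤ K) {X Y : Fin K → Type*}
    [∀ k, MeasurableSpace (X k)] [∀ k, MeasurableSpace (Y k)]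
    [∀ k, StandardBorelSpace (Y k)] [∀ k, Nonempty (Y k)]
    (W : Kernel (∀ k, X k) (∀ k, Y k)) [IsMarkovKernel W]
    (ν : ∀ k, Measure (Y k)) [∀ k, SigmaFinite (ν k)] :
    InterferenceChannel.capacityRegion W ⊆
        closure (InterferenceChannel.outerRegion W ν) ∧
      ((∀ k, Finite (X k)) →
        InterferenceChannel.capacityRegion W ⊆ InterferenceChannel.outerRegion W ν) := by
  have h₁ := InterferenceChannel.capacityRegion_subset_closure W
  have h₂ := InterferenceChannel.setOf_relaxedBounds_subset_outerRegion W ν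
  refine ⟨h₁.trans (closure_mono h₂), fun hX => ?_⟩
  have := fun k => Fintype.ofFinite (X k)
  rw [(InterferenceChannel.isClosed_setOf_relaxedBounds W).closure_eq] at h₁
  exact h₁.trans h₂
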